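/- **Setting.** Let $X$ be a finite set. An energy $e$ on $X$ is given by conductances $C_{x,y}=C_{y,x}\ge 0$ with $C_{x,x}=0$ and a killing measure $\kappa_x\ge 0$ such that $\lambda_x=\kappa_x+\sum_y C_{x,y}>0$ for all $x$ and, for some $\varepsilon>0$, $e(z)=\frac12\sum_{x,y}C_{x,y}|z^x-z^y|^2+\sum_x\kappa_x|z^x|^2\ \ge\ \varepsilon\sum_x\lambda_x|z^x|^2$ for all $z\in\mathbb C^X$. A loop is a finite cyclic sequence of points $\xi_i$ with holding times $\tau_i>0$, up to rotation; a loop with one point is called trivial. For a loop $l$, let $\hat l_x=\sum_i 1_{\{\xi_i=x\}}\tau_i$, let $N_{x,y}(l)=\#\{i:\xi_i=x,\ \xi_{i+1}=y\}$ if $l$ is non trivial and $N_{x,y}(l)=0$ if $l$ is trivial, and let $N_x=\sum_yN_{x,y}$. The loop measure of $e$ is $$\mu=\sum_{x\in X}e^{-\lambda_x\tau}\frac{d\tau}{\tau}+\sum_{p\ge2}\frac1p\sum_{(\xi_i)\in X^p}\ \prod_{i\in\mathbb Z/p\mathbb Z}C_{\xi_i,\xi_{i+1}}e^{-\lambda_{\xi_i}\tau_i}d\tau_i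 ,$$ and, for $\alpha>0$, $\mathcal L_\alpha$ is a Poisson process of loops with intensity $\alpha\mu$. Let $F\subseteq X$ and $D=X\setminus F$. Put $G^D=[(M_\lambda-C)|_{D\times D}]^{-1}$, where $M_\lambda$ is the diagonal matrix with entries $\lambda_x$, and $\mathcal Z_{e^D}=\det G^D$. For $x,y\in F$ put $$C^{\{F\}}_{x,y}=C_{x,y}+\sum_{a,b\in D}C_{x,a}C_{b,y}[G^D]^{a,b}\ (x\ne y),\qquad C^{\{F\}}_{x,x}=0,\qquad \lambda^{\{F\}}_x=\lambda_x-\sum_{a,b\in D}C_{x,a}C_{b,x}[G^D]^{a,b}.$$ The trace $l^{\{F\}}$ on $F$ of a loop $l$ that hits $F$ is the loop obtained from $l$ by deleting the points outside $F$ with their holding times and merging successive visits of the same point (adding the times). Let $\mathcal L_\alpha^{\{F\}}=\{l^{\{F\}}: l\in\mathcal L_\alpha,\ l\text{ hits }F\}$. Write $N_{x,y}$, $\hat l_x$ with $(\mathcal L_\alpha)$ or $(\mathcal L_\alpha^{\{F\}})$ for the sum of these quantities over all loops of the process, and similarly for $N_x$. **Proposition.** Let $e^{\#}$ be another energy on $X$,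 whose objects are marked by $\#$, such that $C^{\#}=C$ on $F\times F$, $\lambda^{\#}=\lambda$ on $F$, and $C^{\#}_{x,y}=0$ whenever $C_{x,y}=0$. Almost surely $\mathcal L_\alpha$ has finitely many non trivial loops and $\sum_{l\in\mathcal L_\alpha}\hat l_x<\infty$ for all $x$, and $$Y=\prod_{(x,y)\notin F\times F}\Big[\frac{C^{\#}_{x,y}}{C_{x,y}}\Big]^{N_{x,y}(\mathcal L_\alpha)}e^{-\sum_{x\in D}\hat l_x(\mathcal L_\alpha)(\lambda^{\#}_x-\lambda_x)}$$ is integrable (with $0/0=0$ and $0^0=1$ here and below). Almost surely, the conditional expectation of $Y$ given the traced loops with their holding times is $$\mathbb E\big(Y\,\big|\,\mathcal L_\alpha^{\{F\}}\big)=\Big[\frac{\mathcal Z_{e^{\#D}}}{\mathcal Z_{e^{D}}}\Big]^{\alpha}\prod_{x,y\in F}\Big[\frac{C^{\#\{F\}}_{x,y}}{C^{\{F\}}_{x,y}}\Big]^{N_{x,y}(\mathcal L_\alpha^{\{F\}})}\prod_{x\in F}e^{-\hat l_x(\mathcal L_\alpha^{\{F\}})\,(\lambda^{\#\{F\}}_x-\lambda^{\{F\}}_x)},$$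 and the conditional expectation of $Y$ given only the non trivial discrete traced loops (the family of the cyclic sequences of points of the non trivial loops of $\mathcal L_\alpha^{\{F\}}$, without the holding times) is $$\Big[\frac{\mathcal Z_{e^{\#D}}}{\mathcal Z_{e^{D}}}\Big]^{\alpha}\prod_{x,y\in F}\Big[\frac{C^{\#\{F\}}_{x,y}}{C^{\{F\}}_{x,y}}\Big]^{N_{x,y}(\mathcal L_\alpha^{\{F\}})}\prod_{x\in F}\Big[\frac{\lambda^{\{F\}}_x}{\lambda^{\#\{F\}}_x}\Big]^{N_x(\mathcal L_\alpha^{\{F\}})+\alpha}.$$ -/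

import Mathlib

open MeasureTheory ProbabilityTheory

namespace MarkovLoops

noncomputable section

/-! ### Energies on a finite set -/

/-- The energy `e` of a transient symmetric Markov chain on the finite set `X`: its free parameters
are the conductances `C` and the killing measure `κ`.  The measure `λ x = κ x + ∑ y, C x y` is
positive, and there is a mass gap. -/
structure Energy (X : Type*) [Fintype X] where
  C : X → X → ℝ
  κ : X → ℝ
  C_symm : ∀ x y, C x y = C y x
  C_nonneg : ∀ x y, 0 ≤ C x y
  C_diag : ∀ x, C x x = 0
  κ_nonneg : ∀ x, 0 ≤ κ x
  lam_pos : ∀ x, 0 < κ x + ∑ y, C x y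
  mass_gap : ∃ ε : ℝ, 0 < ε ∧ ∀ z : X → ℂ,
    ε * ∑ x, (κ x + ∑ y, C x y) * ‖z x‖ ^ 2 ≤
      1 / 2 * ∑ x, ∑ y, C x y * ‖z x - z y‖ ^ 2 + ∑ x, κ x * ‖z x‖ ^ 2

namespace Energy

variable {X : Type*} [Fintype X]

/-- `λ x = κ x + ∑ y, C x y`. -/
def lam (e : Energy X) (x : X) : ℝ := e.κ x + ∑ y, e.C x y

variable [DecidableEq X]

/-- The Green function `G^D` of the chain killed on `F`, where `D` is the complement of `F`: the
inverse of the restriction of `M_λ - C` to `D × D`. -/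
def greenOff (e : Energy X) (F : Finset X) : Matrix {x // x ∉ F} {x // x ∉ F} ℝ :=
  ((Matrix.diagonal e.lam - Matrix.of e.C).submatrix Subtype.val Subtype.val)⁻¹

/-- `Z_{e^D} = det G^D`, where `D` is the complement of `F`. -/
def Zoff (e : Energy X) (F : Finset X) : ℝ := (e.greenOff F).det

/-- `∑_{a, b ∈ D} C_{x,a} C_{b,y} (G^D)^{a,b}`, where `D` is the complement of `F`. -/
def excursionMass (e : Energy X) (F : Finset X) (x y : X) : ℝ :=
  ∑ a : {x // x ∉ F}, ∑ b : {x // x ∉ F}, e.C x a * e.C b y * e.greenOff F a b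

/-- The conductances `C^{F}` of the trace of the chain on `F` (used for `x, y ∈ F`). -/
def traceC (e : Energy X) (F : Finset X) (x y : X) : ℝ :=
  if x = y then 0 else e.C x y + e.excursionMass F x y

/-- The masses `λ^{F}` of the trace of the chain on `F` (used for `x ∈ F`). -/
def traceLam (e : Energy X) (F : Finset X) (x : X) : ℝ :=
  e.lam x - e.excursionMass F x x

end Energy

/-! ### Loops -/

/-- A loop on `X`: the successive points with the (intrinsic) holding times at these points, up to
cyclic rotation.  A trivial loop is a single point with its holding time. -/
abbrev Loop (X : Type*) := Cycle (X × ℝ)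

/-- The loop through the points `ξ 0, …, ξ (n - 1)` with holding times `τ 0, …, τ (n - 1)`. -/
def mkLoop {X : Type*} {n : ℕ} (ξ : Fin n → X) (τ : Fin n → ℝ) : Loop X :=
  ((List.ofFn fun i => (ξ i, τ i) : List (X × ℝ)) : Cycle (X × ℝ))

/-- The quotient σ-algebra on loops (points being discrete): a set of loops is measurable iff, for
all points `ξ`, the set of times `τ` such that `mkLoop ξ τ` is in the set is a Borel set. -/
instance instMeasurableSpaceLoop {X : Type*} : MeasurableSpace (Loop X) :=
  ⨅ (n : ℕ) (ξ : Fin n → X), MeasurableSpace.map (mkLoop ξ) MeasurableSpace.pi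

section Functionals

variable {X : Type*}

/-- The list of all pairs of cyclically successive points of a list. -/
def cyclicSteps (l : List (X × ℝ)) : List (X × X) :=
  List.zipWith (fun p q => (p.1, q.1)) l (l.rotate 1)

theorem cyclicSteps_perm {l l' : List (X × ℝ)} (h : l ~r l') :
    (cyclicSteps l).Perm (cyclicSteps l') := by
  obtain ⟨n, rfl⟩ := h
  have : cyclicSteps (l.rotate n) = (cyclicSteps l).rotate n := by
    unfold cyclicSteps
    rw [List.zipWith_rotate_distrib _ _ _ _ (by simp), List.rotate_rotate, List.rotate_rotate,
      Nat.add_comm]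
  rw [this]
  exact (List.rotate_perm _ _).symm

variable [DecidableEq X]

/-- `N_{x,y}(l)`, the number of `i` with `ξ_i = x` and `ξ_{i+1} = y`; it is `0` for a trivial
loop, which makes no jump. -/
def Loop.N (x y : X) (l : Loop X) : ℕ :=
  if l.length ≤ 1 then 0 else
    Quotient.liftOn l (fun l => (cyclicSteps l).count (x, y))
      fun _ _ h => (cyclicSteps_perm h).count_eq _

/-- The occupation field of a loop at `x`: the total holding time at `x`. -/
def Loop.occ (x : X) (l : Loop X) : ℝ :=
  ((l.toMultiset.filter fun p => p.1 = x).map Prod.snd).sum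

/-! ### The trace of a loop on a subset -/

/-- Put a point with its holding time in front, adding the times if the point does not change. -/
def mergeCons (p : X × ℝ) : List (X × ℝ) → List (X × ℝ)
  | [] => [p]
  | q :: l => if p.1 = q.1 then (p.1, p.2 + q.2) :: l else p :: q :: l

/-- Merge all runs of a repeated point, adding the times. -/
def mergeRuns (l : List (X × ℝ)) : List (X × ℝ) := l.foldr mergeCons []

/-- If the first and the last entry (of at least two) have the same point, merge them. -/
def mergeEnds : List (X × ℝ) → List (X × ℝ)
  | [] => []
  | [p] => [p]
  | p :: q :: l =>
    if p.1 = ((q :: l).getLast (List.cons_ne_nil q l)).1 then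
      (p.1, p.2 + ((q :: l).getLast (List.cons_ne_nil q l)).2) :: (q :: l).dropLast
    else p :: q :: l

/-- The trace on `F` of a loop read from some starting point: delete the points outside `F` and
their holding times, and merge cyclically successive visits of the same point. -/
def traceList (F : Finset X) (l : List (X × ℝ)) : List (X × ℝ) :=
  mergeEnds (mergeRuns (l.filter fun p => p.1 ∈ F))

/-- Put a point with its holding time at the end, adding the times if the point does not change. -/
def mergeSnoc (p : X × ℝ) : List (X × ℝ) → List (X × ℝ)
  | [] => [p]
  | [q] => if p.1 = q.1 then [(q.1, q.2 + p.2)] else [q, p]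
  | q :: r :: l => q :: mergeSnoc p (r :: l)

theorem mergeSnoc_ne_nil (p : X × ℝ) (l : List (X × ℝ)) : mergeSnoc p l ≠ [] := by
  match l with
  | [] => simp [mergeSnoc]
  | [q] => simp only [mergeSnoc]; split_ifs <;> simp
  | q :: r :: l => simp [mergeSnoc]

theorem mergeSnoc_concat (p q : X × ℝ) (l : List (X × ℝ)) :
    mergeSnoc p (l ++ [q]) = if p.1 = q.1 then l ++ [(q.1, q.2 + p.2)] else l ++ [q, p] := by
  induction l with
  | nil => simp [mergeSnoc]
  | cons a l ih =>
    obtain ⟨r, l', h⟩ : ∃ r l', l ++ [q] = r :: l' := by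
      cases l with
      | nil => exact ⟨_, _, rfl⟩
      | cons b l => exact ⟨_, _, rfl⟩
    rw [List.cons_append, h, mergeSnoc, ← h, ih]
    split_ifs <;> simp

theorem mergeCons_mergeSnoc (a p : X × ℝ) (l : List (X × ℝ)) :
    mergeCons a (mergeSnoc p l) = mergeSnoc p (mergeCons a l) := by
  match l with
  | [] =>
    simp only [mergeSnoc, mergeCons]
    by_cases h : a.1 = p.1
    · simp [h]
    · simp [h, Ne.symm h]
  | [q] =>
    by_cases h : a.1 = q.1 <;> by_cases h' : p.1 = q.1 <;>
      simp [mergeSnoc, mergeCons, h, h', add_assoc]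
  | q :: r :: l =>
    by_cases h : a.1 = q.1 <;> simp [mergeSnoc, mergeCons, h]

theorem mergeRuns_concat (p : X × ℝ) (l : List (X × ℝ)) :
    mergeRuns (l ++ [p]) = mergeSnoc p (mergeRuns l) := by
  induction l with
  | nil => simp [mergeRuns, mergeCons, mergeSnoc]
  | cons a l ih =>
    have h1 : mergeRuns (a :: l ++ [p]) = mergeCons a (mergeRuns (l ++ [p])) := rfl
    have h2 : mergeRuns (a :: l) = mergeCons a (mergeRuns l) := rfl
    rw [h1, h2, ih, mergeCons_mergeSnoc]

theorem mergeEnds_cons_concat (p q : X × ℝ) (l : List (X × ℝ)) :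
    mergeEnds (p :: (l ++ [q])) =
      if p.1 = q.1 then (p.1, p.2 + q.2) :: l else p :: (l ++ [q]) := by
  obtain ⟨r, l', h⟩ : ∃ r l', l ++ [q] = r :: l' := by
    cases l with
    | nil => exact ⟨_, _, rfl⟩
    | cons b l => exact ⟨_, _, rfl⟩
  rw [h, mergeEnds]
  simp only [← h]
  simp

theorem mergeEnds_isRotated (p : X × ℝ) (l : List (X × ℝ)) :
    mergeEnds (mergeCons p l) ~r mergeEnds (mergeSnoc p l) := by
  rcases l with _ | ⟨b, l⟩
  · exact List.IsRotated.refl _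
  rcases List.eq_nil_or_concat l with rfl | ⟨m, c, rfl⟩
  · by_cases h : p.1 = b.1
    · simp [mergeCons, mergeSnoc, h, mergeEnds, add_comm]
    · simp only [mergeCons, mergeSnoc, h, if_false, mergeEnds, List.getLast_singleton,
        Ne.symm h]
      exact ⟨1, by simp⟩
  · have hs := mergeSnoc_concat p c (b :: m)
    rw [List.concat_eq_append]
    rw [List.cons_append] at hs
    rw [hs]
    by_cases h : p.1 = b.1 <;> by_cases h' : p.1 = c.1
    · have hb : b.1 = c.1 := h ▸ h'
      have e1 : mergeCons p (b :: (m ++ [c])) = (p.1, p.2 + b.2) :: (m ++ [c]) := by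
        simp [mergeCons, h]
      rw [e1, if_pos h', List.cons_append, mergeEnds_cons_concat, mergeEnds_cons_concat,
        if_pos h', if_pos hb, h]
      have : p.2 + b.2 + c.2 = b.2 + (c.2 + p.2) := by ring
      rw [this]
    · have hb : b.1 = p.1 := h.symm
      have e1 : mergeCons p (b :: (m ++ [c])) = (p.1, p.2 + b.2) :: (m ++ [c]) := by
        simp [mergeCons, h]
      have e2 : b :: m ++ [c, p] = b :: ((m ++ [c]) ++ [p]) := by simp
      rw [e1, if_neg h', e2, mergeEnds_cons_concat, mergeEnds_cons_concat, if_neg h', if_pos hb,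
        h, add_comm]
    · have hb : ¬ b.1 = c.1 := fun hb => h (h'.trans hb.symm)
      have e1 : mergeCons p (b :: (m ++ [c])) = p :: ((b :: m) ++ [c]) := by
        simp [mergeCons, h]
      rw [e1, if_pos h', mergeEnds_cons_concat, if_pos h', List.cons_append,
        mergeEnds_cons_concat, if_neg hb, h', add_comm]
      exact ⟨1, by simp⟩
    · have hb : ¬ b.1 = p.1 := Ne.symm h
      have e1 : mergeCons p (b :: (m ++ [c])) = p :: ((b :: m) ++ [c]) := by
        simp [mergeCons, h]
      have e2 : b :: m ++ [c, p] = b :: ((m ++ [c]) ++ [p]) := by simp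
      rw [e1, if_neg h', e2, mergeEnds_cons_concat, mergeEnds_cons_concat, if_neg h', if_neg hb]
      exact ⟨1, by simp⟩

theorem traceList_isRotated (F : Finset X) {l l' : List (X × ℝ)} (h : l ~r l') :
    traceList F l ~r traceList F l' := by
  have step : ∀ l : List (X × ℝ), traceList F l ~r traceList F (l.rotate 1) := by
    intro l
    cases l with
    | nil => exact List.IsRotated.refl _
    | cons p l =>
      by_cases hp : p.1 ∈ F
      · have e1 : mergeRuns (p :: l.filter fun p => p.1 ∈ F) =
            mergeCons p (mergeRuns (l.filter fun p => p.1 ∈ F)) := rfl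
        simp only [traceList, List.rotate_cons_succ, List.rotate_zero, List.filter_append,
          List.filter_cons, hp, decide_true, if_true, List.filter_nil, mergeRuns_concat, e1]
        exact mergeEnds_isRotated _ _
      · simp only [traceList, List.rotate_cons_succ, List.rotate_zero, List.filter_append,
          List.filter_cons, hp, decide_false, List.filter_nil, List.append_nil,
          Bool.false_eq_true, if_false]
        exact List.IsRotated.refl _
  obtain ⟨n, rfl⟩ := h
  induction n with
  | zero =>
    rw [List.rotate_zero]
  | succ n ih =>
    rw [← List.rotate_rotate]
    exact ih.trans (step _)

/-- The loop `l^{F}`, the trace on `F` of the loop `l`.  (For a loop that does not hit `F`, which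
has no trace, the value is `Cycle.nil`.) -/
def Loop.trace (F : Finset X) (l : Loop X) : Loop X :=
  Quotient.liftOn l (fun l => ((traceList F l : List (X × ℝ)) : Loop X))
    fun _ _ h => Cycle.coe_eq_coe.mpr (traceList_isRotated F h)

end Functionals

/-- The discrete loop underlying a loop: forget the holding times. -/
def Loop.discrete {X : Type*} (l : Loop X) : Cycle X := l.map Prod.fst

/-! ### The loop measure and the Poisson process of loops -/

/-- The loop measure `μ` of the energy `e`,
`∑ₓ exp (-λ_x τ) dτ / τ + ∑_{p ≥ 2} (1 / p) ∑_{ξ ∈ X^p} ∏ᵢ C_{ξᵢ, ξᵢ₊₁} exp (-λ_{ξᵢ} τᵢ) dτᵢ`.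
The loops being counted up to rotation, each of the `p` starting points has weight `1 / p`.
The points are indexed by `Fin p` with `p = n + 1`, where `i + 1` is the cyclic successor of `i`. -/
def loopMeasure {X : Type*} [Fintype X] (e : Energy X) : Measure (Loop X) :=
  (∑ x : X, Measure.map (fun t : ℝ => mkLoop (fun _ : Fin 1 => x) (fun _ => t))
    ((volume.restrict (Set.Ioi 0)).withDensity
      fun t => ENNReal.ofReal (Real.exp (-(e.lam x * t)) / t))) +
  Measure.sum fun n : ℕ =>
    if n = 0 then 0 else
      ∑ ξ : Fin (n + 1) → X,
        ENNReal.ofReal ((∏ i, e.C (ξ i) (ξ (i + 1))) / ((n : ℝ) + 1)) •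
          Measure.map (mkLoop ξ)
            ((volume.restrict {τ : Fin (n + 1) → ℝ | ∀ i, 0 < τ i}).withDensity
              fun τ => ENNReal.ofReal (∏ i, Real.exp (-(e.lam (ξ i) * τ i))))

/-- `L` is a Poisson process on `S` with intensity `ν`: a random countable subset such that the
number of points in each measurable set `B` is measurable and has the Poisson law with parameter
`ν B` (it is a.s. infinite if `ν B = ∞`), and such that the numbers of points in disjoint
measurable sets are independent. -/
structure IsPoissonProcess {Ω S : Type*} [MeasurableSpace Ω] [MeasurableSpace S]
    (P : Measure Ω) (ν : Measure S) (L : Ω → Set S) : Prop where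
  countable : ∀ ω, (L ω).Countable
  measurable_count : ∀ B : Set S, MeasurableSet B → Measurable fun ω => (L ω ∩ B).encard
  law : ∀ B : Set S, MeasurableSet B → ν B ≠ ⊤ →
    P.map (fun ω => (L ω ∩ B).encard) =
      (poissonMeasure (ν B).toNNReal).map (fun k : ℕ => (k : ℕ∞))
  law_top : ∀ B : Set S, MeasurableSet B → ν B = ⊤ → ∀ᵐ ω ∂P, (L ω ∩ B).encard = ⊤
  indep : ∀ (n : ℕ) (B : Fin n → Set S), (∀ i, MeasurableSet (B i)) →
    Pairwise (fun i j => Disjoint (B i) (B j)) →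
    iIndepFun (fun i ω => (L ω ∩ B i).encard) P

section PoissonLoops

variable {X : Type*} [DecidableEq X] {Ω : Type*}

/-- `N_{x,y}` of a set of loops: the sum of `N_{x,y}(l)` over its loops `l`. -/
def totalN (x y : X) (S : Set (Loop X)) : ℕ := ∑ᶠ l ∈ S, l.N x y

/-- The occupation field at `x` of a set of loops. -/
def totalOcc (x : X) (S : Set (Loop X)) : ℝ := ∑' l : S, (l : Loop X).occ x

/-- `N_{x,y}` of the traces on `F` of a set of loops. -/
def traceN (F : Finset X) (x y : X) (S : Set (Loop X)) : ℕ := ∑ᶠ l ∈ S, (l.trace F).N x y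

/-- `N_x = ∑ y, N_{x,y}` of the traces on `F` of a set of loops. -/
def traceVisits [Fintype X] (F : Finset X) (x : X) (S : Set (Loop X)) : ℕ :=
  ∑ y, traceN F x y S

/-- The occupation field at `x` of the traces on `F` of a set of loops. -/
def traceOcc (F : Finset X) (x : X) (S : Set (Loop X)) : ℝ :=
  ∑' l : S, ((l : Loop X).trace F).occ x

/-- The σ-algebra of the process `{l^{F} : l ∈ L}` of traced loops (with their holding times): it
is generated by the numbers of traced loops in the measurable sets of loops. -/
@[reducible] def tracedSigma (F : Finset X) (L : Ω → Set (Loop X)) : MeasurableSpace Ω :=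
  ⨆ (B : Set (Loop X)) (_ : MeasurableSet B),
    MeasurableSpace.comap
      (fun ω => {l | l ∈ L ω ∧ (∃ p ∈ l, p.1 ∈ F) ∧ l.trace F ∈ B}.encard) ⊤

/-- The σ-algebra of the non trivial discrete loops underlying the process of traced loops: it is
generated by the numbers of non trivial traced loops whose discrete loop is in a given set. -/
@[reducible] def discreteTracedSigma (F : Finset X) (L : Ω → Set (Loop X)) : MeasurableSpace Ω :=
  ⨆ B : Set (Cycle X),
    MeasurableSpace.comap
      (fun ω => {l | l ∈ L ω ∧ 2 ≤ (l.trace F).length ∧ (l.trace F).discrete ∈ B}.encard) ⊤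

end PoissonLoops

end

end MarkovLoops

open MarkovLoops

/-! The variable $Y$ is a product over the loops of the process: $Y=\prod_{l\in\mathcal
L_\alpha}h(l)$, where $h$ (`Loop.tilt` with `Energy.ratio`, `Energy.delta`) multiplies each jump by
$C^\#/C$ and each holding time by $e^{-(\lambda^\#-\lambda)\tau}$. Hence $h$ is the density of
$\mu^\#$ with respect to $\mu$ (`lintegral_tilt_mul`). Likewise each right-hand side is a constant
times a product over the traced loops.

Conditional expectations are identified by exponential moments. A σ-algebra generated by counts
$N_i$ is tested by the variables $e^{-\sum k_iN_i}$ (Stone–Weierstrass,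
`condExp_ae_eq_of_exp_moments`). These are again products over loops, $\prod T(l^{\{F\}})$ with
$T\le 1$. For a Poisson process of intensity $\nu$, $\mathbb E\prod f(l)=\exp\int(f-1)\,d\nu$
(`IsPoissonProcess.lintegral_prod`, the right side being `expDiff`). So everything reduces to one
identity between exponents (`expDiff_ofTrace`): up to the constant $\mathcal Z_{e^{\#D}}/\mathcal
Z_{e^D}$, the functional of $h\cdot T(l^{\{F\}})$ under $\mu$ equals that of $h^{\{F\}}T$ under the
loop measure of the traced chain.

Loops that avoid $F$ have $T=1$ and give the constant (`expDiff_not_hits`). Trivial loops contribute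
$\prod_D\lambda/\lambda^\#$ by Frullani's integral; non trivial ones have mass
$\sum_{k\ge2}\mathrm{Tr}\,Q^k/k=-\log\det(1-Q)$ for the killed transition matrix $Q$. For loops that
hit $F$, only the conditional density given the trace matters. Since $h\mu=\mu^\#$, and since the
trace of each loop measure is the loop measure of the traced chain, whose conductances and masses
are $C^{\{F\}},\lambda^{\{F\}}$, that conditional density is $h^{\{F\}}$.

The trace of the loop measure (`lintegral_trace`) is found by marking a uniform time among those
spent in $F$. Weighting by this total time cancels the factors $1/p$ and $1/\tau$ and turns the loop
measure into the sum over $x\in F$ of the measures on paths from $x$ to $x$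
(`lintegral_timeIn_wordLoops`). Traced paths are then compared with paths of the traced chain by
decomposition at the first jump (`traceM_eq_pathM`). Excursions in $D$ are summed by $G^D$, and
excursions from $x$ back to $x$ lengthen its holding time, lowering the rate from $\lambda_x$ to
$\lambda_x^{\{F\}}$ by the resolvent identity.

If only discrete non trivial loops are observed, integrating the times makes the change of masses
equivalent to multiplying the conductances by $\lambda_x^{\{F\}}/\lambda_x^{\#\{F\}}$, while the
unobserved trivial loops give the factor with exponent $\alpha$ (`expDiff_discrete`).

The measure $\mu$ can be infinite because of short trivial loops, so $\int(f-1)$ is never computed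
as a difference of infinite integrals: positive and negative parts are kept apart in $[0,\infty]$,
and comparisons are made on level sets of finite measure. -/

namespace MarkovLoops
open scoped ENNReal
noncomputable section

/-! ### The exponential and the positive part of the logarithm on `ℝ≥0∞` -/

/-- The exponential function `[0, ∞] → [1, ∞]`. -/
def ep (a : ℝ≥0∞) : ℝ≥0∞ := EReal.exp (a : EReal)

@[simp] theorem ep_zero : ep 0 = 1 := by simp [ep]

@[simp] theorem ep_top : ep ∞ = ∞ := by simp [ep]

theorem ep_add (a b : ℝ≥0∞) : ep (a + b) = ep a * ep b := by
  simp [ep, EReal.coe_ennreal_add, EReal.exp_add]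

theorem ep_mono : Monotone ep := fun _ _ h =>
  EReal.exp_monotone (EReal.coe_ennreal_le_coe_ennreal_iff.mpr h)

theorem continuous_ep : Continuous ep :=
  ENNReal.continuous_exp.comp continuous_coe_ennreal_ereal

theorem measurable_ep : Measurable ep := continuous_ep.measurable

theorem one_le_ep (a : ℝ≥0∞) : 1 ≤ ep a := by
  simpa using ep_mono (zero_le : 0 ≤ a)

theorem ep_ne_zero (a : ℝ≥0∞) : ep a ≠ 0 := (zero_lt_one.trans_le (one_le_ep a)).ne'

theorem ep_eq_top_iff {a : ℝ≥0∞} : ep a = ∞ ↔ a = ∞ := by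
  simp [ep]

theorem ep_sum {ι : Type*} (s : Finset ι) (f : ι → ℝ≥0∞) :
    ep (∑ i ∈ s, f i) = ∏ i ∈ s, ep (f i) := by
  classical
  induction s using Finset.induction_on with
  | empty => simp
  | insert i s hi ih => rw [Finset.sum_insert hi, Finset.prod_insert hi, ep_add, ih]

theorem ep_mul_natCast (a : ℝ≥0∞) (n : ℕ) : ep (a * n) = ep a ^ n := by
  induction n with
  | zero => simp
  | succ n ih => rw [Nat.cast_succ, mul_add, mul_one, ep_add, ih, pow_succ]

theorem ep_ofReal {x : ℝ} (hx : 0 ≤ x) : ep (ENNReal.ofReal x) = ENNReal.ofReal (Real.exp x) := by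
  rw [ep, EReal.coe_ennreal_ofReal, max_eq_left hx, EReal.exp_coe]

theorem ep_coe (a : NNReal) : ep a = ENNReal.ofReal (Real.exp a) := by
  rw [← ENNReal.ofReal_coe_nnreal, ep_ofReal a.coe_nonneg]

/-- The positive part of the logarithm, on `[0, ∞]`. -/
def lp (a : ℝ≥0∞) : ℝ≥0∞ := (ENNReal.log a).toENNReal

theorem measurable_lp : Measurable lp := by
  unfold lp
  exact ENNReal.measurable_log.ereal_toENNReal

theorem ep_lp (a : ℝ≥0∞) : ep (lp a) = max 1 a := by
  rw [ep, lp, EReal.coe_toENNReal_eq_max, EReal.exp_monotone.map_max]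
  simp

theorem inv_ep_lp_inv (a : ℝ≥0∞) : (ep (lp a⁻¹))⁻¹ = min 1 a := by
  rw [ep_lp]
  rcases le_total 1 a with h | h
  · rw [max_eq_left (ENNReal.inv_le_one.mpr h), min_eq_left h, inv_one]
  · rw [max_eq_right (ENNReal.one_le_inv.mpr h), min_eq_right h, inv_inv]

theorem lp_eq_zero_or (a : ℝ≥0∞) : lp a = 0 ∨ lp a⁻¹ = 0 := by
  simp only [lp, EReal.toENNReal_eq_zero_iff, ENNReal.log_le_zero_iff, ENNReal.inv_le_one]
  exact le_total _ _

/-- Both sides are the maximum of $a$ and $b$, since $(a-b)^++b=(b-a)^++a$. This replaces an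
exponent $a-b$ by its positive and negative parts without subtracting in $[0,\infty]$. -/
theorem lp_add_eq {a b : ℝ≥0∞} (ha : a ≠ ∞) :
    lp (ep a * (ep b)⁻¹) + b = lp (ep a * (ep b)⁻¹)⁻¹ + a := by
  have h1 : ENNReal.log (ep a * (ep b)⁻¹) = (a : EReal) - b := by
    rw [ENNReal.log_mul_add, ENNReal.log_inv, ep, ep, EReal.log_exp, EReal.log_exp]
    rfl
  unfold lp
  rw [ENNReal.log_inv, h1]
  lift a to NNReal using ha
  by_cases hb : b = ∞
  · subst hb
    simp
  lift b to NNReal using hb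
  have h2 : ((a : ℝ≥0∞) : EReal) - ((b : ℝ≥0∞) : EReal) = ((a - b : ℝ) : EReal) := by
    norm_cast
  rw [h2, ← EReal.coe_neg, EReal.real_coe_toENNReal, EReal.real_coe_toENNReal,
    ← ENNReal.ofReal_coe_nnreal, ← ENNReal.ofReal_coe_nnreal]
  rcases le_total (a : ℝ) b with h | h
  · rw [ENNReal.ofReal_of_nonpos (sub_nonpos.mpr h), zero_add,
      ← ENNReal.ofReal_add (by linarith) a.coe_nonneg]
    congr 1
    ring
  · rw [ENNReal.ofReal_of_nonpos (p := -(_ : ℝ)) (by linarith), zero_add,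
      ← ENNReal.ofReal_add (by linarith) b.coe_nonneg]
    congr 1
    ring

theorem lp_ep_mul_inv_le (a b : ℝ≥0∞) : lp (ep a * (ep b)⁻¹) ≤ a := by
  have : lp (ep a * (ep b)⁻¹) ≤ lp (ep a) := by
    refine EReal.toENNReal_le_toENNReal (ENNReal.log_monotone ?_)
    exact mul_le_of_le_one_right' (ENNReal.inv_le_one.mpr (one_le_ep b))
  refine this.trans (le_of_eq ?_)
  rw [lp, ep, EReal.log_exp, EReal.toENNReal_coe]

/-! ### Point measures -/

section PointMeasure

variable {S S' Ω : Type*} [MeasurableSpace S']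

/-- The image by `f` of the counting measure of `A`. -/
def pointMeasure (A : Set S) (f : S → S') : Measure S' :=
  Measure.sum fun l : A => Measure.dirac (f l)

theorem pointMeasure_apply (A : Set S) (f : S → S') {B : Set S'} (hB : MeasurableSet B) :
    pointMeasure A f B = ({l | l ∈ A ∧ f l ∈ B}.encard : ℝ≥0∞) := by
  rw [pointMeasure, Measure.sum_apply _ hB, ← ENNReal.tsum_set_one]
  simp_rw [Measure.dirac_apply' _ hB]
  rw [tsum_subtype (s := A) (f := fun l => B.indicator (1 : S' → ℝ≥0∞) (f l)),
    tsum_subtype (s := {l | l ∈ A ∧ f l ∈ B}) (f := fun _ => (1 : ℝ≥0∞))]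
  refine tsum_congr fun l => ?_
  by_cases h1 : l ∈ A <;> by_cases h2 : f l ∈ B <;> simp [Set.indicator, h1, h2]

theorem lintegral_pointMeasure (A : Set S) (f : S → S') {u : S' → ℝ≥0∞} (hu : Measurable u) :
    ∫⁻ s, u s ∂pointMeasure A f = ∑' l : A, u (f l) := by
  rw [pointMeasure, lintegral_sum_measure]
  exact tsum_congr fun l => lintegral_dirac' _ hu

theorem measurable_natCast_toENNReal : Measurable fun n : ℕ∞ => (n : ℝ≥0∞) :=
  Measurable.of_discrete

/-- The σ-algebra on measures is generated by evaluations at measurable sets, so measurability of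
the counts suffices. The σ-algebra on `Ω` is left free because the lemma is also used for the
σ-algebras of the traced processes. -/
theorem measurable_lintegral_pointMeasure {m : MeasurableSpace Ω} {A : Ω → Set S} {f : S → S'}
    (h : ∀ B : Set S', MeasurableSet B →
      Measurable fun ω => {l | l ∈ A ω ∧ f l ∈ B}.encard)
    {u : S' → ℝ≥0∞} (hu : Measurable u) :
    Measurable fun ω => ∫⁻ s, u s ∂pointMeasure (A ω) f := by
  have : Measurable fun ω => pointMeasure (A ω) f := by
    refine Measure.measurable_of_measurable_coe _ fun B hB => ?_
    simp_rw [pointMeasure_apply _ _ hB]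
    exact measurable_natCast_toENNReal.comp (h B hB)
  exact (Measure.measurable_lintegral hu).comp this

end PointMeasure

/-! ### The Laplace functional of a Poisson process -/

theorem lintegral_pow_poissonMeasure (r : NNReal) (q : ℝ) (hq : 0 ≤ q) :
    ∫⁻ k, ENNReal.ofReal q ^ k ∂poissonMeasure r =
      ENNReal.ofReal (Real.exp (r * (q - 1))) := by
  rw [lintegral_countable']
  have h : ∀ k : ℕ, ENNReal.ofReal q ^ k * poissonMeasure r {k} =
      ENNReal.ofReal (Real.exp (-r) * ((r * q) ^ k / k.factorial)) := by
    intro k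
    rw [poissonMeasure_singleton, ← ENNReal.ofReal_pow hq, ← ENNReal.ofReal_mul (by positivity)]
    congr 1
    rw [mul_pow]
    ring
  simp_rw [h]
  have hs := (NormedSpace.expSeries_div_hasSum_exp (r * q : ℝ)).mul_left (Real.exp (-r))
  rw [← ENNReal.ofReal_tsum_of_nonneg (fun k => by positivity) hs.summable, hs.tsum_eq,
    ← Real.exp_eq_exp_ℝ, ← Real.exp_add]
  congr 2
  ring

namespace IsPoissonProcess

variable {Ω S : Type*} [MeasurableSpace Ω] [MeasurableSpace S] {P : Measure Ω} {ν : Measure S}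
  {L : Ω → Set S}

theorem lintegral_count (hL : IsPoissonProcess P ν L) {B : Set S} (hB : MeasurableSet B)
    (hν : ν B ≠ ∞) (φ : ℕ∞ → ℝ≥0∞) :
    ∫⁻ ω, φ (L ω ∩ B).encard ∂P = ∫⁻ k : ℕ, φ k ∂poissonMeasure (ν B).toNNReal := by
  have h1 : ∫⁻ ω, φ (L ω ∩ B).encard ∂P = ∫⁻ n, φ n ∂(P.map fun ω => (L ω ∩ B).encard) :=
    (lintegral_map (Measurable.of_discrete) (hL.measurable_count B hB)).symm
  rw [h1, hL.law B hB hν, lintegral_map (Measurable.of_discrete) (Measurable.of_discrete)]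

theorem ae_count_ne_top (hL : IsPoissonProcess P ν L) {B : Set S} (hB : MeasurableSet B)
    (hν : ν B ≠ ∞) : ∀ᵐ ω ∂P, (L ω ∩ B).encard ≠ ⊤ := by
  have h := hL.lintegral_count hB hν (Set.indicator {⊤} 1)
  have h2 : ∀ k : ℕ, Set.indicator {(⊤ : ℕ∞)} (1 : ℕ∞ → ℝ≥0∞) (k : ℕ∞) = 0 := by
    intro k
    simp
  simp_rw [h2, lintegral_zero] at h
  replace h := (lintegral_eq_zero_iff' ((Measurable.of_discrete (f := Set.indicator {⊤} 1)).comp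
    (hL.measurable_count B hB)).aemeasurable).mp h
  filter_upwards [h] with ω hω hc
  simp [hc] at hω

theorem ae_count_eq_zero (hL : IsPoissonProcess P ν L) {B : Set S} (hB : MeasurableSet B)
    (hν : ν B = 0) : ∀ᵐ ω ∂P, L ω ∩ B = ∅ := by
  have h := hL.lintegral_count hB (by simp [hν]) (Set.indicator {0}ᶜ 1)
  have h2 : ∫⁻ k : ℕ, Set.indicator {(0 : ℕ∞)}ᶜ (1 : ℕ∞ → ℝ≥0∞) (k : ℕ∞)
      ∂poissonMeasure (ν B).toNNReal = 0 := by
    rw [hν, lintegral_countable', ENNReal.tsum_eq_zero]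
    intro k
    rw [poissonMeasure_singleton]
    rcases Nat.eq_zero_or_pos k with rfl | hk
    · simp
    · simp [hk.ne']
  rw [h2] at h
  replace h := (lintegral_eq_zero_iff' ((Measurable.of_discrete (f := Set.indicator {0}ᶜ 1)).comp
    (hL.measurable_count B hB)).aemeasurable).mp h
  filter_upwards [h] with ω hω
  by_contra hc
  have : (L ω ∩ B).encard ≠ 0 := by rwa [Ne, Set.encard_eq_zero]
  simp [this] at hω

/-- This is the exponential moment of a Poisson variable. It persists for an infinite parameter: the
count is then almost surely infinite, so both sides are infinite unless $a=0$. -/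
theorem lintegral_ep_count (hL : IsPoissonProcess P ν L) [IsProbabilityMeasure P] {B : Set S}
    (hB : MeasurableSet B) {a : ℝ≥0∞} (ha : a ≠ ∞) :
    ∫⁻ ω, ep (a * (L ω ∩ B).encard) ∂P = ep (ν B * (ep a - 1)) := by
  by_cases h0 : a = 0
  · simp [h0]
  by_cases hν : ν B = ∞
  · have h1 : ep a - 1 ≠ 0 := by
      refine (tsub_pos_of_lt ?_).ne'
      rw [ep]
      simpa [pos_iff_ne_zero] using h0
    rw [hν, ENNReal.top_mul h1, ep_top]
    have h2 : ∀ᵐ ω ∂P, ep (a * (L ω ∩ B).encard) = ∞ := by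
      filter_upwards [hL.law_top B hB hν] with ω hω
      rw [hω, ENat.toENNReal_top, ENNReal.mul_top h0, ep_top]
    rw [lintegral_congr_ae h2]
    simp
  · rw [hL.lintegral_count hB hν fun n => ep (a * n)]
    lift a to NNReal using ha
    have h1 : ∀ k : ℕ, ep ((a : ℝ≥0∞) * ((k : ℕ∞) : ℝ≥0∞)) =
        ENNReal.ofReal (Real.exp a) ^ k := by
      intro k
      rw [ENat.toENNReal_coe, ep_mul_natCast, ep_coe]
    simp_rw [h1]
    rw [lintegral_pow_poissonMeasure _ _ (Real.exp_nonneg _), ← ENNReal.ofReal_coe_nnreal,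
      ep_ofReal a.coe_nonneg, ← ENNReal.ofReal_one, ← ENNReal.ofReal_sub _ zero_le_one,
      ← ENNReal.ofReal_toReal hν, ← ENNReal.ofReal_mul ENNReal.toReal_nonneg, ep_ofReal]
    · simp [ENNReal.coe_toNNReal_eq_toReal]
    · have := Real.one_le_exp a.coe_nonneg
      exact mul_nonneg ENNReal.toReal_nonneg (by linarith)

theorem lintegral_inv_ep_count (hL : IsPoissonProcess P ν L) [IsProbabilityMeasure P] {B : Set S}
    (hB : MeasurableSet B) {a : ℝ≥0∞} (ha : a ≠ ∞) :
    ∫⁻ ω, (ep (a * (L ω ∩ B).encard))⁻¹ ∂P = (ep (ν B * (1 - (ep a)⁻¹)))⁻¹ := by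
  by_cases h0 : a = 0
  · simp [h0]
  by_cases hν : ν B = ∞
  · have h1 : 1 - (ep a)⁻¹ ≠ 0 := by
      refine (tsub_pos_of_lt ?_).ne'
      rw [ENNReal.inv_lt_one, ep]
      simpa [pos_iff_ne_zero] using h0
    rw [hν, ENNReal.top_mul h1, ep_top]
    have h2 : ∀ᵐ ω ∂P, (ep (a * (L ω ∩ B).encard))⁻¹ = 0 := by
      filter_upwards [hL.law_top B hB hν] with ω hω
      rw [hω, ENat.toENNReal_top, ENNReal.mul_top h0, ep_top, ENNReal.inv_top]
    rw [lintegral_congr_ae h2]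
    simp
  · rw [hL.lintegral_count hB hν fun n => (ep (a * n))⁻¹]
    lift a to NNReal using ha
    have h1 : ∀ k : ℕ, (ep ((a : ℝ≥0∞) * ((k : ℕ∞) : ℝ≥0∞)))⁻¹ =
        ENNReal.ofReal (Real.exp (-a)) ^ k := by
      intro k
      rw [ENat.toENNReal_coe, ep_mul_natCast, ep_coe,
        ENNReal.inv_pow, ← ENNReal.ofReal_inv_of_pos (Real.exp_pos _), ← Real.exp_neg]
    simp_rw [h1]
    have h2 : Real.exp (-a) ≤ 1 := Real.exp_le_one_iff.mpr (neg_nonpos.mpr a.coe_nonneg)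
    rw [lintegral_pow_poissonMeasure _ _ (Real.exp_nonneg _), ← ENNReal.ofReal_coe_nnreal,
      ep_ofReal a.coe_nonneg, ← ENNReal.ofReal_inv_of_pos (Real.exp_pos _), ← Real.exp_neg,
      ← ENNReal.ofReal_one, ← ENNReal.ofReal_sub _ (Real.exp_nonneg _),
      ← ENNReal.ofReal_toReal hν, ← ENNReal.ofReal_mul ENNReal.toReal_nonneg, ep_ofReal,
      ← ENNReal.ofReal_inv_of_pos (Real.exp_pos _), ← Real.exp_neg]
    · congr 2
      simp only [ENNReal.coe_toNNReal_eq_toReal, ENNReal.toReal_ofReal ENNReal.toReal_nonneg]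
      ring
    · exact mul_nonneg ENNReal.toReal_nonneg (by linarith)

theorem lintegral_prod_count (hL : IsPoissonProcess P ν L) {ι : Type*} [Finite ι]
    {B : ι → Set S} (hB : ∀ i, MeasurableSet (B i))
    (hd : Pairwise fun i j => Disjoint (B i) (B j)) (φ : ι → ℕ∞ → ℝ≥0∞) (s : Finset ι) :
    ∫⁻ ω, ∏ i ∈ s, φ i (L ω ∩ B i).encard ∂P =
      ∏ i ∈ s, ∫⁻ ω, φ i (L ω ∩ B i).encard ∂P := by
  cases nonempty_fintype ι
  have h1 := hL.indep (Fintype.card ι) (fun i => B ((Fintype.equivFin ι).symm i))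
    (fun i => hB _) (fun i j hij => hd (by simpa using hij))
  have h2 : iIndepFun (fun i ω => (L ω ∩ B i).encard) P := by
    have := h1.precomp (Fintype.equivFin ι).injective
    simpa using this
  exact lintegral_prod_eq_prod_lintegral_of_indepFun s _
    (h2.comp φ fun i => Measurable.of_discrete)
    fun i => (Measurable.of_discrete).comp (hL.measurable_count _ (hB i))

theorem measurable_lintegral (hL : IsPoissonProcess P ν L) {u : S → ℝ≥0∞} (hu : Measurable u) :
    Measurable fun ω => ∫⁻ s, u s ∂pointMeasure (L ω) id :=
  measurable_lintegral_pointMeasure (fun B hB => hL.measurable_count B hB) hu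

end IsPoissonProcess

theorem SimpleFunc.lintegral_comp {S β : Type*} [MeasurableSpace S] (p : SimpleFunc S β)
    (g : β → ℝ≥0∞) (μ : Measure S) :
    ∫⁻ s, g (p s) ∂μ = ∑ x ∈ p.range, g x * μ (p ⁻¹' {x}) := by
  rw [← SimpleFunc.map_lintegral]
  exact SimpleFunc.lintegral_eq_lintegral (p.map g) μ

theorem ep_iSup (f : ℕ → ℝ≥0∞) : ep (⨆ n, f n) = ⨆ n, ep (f n) :=
  ep_mono.map_ciSup_of_continuousAt continuous_ep.continuousAt

/-! ### The Laplace functional, from simple functions to measurable functions -/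

namespace IsPoissonProcess

variable {Ω S : Type*} [MeasurableSpace Ω] [MeasurableSpace S] {P : Measure Ω} {ν : Measure S}
  {L : Ω → Set S}

/-- Taking the pair of exponents as a single simple function gives them common level sets, on which
the counts are independent. Since one of the two exponents vanishes on each level set, each factor
is one of the two Poisson moments already computed. -/
theorem laplace_simpleFunc (hL : IsPoissonProcess P ν L) [IsProbabilityMeasure P]
    (p : SimpleFunc S (ℝ≥0∞ × ℝ≥0∞)) (hfin : ∀ s, (p s).1 ≠ ∞ ∧ (p s).2 ≠ ∞)
    (h0 : ∀ s, (p s).1 = 0 ∨ (p s).2 = 0) :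
    ∫⁻ ω, ep (∫⁻ s, (p s).1 ∂pointMeasure (L ω) id) *
        (ep (∫⁻ s, (p s).2 ∂pointMeasure (L ω) id))⁻¹ ∂P =
      ep (∫⁻ s, (ep (p s).1 - 1) ∂ν) * (ep (∫⁻ s, (1 - (ep (p s).2)⁻¹) ∂ν))⁻¹ := by
  have hB : ∀ c, MeasurableSet (p ⁻¹' {c}) := fun c => p.measurableSet_preimage _
  have h1 : ∀ ω, ep (∫⁻ s, (p s).1 ∂pointMeasure (L ω) id) *
      (ep (∫⁻ s, (p s).2 ∂pointMeasure (L ω) id))⁻¹ =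
      ∏ c ∈ p.range.attach, (fun (c : p.range) (k : ℕ∞) => ep (c.1.1 * k) * (ep (c.1.2 * k))⁻¹) c
        (L ω ∩ p ⁻¹' {c.1}).encard := by
    intro ω
    have hN : ∀ c, pointMeasure (L ω) id (p ⁻¹' {c}) = ((L ω ∩ p ⁻¹' {c}).encard : ℝ≥0∞) :=
      fun c => pointMeasure_apply _ _ (hB c)
    rw [SimpleFunc.lintegral_comp p Prod.fst, SimpleFunc.lintegral_comp p Prod.snd, ep_sum, ep_sum,
      ENNReal.prod_inv_distrib (fun _ _ _ _ _ => Or.inl (ep_ne_zero _)),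
      ← Finset.prod_mul_distrib, ← Finset.prod_attach]
    simp only [hN]
  simp_rw [h1]
  have := hL.lintegral_prod_count (ι := p.range) (B := fun c => p ⁻¹' {c.1}) (fun c => hB _)
    (fun c d hcd => Disjoint.preimage _ (Set.disjoint_singleton.mpr fun h => hcd (Subtype.ext h)))
    (fun (c : p.range) (k : ℕ∞) => ep (c.1.1 * k) * (ep (c.1.2 * k))⁻¹) p.range.attach
  rw [this, SimpleFunc.lintegral_comp p fun c => ep c.1 - 1,
    SimpleFunc.lintegral_comp p fun c => 1 - (ep c.2)⁻¹, ep_sum, ep_sum,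
      ENNReal.prod_inv_distrib (fun _ _ _ _ _ => Or.inl (ep_ne_zero _)),
      ← Finset.prod_mul_distrib, ← Finset.prod_attach p.range]
  refine Finset.prod_congr rfl fun c _ => ?_
  obtain ⟨s, hs⟩ := SimpleFunc.mem_range.mp c.2
  have hf := hfin s
  have h0 := h0 s
  rw [hs] at hf h0
  rw [mul_comm _ (ν _), mul_comm _ (ν _)]
  rcases h0 with h | h
  · simp only [h, zero_mul, ep_zero, one_mul, tsub_self, mul_zero]
    exact hL.lintegral_inv_ep_count (hB _) hf.2
  · simp only [h, zero_mul, ep_zero, inv_one, mul_one, tsub_self, mul_zero]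
    exact hL.lintegral_ep_count (hB _) hf.1

/-- Monotone convergence in the positive exponent, the negative one being kept fixed and simple:
both sides increase with the approximation of $u$. -/
theorem laplace_simpleFunc_right (hL : IsPoissonProcess P ν L) [IsProbabilityMeasure P]
    {u : S → ℝ≥0∞} (hu : Measurable u) (v : SimpleFunc S ℝ≥0∞) (hv : ∀ s, v s ≠ ∞)
    (h0 : ∀ s, u s = 0 ∨ v s = 0) :
    ∫⁻ ω, ep (∫⁻ s, u s ∂pointMeasure (L ω) id) *
        (ep (∫⁻ s, v s ∂pointMeasure (L ω) id))⁻¹ ∂P =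
      ep (∫⁻ s, (ep (u s) - 1) ∂ν) * (ep (∫⁻ s, (1 - (ep (v s))⁻¹) ∂ν))⁻¹ := by
  have hsup : ∀ s, ⨆ n, SimpleFunc.eapprox u n s = u s :=
    fun s => SimpleFunc.iSup_eapprox_apply hu s
  have hmono : ∀ s, Monotone fun n => SimpleFunc.eapprox u n s :=
    fun s n m h => SimpleFunc.monotone_eapprox u h s
  have hmeas : ∀ n, Measurable fun s => SimpleFunc.eapprox u n s :=
    fun n => (SimpleFunc.eapprox u n).measurable
  have key : ∀ n, ∫⁻ ω, ep (∫⁻ s, SimpleFunc.eapprox u n s ∂pointMeasure (L ω) id) *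
        (ep (∫⁻ s, v s ∂pointMeasure (L ω) id))⁻¹ ∂P =
      ep (∫⁻ s, (ep (SimpleFunc.eapprox u n s) - 1) ∂ν) *
        (ep (∫⁻ s, (1 - (ep (v s))⁻¹) ∂ν))⁻¹ := by
    intro n
    refine hL.laplace_simpleFunc ((SimpleFunc.eapprox u n).pair v)
      (fun s => ⟨(SimpleFunc.eapprox_lt_top u n s).ne, hv s⟩) fun s => ?_
    refine (h0 s).imp (fun h => ?_) id
    have : SimpleFunc.eapprox u n s ≤ u s := by
      rw [← hsup s]
      exact le_iSup (fun n => SimpleFunc.eapprox u n s) n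
    exact le_antisymm (this.trans h.le) zero_le
  have hl : ∀ ω, ep (∫⁻ s, u s ∂pointMeasure (L ω) id) *
      (ep (∫⁻ s, v s ∂pointMeasure (L ω) id))⁻¹ =
      ⨆ n, ep (∫⁻ s, SimpleFunc.eapprox u n s ∂pointMeasure (L ω) id) *
        (ep (∫⁻ s, v s ∂pointMeasure (L ω) id))⁻¹ := by
    intro ω
    rw [← ENNReal.iSup_mul, ← ep_iSup, ← lintegral_iSup hmeas fun n m h s => hmono s h]
    simp_rw [hsup]
  simp_rw [hl]
  rw [lintegral_iSup]
  · simp_rw [key]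
    rw [← ENNReal.iSup_mul, ← ep_iSup, ← lintegral_iSup]
    · simp_rw [← ENNReal.iSup_sub, ← ep_iSup, hsup]
    · exact fun n => (measurable_ep.comp (hmeas n)).sub_const _
    · exact fun n m h s => tsub_le_tsub_right (ep_mono (hmono s h)) _
  · exact fun n => (measurable_ep.comp (hL.measurable_lintegral (hmeas n))).mul
      (measurable_ep.comp (hL.measurable_lintegral v.measurable)).inv
  · exact fun n m h ω => mul_le_mul_left (ep_mono (lintegral_mono fun s => hmono s h)) _

/-- The negative exponent enters decreasingly, so its approximation is by dominated convergence. The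
dominating function is the positive exponential, whose mean is finite by `hfin`. -/
theorem laplace (hL : IsPoissonProcess P ν L) [IsProbabilityMeasure P]
    {u v : S → ℝ≥0∞} (hu : Measurable u) (hv : Measurable v)
    (h0 : ∀ s, u s = 0 ∨ v s = 0) (hfin : ∫⁻ s, (ep (u s) - 1) ∂ν ≠ ∞) :
    ∫⁻ ω, ep (∫⁻ s, u s ∂pointMeasure (L ω) id) *
        (ep (∫⁻ s, v s ∂pointMeasure (L ω) id))⁻¹ ∂P =
      ep (∫⁻ s, (ep (u s) - 1) ∂ν) * (ep (∫⁻ s, (1 - (ep (v s))⁻¹) ∂ν))⁻¹ := by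
  have hsup : ∀ s, ⨆ n, SimpleFunc.eapprox v n s = v s :=
    fun s => SimpleFunc.iSup_eapprox_apply hv s
  have hmono : ∀ s, Monotone fun n => SimpleFunc.eapprox v n s :=
    fun s n m h => SimpleFunc.monotone_eapprox v h s
  have hmeas : ∀ n, Measurable fun s => SimpleFunc.eapprox v n s :=
    fun n => (SimpleFunc.eapprox v n).measurable
  have htend : ∀ s, Filter.Tendsto (fun n => SimpleFunc.eapprox v n s) Filter.atTop
      (nhds (v s)) := fun s => by
    rw [← hsup s]
    exact tendsto_atTop_iSup (hmono s)
  -- The dominating function has the mean given by the preceding lemma with $v=0$.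
  have hbound : ∫⁻ ω, ep (∫⁻ s, u s ∂pointMeasure (L ω) id) ∂P ≠ ∞ := by
    have := hL.laplace_simpleFunc_right hu 0 (by simp) (by simp)
    simp only [SimpleFunc.coe_zero, Pi.zero_apply, lintegral_zero, ep_zero, inv_one, mul_one,
      tsub_self] at this
    rw [this]
    simpa [ep_eq_top_iff] using hfin
  have hmu := measurable_ep.comp (hL.measurable_lintegral hu)
  have key : ∀ n, ∫⁻ ω, ep (∫⁻ s, u s ∂pointMeasure (L ω) id) *
        (ep (∫⁻ s, SimpleFunc.eapprox v n s ∂pointMeasure (L ω) id))⁻¹ ∂P =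
      ep (∫⁻ s, (ep (u s) - 1) ∂ν) *
        (ep (∫⁻ s, (1 - (ep (SimpleFunc.eapprox v n s))⁻¹) ∂ν))⁻¹ := by
    intro n
    refine hL.laplace_simpleFunc_right hu (SimpleFunc.eapprox v n)
      (fun s => (SimpleFunc.eapprox_lt_top v n s).ne) fun s => ?_
    refine (h0 s).imp id (fun h => ?_)
    have : SimpleFunc.eapprox v n s ≤ v s := by
      rw [← hsup s]
      exact le_iSup (fun n => SimpleFunc.eapprox v n s) n
    exact le_antisymm (this.trans h.le) zero_le
  have hl : Filter.Tendsto (fun n => ∫⁻ ω, ep (∫⁻ s, u s ∂pointMeasure (L ω) id) *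
        (ep (∫⁻ s, SimpleFunc.eapprox v n s ∂pointMeasure (L ω) id))⁻¹ ∂P) Filter.atTop
      (nhds (∫⁻ ω, ep (∫⁻ s, u s ∂pointMeasure (L ω) id) *
        (ep (∫⁻ s, v s ∂pointMeasure (L ω) id))⁻¹ ∂P)) := by
    refine tendsto_lintegral_of_dominated_convergence _
      (fun n => hmu.mul (measurable_ep.comp (hL.measurable_lintegral (hmeas n))).inv)
      (fun n => Filter.Eventually.of_forall fun ω =>
        mul_le_of_le_one_right' (ENNReal.inv_le_one.mpr (one_le_ep _))) hbound ?_
    filter_upwards [ae_lt_top hmu hbound] with ω hω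
    refine ENNReal.Tendsto.const_mul ?_ (Or.inr hω.ne)
    refine tendsto_inv_iff.mpr ((continuous_ep.tendsto _).comp ?_)
    exact lintegral_tendsto_of_tendsto_of_monotone (fun n => (hmeas n).aemeasurable)
      (Filter.Eventually.of_forall hmono) (Filter.Eventually.of_forall htend)
  refine tendsto_nhds_unique hl ?_
  simp_rw [key]
  refine ENNReal.Tendsto.const_mul ?_ (Or.inr (by simpa [ep_eq_top_iff] using hfin))
  refine tendsto_inv_iff.mpr ((continuous_ep.tendsto _).comp ?_)
  refine lintegral_tendsto_of_tendsto_of_monotone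
    (fun n => ((measurable_ep.comp (hmeas n)).inv.const_sub _).aemeasurable)
    (Filter.Eventually.of_forall fun s n m h => tsub_le_tsub_left
      (ENNReal.inv_le_inv.mpr (ep_mono (hmono s h))) _)
    (Filter.Eventually.of_forall fun s => ?_)
  exact ENNReal.Tendsto.sub tendsto_const_nhds
    (tendsto_inv_iff.mpr ((continuous_ep.tendsto _).comp (htend s))) (Or.inl (by simp))

end IsPoissonProcess

/-! ### Functions of a family of counts are determined by exponential moments -/

-- The polynomials form a subalgebra of the continuous functions on a cube and separate its points;
-- the integrals over such a subalgebra determine a finite measure on a Polish space.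
open BoundedContinuousFunction in
theorem measure_ext_of_moments {t : Type*} [Fintype t] {μ ν : Measure (t → unitInterval)}
    [IsFiniteMeasure μ] [IsFiniteMeasure ν]
    (h : ∀ k : t → ℕ, ∫ x, ∏ i, (x i : ℝ) ^ k i ∂μ = ∫ x, ∏ i, (x i : ℝ) ^ k i ∂ν) : μ = ν := by
  let A : StarSubalgebra ℝ ((t → unitInterval) →ᵇ ℝ) :=
    { carrier := {g | ∃ p : MvPolynomial t ℝ, ∀ x, g x = MvPolynomial.eval (fun i => (x i : ℝ)) p}
      mul_mem' := by
        rintro f g ⟨p, hp⟩ ⟨q, hq⟩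
        exact ⟨p * q, fun x => by simp [hp, hq]⟩
      add_mem' := by
        rintro f g ⟨p, hp⟩ ⟨q, hq⟩
        exact ⟨p + q, fun x => by simp [hp, hq]⟩
      algebraMap_mem' := fun r => ⟨MvPolynomial.C r, fun x => by simp⟩
      star_mem' := by
        rintro f ⟨p, hp⟩
        exact ⟨p, fun x => by simp [hp]⟩ }
  have hcont : ∀ k : t → ℕ, Continuous fun x : t → unitInterval => ∏ i, (x i : ℝ) ^ k i :=
    fun k => by fun_prop
  have hint : ∀ (k : t → ℕ) (m : Measure (t → unitInterval)) [IsFiniteMeasure m],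
      Integrable (fun x : t → unitInterval => ∏ i, (x i : ℝ) ^ k i) m :=
    fun k m _ => ((mkOfCompact ⟨_, hcont k⟩).integrable m)
  refine ext_of_forall_mem_subalgebra_integral_eq_of_polish (𝕜 := ℝ) (A := A) ?_ ?_
  · intro x y hxy
    obtain ⟨i, hi⟩ := Function.ne_iff.mp hxy
    let c : C(t → unitInterval, ℝ) := ⟨fun x => (x i : ℝ), by fun_prop⟩
    refine ⟨c, ⟨c, ⟨mkOfCompact c, ⟨MvPolynomial.X i, fun x => by simp [c]⟩, rfl⟩, rfl⟩, ?_⟩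
    exact fun h => hi (Subtype.ext h)
  · rintro g ⟨p, hp⟩
    simp_rw [hp, MvPolynomial.eval_eq']
    rw [integral_finsetSum _ fun (d : t →₀ ℕ) _ => (hint d μ).const_mul (p.coeff d),
      integral_finsetSum _ fun (d : t →₀ ℕ) _ => (hint d ν).const_mul (p.coeff d)]
    simp_rw [integral_const_mul, h]

/-- The map $n\mapsto e^{-n}$ embeds `ℕ∞` in the unit interval, with ⊤ going to $0$. Infinite counts
thus need no separate treatment in the moment argument. -/
theorem ep_natCast_injective : Function.Injective fun n : ℕ∞ => (ep n)⁻¹ := by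
  intro a b h
  have h1 : ep a = ep b := inv_injective h
  have h2 : ((a : ℝ≥0∞) : EReal) = ((b : ℝ≥0∞) : EReal) := by
    have := congrArg ENNReal.log h1
    rwa [ep, ep, EReal.log_exp, EReal.log_exp] at this
  exact_mod_cast h2

/-- Under the measures of densities $f$ and $g$, finite subfamilies of the variables $e^{-N_i}$ have
the same mixed moments, hence the same law on a cube. The events depending on finitely many counts
form a π-system that generates the σ-algebra. -/
theorem lintegral_eq_of_exp_moments {Ω ι : Type*} {mΩ : MeasurableSpace Ω} {P : Measure Ω}
    {N : ι → Ω → ℕ∞} (hN : ∀ i, Measurable (N i)) {f g : Ω → ℝ≥0∞} (hf : Measurable f)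
    (hg : Measurable g) (hfin : ∫⁻ ω, f ω ∂P ≠ ∞)
    (h : ∀ (t : Finset ι) (k : ι → ℕ),
      ∫⁻ ω, f ω * (ep (∑ i ∈ t, k i * N i ω))⁻¹ ∂P =
        ∫⁻ ω, g ω * (ep (∑ i ∈ t, k i * N i ω))⁻¹ ∂P)
    {s : Set Ω} (hs : MeasurableSet[⨆ i, MeasurableSpace.comap (N i) ⊤] s) :
    ∫⁻ ω in s, f ω ∂P = ∫⁻ ω in s, g ω ∂P := by
  classical
  have hm : (⨆ i, MeasurableSpace.comap (N i) ⊤) ≤ mΩ := iSup_le fun i => (hN i).comap_le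
  have huniv : ∫⁻ ω, f ω ∂P = ∫⁻ ω, g ω ∂P := by simpa using h ∅ 0
  have hfF : IsFiniteMeasure (P.withDensity f) := isFiniteMeasure_withDensity hfin
  have hgF : IsFiniteMeasure (P.withDensity g) := isFiniteMeasure_withDensity (huniv ▸ hfin)
  let q : ℕ∞ → unitInterval := fun n => ⟨((ep n)⁻¹).toReal, ENNReal.toReal_nonneg, by
    rw [← ENNReal.toReal_one]
    exact ENNReal.toReal_mono ENNReal.one_ne_top (ENNReal.inv_le_one.mpr (one_le_ep _))⟩
  have hle : ∀ n : ℕ∞, (ep n)⁻¹ ≠ ∞ := fun n => ENNReal.inv_ne_top.mpr (ep_ne_zero _)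
  have hq : Function.Injective q := fun a b hab => ep_natCast_injective <| by
    have h1 : ((ep a)⁻¹).toReal = ((ep b)⁻¹).toReal := congrArg (fun z : unitInterval => (z : ℝ)) hab
    exact (ENNReal.toReal_eq_toReal_iff' (hle a) (hle b)).mp h1
  have key : ∀ t : Finset ι, (P.withDensity f).map (fun ω (i : t) => q (N i ω)) =
      (P.withDensity g).map (fun ω (i : t) => q (N i ω)) := by
    intro t
    have hmeas : Measurable fun ω (i : t) => q (N i ω) :=
      measurable_pi_lambda _ fun i => (Measurable.of_discrete (f := q)).comp (hN i)
    refine measure_ext_of_moments fun k => ?_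
    have hc : Continuous fun x : t → unitInterval => ∏ i, (x i : ℝ) ^ k i := by fun_prop
    -- The exponents are extended by $0$ outside `t`, as the hypothesis takes exponents indexed by
    -- all of `ι`.
    have hqk : ∀ ω, ENNReal.ofReal (∏ i : t, (q (N i ω) : ℝ) ^ k i) =
        (ep (∑ i ∈ t, (if hi : i ∈ t then k ⟨i, hi⟩ else 0 : ℕ) * N i ω))⁻¹ := by
      intro ω
      rw [ep_sum, ENNReal.prod_inv_distrib (fun _ _ _ _ _ => Or.inl (ep_ne_zero _)),
        ← Finset.prod_attach t, ENNReal.ofReal_prod_of_nonneg (fun i _ => pow_nonneg (q _).2.1 _)]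
      refine Finset.prod_congr rfl fun i _ => ?_
      rw [ENNReal.ofReal_pow (q _).2.1, ENNReal.ofReal_toReal (hle _), dif_pos i.2,
        mul_comm, ep_mul_natCast, ENNReal.inv_pow]
    have hI : ∀ F : Ω → ℝ≥0∞, Measurable F →
        ∫ x, ∏ i, (x i : ℝ) ^ k i ∂((P.withDensity F).map (fun ω (i : t) => q (N i ω))) =
        (∫⁻ ω, F ω * (ep (∑ i ∈ t, (if hi : i ∈ t then k ⟨i, hi⟩ else 0 : ℕ) * N i ω))⁻¹
          ∂P).toReal := by
      intro F hF
      rw [integral_eq_lintegral_of_nonneg_ae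
          (Filter.Eventually.of_forall fun x => Finset.prod_nonneg fun i _ => pow_nonneg (x i).2.1 _)
          hc.aestronglyMeasurable, lintegral_map hc.measurable.ennreal_ofReal hmeas,
        lintegral_withDensity_eq_lintegral_mul₀ hF.aemeasurable]
      · simp only [Pi.mul_apply, hqk]
      · exact (hc.measurable.ennreal_ofReal.comp hmeas).aemeasurable
    rw [hI f hf, hI g hg]
    exact congrArg _ (h t fun i => if hi : i ∈ t then k ⟨i, hi⟩ else 0)
  -- Two finite measures on the generated σ-algebra are compared on finite intersections of events,
  -- each depending on a single count.
  have hmeq : (P.withDensity f).trim hm = (P.withDensity g).trim hm := by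
    let π : ι → Set (Set Ω) := fun i => {s | MeasurableSet[MeasurableSpace.comap (N i) ⊤] s}
    have hgen : MeasurableSpace.generateFrom (piiUnionInter π Set.univ) =
        ⨆ i, MeasurableSpace.comap (N i) ⊤ := by
      have := generateFrom_piiUnionInter_measurableSet
        (fun i => MeasurableSpace.comap (N i) ⊤) Set.univ
      simpa only [Set.mem_univ, iSup_pos] using this
    refine @ext_of_generate_finite Ω (⨆ i, MeasurableSpace.comap (N i) ⊤) _ _
      (piiUnionInter π Set.univ) ?_ ?_ inferInstance ?_ ?_
    · exact hgen.symm
    · exact isPiSystem_piiUnionInter _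
        (fun i => @MeasurableSpace.isPiSystem_measurableSet _ (MeasurableSpace.comap (N i) ⊤)) _
    · intro s hs
      have hsm : MeasurableSet[⨆ i, MeasurableSpace.comap (N i) ⊤] s := by
        rw [← hgen]
        exact MeasurableSpace.measurableSet_generateFrom hs
      rw [trim_measurableSet_eq hm hsm, trim_measurableSet_eq hm hsm]
      obtain ⟨t, -, F, hF, rfl⟩ := hs
      have hF' : ∀ i : t, ∃ A : Set ℕ∞, N i ⁻¹' A = F i := fun i => by
        obtain ⟨A, -, hA⟩ := hF i i.2
        exact ⟨A, hA⟩
      choose A hA using hF'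
      have hpre : (⋂ i ∈ t, F i) = (fun ω (i : t) => q (N i ω)) ⁻¹'
          (Set.univ.pi fun i => q '' A i) := by
        ext ω
        simp only [Set.mem_iInter, Set.mem_preimage, Set.mem_pi, Set.mem_univ, true_imp_iff,
          hq.mem_set_image]
        refine ⟨fun h i => ?_, fun h i hi => ?_⟩
        · have := h i i.2
          rwa [← hA i] at this
        · have := h ⟨i, hi⟩
          rw [← hA ⟨i, hi⟩]
          exact this
      have hmeas : Measurable fun ω (i : t) => q (N i ω) :=
        measurable_pi_lambda _ fun i => (Measurable.of_discrete (f := q)).comp (hN i)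
      have hpim : MeasurableSet (Set.univ.pi fun i : t => q '' A i) :=
        MeasurableSet.univ_pi fun i => (Set.to_countable (A i)).image q |>.measurableSet
      rw [hpre, ← Measure.map_apply hmeas hpim, key t, Measure.map_apply hmeas hpim]
    · rw [trim_measurableSet_eq hm MeasurableSet.univ, trim_measurableSet_eq hm MeasurableSet.univ,
        withDensity_apply _ MeasurableSet.univ, withDensity_apply _ MeasurableSet.univ]
      simpa using huniv
  have h1 := congrArg (fun m => m s) hmeq
  simp only [trim_measurableSet_eq hm hs, withDensity_apply _ (hm s hs)] at h1
  exact h1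

/-- A version of the conditional expectation of a nonnegative function, characterized by exponential
moments of a family of counts. -/
theorem condExp_ae_eq_of_exp_moments {Ω ι : Type*} {mΩ : MeasurableSpace Ω} {P : Measure Ω}
    [IsFiniteMeasure P]
    {N : ι → Ω → ℕ∞} (hN : ∀ i, Measurable (N i)) {f g : Ω → ℝ≥0∞} (hf : Measurable f)
    (hg : Measurable[⨆ i, MeasurableSpace.comap (N i) ⊤] g) (hfin : ∫⁻ ω, f ω ∂P ≠ ∞)
    (h : ∀ (t : Finset ι) (k : ι → ℕ),
      ∫⁻ ω, f ω * (ep (∑ i ∈ t, k i * N i ω))⁻¹ ∂P =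
        ∫⁻ ω, g ω * (ep (∑ i ∈ t, k i * N i ω))⁻¹ ∂P) :
    P[fun ω => (f ω).toReal | ⨆ i, MeasurableSpace.comap (N i) ⊤] =ᵐ[P]
      fun ω => (g ω).toReal := by
  have hm : (⨆ i, MeasurableSpace.comap (N i) ⊤) ≤ mΩ := iSup_le fun i => (hN i).comap_le
  have huniv : ∫⁻ ω, f ω ∂P = ∫⁻ ω, g ω ∂P := by simpa using h ∅ 0
  have hg' : Measurable g := hg.mono hm le_rfl
  have hfin' := huniv ▸ hfin
  symm
  refine ae_eq_condExp_of_forall_setIntegral_eq hm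
    (integrable_toReal_of_lintegral_ne_top hf.aemeasurable hfin)
    (fun s _ _ => (integrable_toReal_of_lintegral_ne_top hg'.aemeasurable hfin').integrableOn)
    (fun s hs _ => ?_) (hg.ennreal_toReal.stronglyMeasurable).aestronglyMeasurable
  rw [integral_toReal hg'.aemeasurable, integral_toReal hf.aemeasurable,
    lintegral_eq_of_exp_moments hN hf hg' hfin h hs]
  · exact ae_restrict_of_ae (ae_lt_top hf hfin)
  · exact ae_restrict_of_ae (ae_lt_top hg' hfin')

/-! ### The measurable space of lists of points with holding times -/

section ListMeasurable

variable {X : Type*}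

/-- The list of the points `ξ i` with holding times `τ i`. -/
def timedList {n : ℕ} (ξ : Fin n → X) (τ : Fin n → ℝ) : List (X × ℝ) :=
  List.ofFn fun i => (ξ i, τ i)

theorem timedList_zero (ξ : Fin 0 → X) (τ : Fin 0 → ℝ) : timedList ξ τ = [] := by
  simp [timedList]

theorem timedList_succ {n : ℕ} (ξ : Fin (n + 1) → X) (τ : Fin (n + 1) → ℝ) :
    timedList ξ τ = (ξ 0, τ 0) :: timedList (fun i => ξ i.succ) fun i => τ i.succ := by
  simp [timedList, List.ofFn_succ]

theorem timedList_succ_last {n : ℕ} (ξ : Fin (n + 1) → X) (τ : Fin (n + 1) → ℝ) :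
    timedList ξ τ = (timedList (fun i => ξ i.castSucc) fun i => τ i.castSucc) ++
      [(ξ (Fin.last n), τ (Fin.last n))] := by
  rw [timedList, List.ofFn_succ', List.concat_eq_append]
  rfl

theorem map_fst_timedList {n : ℕ} (ξ : Fin n → X) (τ : Fin n → ℝ) :
    (timedList ξ τ).map Prod.fst = List.ofFn ξ := by
  simp [timedList, List.map_ofFn, Function.comp_def]

theorem exists_timedList (l : List (X × ℝ)) :
    ∃ (n : ℕ) (ξ : Fin n → X) (τ : Fin n → ℝ), l = timedList ξ τ :=
  ⟨l.length, fun i => (l.get i).1, fun i => (l.get i).2, by simp [timedList]⟩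

/-- The σ-algebra on lists of points with holding times, the points being discrete. -/
instance instMeasurableSpaceTimedList : MeasurableSpace (List (X × ℝ)) :=
  ⨅ (n : ℕ) (ξ : Fin n → X), MeasurableSpace.map (timedList ξ) MeasurableSpace.pi

theorem measurableSet_list_iff {s : Set (List (X × ℝ))} :
    MeasurableSet s ↔ ∀ (n : ℕ) (ξ : Fin n → X), MeasurableSet (timedList ξ ⁻¹' s) := by
  rw [instMeasurableSpaceTimedList, MeasurableSpace.measurableSet_iInf]
  simp_rw [MeasurableSpace.measurableSet_iInf, MeasurableSpace.map_def]

theorem measurable_list_iff {β : Type*} [MeasurableSpace β] {f : List (X × ℝ) → β} :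
    Measurable f ↔ ∀ (n : ℕ) (ξ : Fin n → X), Measurable fun τ => f (timedList ξ τ) :=
  ⟨fun h n ξ _ hs => measurableSet_list_iff.mp (h hs) n ξ,
    fun h _ hs => measurableSet_list_iff.mpr fun n ξ => h n ξ hs⟩

theorem measurable_timedList {n : ℕ} (ξ : Fin n → X) : Measurable (timedList ξ) :=
  measurable_list_iff.mp measurable_id n ξ

theorem measurableSet_loop_iff {s : Set (Loop X)} :
    MeasurableSet s ↔ MeasurableSet {l : List (X × ℝ) | (l : Loop X) ∈ s} := by
  rw [instMeasurableSpaceLoop, MeasurableSpace.measurableSet_iInf, measurableSet_list_iff]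
  simp_rw [MeasurableSpace.measurableSet_iInf, MeasurableSpace.map_def]
  rfl

theorem measurable_loop_iff {β : Type*} [MeasurableSpace β] {f : Loop X → β} :
    Measurable f ↔ Measurable fun l : List (X × ℝ) => f (l : Loop X) :=
  ⟨fun h _ hs => measurableSet_loop_iff.mp (h hs), fun h _ hs => measurableSet_loop_iff.mpr (h hs)⟩

theorem measurable_coe_loop : Measurable fun l : List (X × ℝ) => (l : Loop X) :=
  measurable_loop_iff.mp measurable_id

theorem timedList_injective {n : ℕ} (ξ : Fin n → X) : Function.Injective (timedList ξ) := by
  intro τ τ' h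
  funext i
  exact congrArg Prod.snd (congrFun (List.ofFn_injective h) i)

/-- Charts of two different words have disjoint images, and a chart is injective. In any other chart
the image of a measurable set is therefore empty. -/
theorem measurableEmbedding_timedList {n : ℕ} (ξ : Fin n → X) :
    MeasurableEmbedding (timedList ξ) := by
  refine ⟨timedList_injective ξ, measurable_timedList ξ, fun {s} hs => ?_⟩
  rw [measurableSet_list_iff]
  intro m ξ'
  by_cases h : ∃ τ τ', timedList ξ τ = timedList ξ' τ'
  · obtain ⟨τ, τ', h⟩ := h
    have h1 : List.ofFn ξ = List.ofFn ξ' := by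
      rw [← map_fst_timedList ξ τ, h, map_fst_timedList]
    have hnm : n = m := by simpa using congrArg List.length h1
    subst hnm
    have h2 : ξ = ξ' := List.ofFn_injective h1
    subst h2
    rwa [Set.preimage_image_eq _ (timedList_injective ξ)]
  · convert MeasurableSet.empty
    ext τ'
    simp only [Set.mem_preimage, Set.mem_image, Set.mem_empty_iff_false, iff_false]
    rintro ⟨τ, -, hτ⟩
    exact h ⟨τ, τ', hτ⟩

/-- The σ-algebra of lists is defined chart by chart, but that of a product with lists is not. As
`X` is countable, the product is covered by countably many images of measurable embeddings, one for
each word. -/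
theorem measurable_prod_list [Countable X] {β γ : Type*} [MeasurableSpace β] [MeasurableSpace γ]
    {f : γ → List (X × ℝ) → β}
    (h : ∀ (n : ℕ) (ξ : Fin n → X),
      Measurable fun p : γ × (Fin n → ℝ) => f p.1 (timedList ξ p.2)) :
    Measurable fun p : γ × List (X × ℝ) => f p.1 p.2 := by
  intro s hs
  have hE : ∀ (n : ℕ) (ξ : Fin n → X), MeasurableEmbedding
      (Prod.map id (timedList ξ) : γ × (Fin n → ℝ) → γ × List (X × ℝ)) :=
    fun n ξ => MeasurableEmbedding.id.prodMap (measurableEmbedding_timedList ξ)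
  have : (fun p : γ × List (X × ℝ) => f p.1 p.2) ⁻¹' s = ⋃ (n : ℕ) (ξ : Fin n → X),
      Prod.map id (timedList ξ) '' ((fun p : γ × (Fin n → ℝ) => f p.1 (timedList ξ p.2)) ⁻¹' s) := by
    ext ⟨c, l⟩
    simp only [Set.mem_preimage, Set.mem_iUnion, Set.mem_image, Prod.exists, Prod.map_apply, id,
      Prod.mk.injEq]
    constructor
    · intro hl
      obtain ⟨n, ξ, τ, rfl⟩ := exists_timedList l
      exact ⟨n, ξ, c, τ, hl, rfl, rfl⟩
    · rintro ⟨n, ξ, c, τ, hl, rfl, rfl⟩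
      exact hl
  rw [this]
  exact MeasurableSet.iUnion fun n => MeasurableSet.iUnion fun ξ =>
    (hE n ξ).measurableSet_image' (h n ξ hs)

theorem measurable_of_map_fst {β : Type*} [MeasurableSpace β] (g : List X → β) :
    Measurable fun l : List (X × ℝ) => g (l.map Prod.fst) := by
  rw [measurable_list_iff]
  intro n ξ
  simp_rw [map_fst_timedList]
  exact measurable_const

section Trace

variable [DecidableEq X]

/-- The trace on `F` of a path: delete the points outside `F` and merge the runs. -/
def tracePath (F : Finset X) (l : List (X × ℝ)) : List (X × ℝ) :=
  mergeRuns (l.filter fun p => p.1 ∈ F)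

theorem tracePath_nil (F : Finset X) : tracePath F [] = [] := rfl

theorem tracePath_cons_of_mem {F : Finset X} {x : X} (hx : x ∈ F) (t : ℝ) (l : List (X × ℝ)) :
    tracePath F ((x, t) :: l) = mergeCons (x, t) (tracePath F l) := by
  simp [tracePath, hx, mergeRuns]

theorem tracePath_cons_of_notMem {F : Finset X} {x : X} (hx : x ∉ F) (t : ℝ)
    (l : List (X × ℝ)) : tracePath F ((x, t) :: l) = tracePath F l := by
  simp [tracePath, hx]

theorem trace_coe (F : Finset X) (l : List (X × ℝ)) :
    Loop.trace F (l : Loop X) = (traceList F l : Loop X) := rfl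

end Trace

variable [Countable X]

theorem measurable_cons_uncurry (x : X) :
    Measurable fun p : ℝ × List (X × ℝ) => (x, p.1) :: p.2 := by
  refine measurable_prod_list (f := fun (t : ℝ) (l : List (X × ℝ)) => (x, t) :: l) fun n ξ => ?_
  have : ∀ p : ℝ × (Fin n → ℝ), (x, p.1) :: timedList ξ p.2 =
      timedList (Fin.cons x ξ : Fin (n + 1) → X) (Fin.cons p.1 p.2 : Fin (n + 1) → ℝ) := by
    intro p
    simp [timedList_succ]
  simp_rw [this]
  refine (measurable_timedList _).comp (measurable_pi_lambda _ fun i => ?_)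
  refine Fin.cases ?_ (fun i => ?_) i
  · simpa using measurable_fst
  · simpa using (by fun_prop : Measurable fun c : ℝ × (Fin n → ℝ) => c.2 i)

theorem Measurable.timedCons {γ : Type*} [MeasurableSpace γ] (x : X) {f : γ → ℝ}
    {g : γ → List (X × ℝ)} (hf : Measurable f) (hg : Measurable g) :
    Measurable fun c => (x, f c) :: g c :=
  (measurable_cons_uncurry x).comp (hf.prodMk hg)

theorem measurable_append_uncurry (x : X) :
    Measurable fun p : ℝ × List (X × ℝ) => p.2 ++ [(x, p.1)] := by
  refine measurable_prod_list (f := fun (t : ℝ) (l : List (X × ℝ)) => l ++ [(x, t)]) fun n ξ => ?_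
  have : ∀ p : ℝ × (Fin n → ℝ), timedList ξ p.2 ++ [(x, p.1)] =
      timedList (Fin.snoc ξ x : Fin (n + 1) → X) (Fin.snoc p.2 p.1 : Fin (n + 1) → ℝ) := by
    intro p
    simp [timedList_succ_last]
  simp_rw [this]
  refine (measurable_timedList _).comp (measurable_pi_lambda _ fun i => ?_)
  refine Fin.lastCases ?_ (fun i => ?_) i
  · simpa using measurable_fst
  · simpa using (by fun_prop : Measurable fun c : ℝ × (Fin n → ℝ) => c.2 i)

theorem Measurable.timedAppend {γ : Type*} [MeasurableSpace γ] (x : X) {f : γ → ℝ}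
    {g : γ → List (X × ℝ)} (hf : Measurable f) (hg : Measurable g) :
    Measurable fun c => g c ++ [(x, f c)] :=
  (measurable_append_uncurry x).comp (hf.prodMk hg)

theorem measurable_rotate_one : Measurable fun l : List (X × ℝ) => l.rotate 1 := by
  rw [measurable_list_iff]
  intro n ξ
  cases n with
  | zero => simp [timedList_zero]
  | succ n =>
    simp_rw [timedList_succ, List.rotate_cons_succ, List.rotate_zero]
    exact Measurable.timedAppend _ (by fun_prop) ((measurable_timedList _).comp (by fun_prop))

theorem measurable_rotate (k : ℕ) : Measurable fun l : List (X × ℝ) => l.rotate k := by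
  induction k with
  | zero => simpa using measurable_id'
  | succ k ih =>
    simp_rw [← List.rotate_rotate _ k 1]
    exact measurable_rotate_one.comp ih

/-! ### Measurability of the trace -/

section Trace

variable [DecidableEq X]

theorem measurable_mergeCons_uncurry (x : X) :
    Measurable fun p : ℝ × List (X × ℝ) => mergeCons (x, p.1) p.2 := by
  refine measurable_prod_list (f := fun (t : ℝ) (l : List (X × ℝ)) => mergeCons (x, t) l)
    fun n ξ => ?_
  cases n with
  | zero =>
    simp_rw [timedList_zero, mergeCons]
    exact Measurable.timedCons _ measurable_fst measurable_const
  | succ n =>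
    have ht : Measurable fun p : ℝ × (Fin (n + 1) → ℝ) =>
        timedList (fun i => ξ i.succ) fun i => p.2 i.succ :=
      (measurable_timedList _).comp (by fun_prop)
    simp_rw [timedList_succ, mergeCons]
    split_ifs
    · exact Measurable.timedCons _ (by fun_prop) ht
    · exact Measurable.timedCons _ (by fun_prop) (Measurable.timedCons _ (by fun_prop) ht)

theorem Measurable.mergeCons {γ : Type*} [MeasurableSpace γ] (x : X) {f : γ → ℝ}
    {g : γ → List (X × ℝ)} (hf : Measurable f) (hg : Measurable g) :
    Measurable fun c => MarkovLoops.mergeCons (x, f c) (g c) :=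
  (measurable_mergeCons_uncurry x).comp (hf.prodMk hg)

theorem measurable_tracePath (F : Finset X) : Measurable (tracePath F) := by
  rw [measurable_list_iff]
  intro n
  induction n with
  | zero =>
    intro ξ
    simp_rw [timedList_zero]
    exact measurable_const
  | succ n ih =>
    intro ξ
    have h := (ih fun i => ξ i.succ).comp
      (show Measurable fun (τ : Fin (n + 1) → ℝ) i => τ (Fin.succ i) by fun_prop)
    simp_rw [timedList_succ]
    by_cases hx : ξ 0 ∈ F
    · simp_rw [tracePath_cons_of_mem hx]
      exact Measurable.mergeCons _ (by fun_prop) h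
    · simp_rw [tracePath_cons_of_notMem hx]
      exact h

theorem measurable_mergeEnds : Measurable (mergeEnds : List (X × ℝ) → List (X × ℝ)) := by
  rw [measurable_list_iff]
  intro n ξ
  rcases n with _ | _ | n
  · simp_rw [timedList_zero]
    exact measurable_const
  · simp_rw [timedList_succ, timedList_zero, mergeEnds]
    exact Measurable.timedCons _ (by fun_prop) measurable_const
  · have h := measurable_timedList ξ
    have h' : ∀ τ : Fin (n + 1 + 1) → ℝ, timedList ξ τ = (ξ 0, τ 0) ::
        ((timedList (fun i => ξ i.castSucc.succ) fun i => τ i.castSucc.succ) ++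
          [(ξ (Fin.last n).succ, τ (Fin.last n).succ)]) := fun τ => by
      rw [timedList_succ, timedList_succ_last]
    by_cases hξ : ξ 0 = ξ (Fin.last n).succ
    · have e : (fun τ => mergeEnds (timedList ξ τ)) = fun τ => (ξ 0, τ 0 + τ (Fin.last n).succ) ::
          timedList (fun i => ξ i.castSucc.succ) fun i => τ i.castSucc.succ := by
        funext τ
        rw [h', mergeEnds_cons_concat, if_pos hξ]
      rw [e]
      exact Measurable.timedCons _ (by fun_prop) ((measurable_timedList _).comp (by fun_prop))
    · have e : (fun τ => mergeEnds (timedList ξ τ)) = timedList ξ := by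
        funext τ
        rw [h', mergeEnds_cons_concat, if_neg hξ]
      rw [e]
      exact h

theorem measurable_traceList (F : Finset X) : Measurable (traceList F) :=
  measurable_mergeEnds.comp (measurable_tracePath F)

theorem measurable_trace (F : Finset X) : Measurable (Loop.trace F) := by
  rw [measurable_loop_iff]
  simp_rw [trace_coe]
  exact measurable_coe_loop.comp (measurable_traceList F)

end Trace

end ListMeasurable

/-! ### Exponential holding times -/

/-- The measure `exp (-a t) dt` on `t > 0`. -/
def expM (a : ℝ) : Measure ℝ :=
  (volume.restrict (Set.Ioi 0)).withDensity fun t => ENNReal.ofReal (Real.exp (-(a * t)))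

instance (a : ℝ) : SFinite (expM a) := by unfold expM; infer_instance

theorem lintegral_expM (a : ℝ) {f : ℝ → ℝ≥0∞} (hf : Measurable f) :
    ∫⁻ t, f t ∂expM a = ∫⁻ t in Set.Ioi 0, ENNReal.ofReal (Real.exp (-(a * t))) * f t := by
  rw [expM, lintegral_withDensity_eq_lintegral_mul _ (by fun_prop) hf]
  rfl

theorem ae_pos_expM (a : ℝ) : ∀ᵐ t ∂expM a, 0 < t :=
  (withDensity_absolutelyContinuous _ _).ae_le (ae_restrict_mem measurableSet_Ioi)

theorem expM_univ {a : ℝ} (ha : 0 < a) : expM a Set.univ = ENNReal.ofReal a⁻¹ := by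
  have h := lintegral_expM a (f := fun _ => 1) measurable_const
  rw [lintegral_one] at h
  rw [h]
  simp_rw [mul_one]
  have hi : IntegrableOn (fun t : ℝ => Real.exp (-a * t)) (Set.Ioi 0) :=
    integrableOn_exp_mul_Ioi (neg_lt_zero.mpr ha) 0
  have := ofReal_integral_eq_lintegral_ofReal hi
    (Filter.Eventually.of_forall fun t => (Real.exp_pos _).le)
  simp_rw [← neg_mul]
  rw [← this, integral_exp_mul_Ioi (neg_lt_zero.mpr ha)]
  congr 1
  simp [neg_div_neg_eq]

theorem lintegral_expM_mul (a b : ℝ) {f : ℝ → ℝ≥0∞} (hf : Measurable f) :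
    ∫⁻ t, ENNReal.ofReal (Real.exp (-(b * t))) * f t ∂expM a = ∫⁻ t, f t ∂expM (a + b) := by
  rw [lintegral_expM _ (by fun_prop), lintegral_expM _ hf]
  refine lintegral_congr fun t => ?_
  rw [← mul_assoc, ← ENNReal.ofReal_mul (Real.exp_nonneg _), ← Real.exp_add]
  congr 3
  ring

/-- The substitution $u=s+t$ at fixed $s$, followed by Tonelli on $\{0<s<u\}$. -/
theorem lintegral_lintegral_add_Ioi {k f : ℝ → ℝ≥0∞} (hk : Measurable k) (hf : Measurable f) :
    ∫⁻ s in Set.Ioi 0, k s * ∫⁻ t in Set.Ioi 0, f (s + t) =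
      ∫⁻ u in Set.Ioi 0, f u * ∫⁻ s in Set.Ioo 0 u, k s := by
  have h1 : ∀ s, ∫⁻ t in Set.Ioi 0, f (s + t) = ∫⁻ u, (Set.Ioi s).indicator f u := by
    intro s
    rw [← lintegral_indicator measurableSet_Ioi,
      ← lintegral_add_left_eq_self ((Set.Ioi s).indicator f) s]
    refine lintegral_congr fun t => ?_
    simp [Set.indicator]
  have hm : Measurable (Function.uncurry fun s u : ℝ =>
      (Set.Ioi (0 : ℝ)).indicator k s * (Set.Ioi s).indicator f u) := by
    refine ((hk.indicator measurableSet_Ioi).comp measurable_fst).mul ?_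
    have : (fun p : ℝ × ℝ => (Set.Ioi p.1).indicator f p.2) =
        {p : ℝ × ℝ | p.1 < p.2}.indicator fun p => f p.2 := by
      ext p
      simp [Set.indicator]
    rw [this]
    exact (hf.comp measurable_snd).indicator (measurableSet_lt measurable_fst measurable_snd)
  rw [← lintegral_indicator measurableSet_Ioi, ← lintegral_indicator measurableSet_Ioi]
  have h2 : ∀ s, (Set.Ioi (0 : ℝ)).indicator
      (fun s => k s * ∫⁻ t in Set.Ioi 0, f (s + t)) s =
      ∫⁻ u, (Set.Ioi (0 : ℝ)).indicator k s * (Set.Ioi s).indicator f u := by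
    intro s
    rw [lintegral_const_mul _ (hf.indicator measurableSet_Ioi), ← h1,
      Set.indicator_mul_left]
  simp_rw [h2]
  rw [lintegral_lintegral_swap hm.aemeasurable]
  refine lintegral_congr fun u => ?_
  have h3 : ∀ s, (Set.Ioi (0 : ℝ)).indicator k s * (Set.Ioi s).indicator f u =
      f u * (Set.Ioo 0 u).indicator k s := by
    intro s
    by_cases h0 : 0 < s <;> by_cases hu : s < u <;> simp [Set.indicator, h0, hu, mul_comm]
  simp_rw [h3]
  rw [lintegral_const_mul _ (hk.indicator measurableSet_Ioo), lintegral_indicator measurableSet_Ioo]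
  by_cases hu : 0 < u
  · simp [hu]
  · simp [hu]

theorem lintegral_expM_lintegral_expM_add (a b : ℝ) {f : ℝ → ℝ≥0∞} (hf : Measurable f) :
    ∫⁻ s, ∫⁻ t, f (s + t) ∂expM b ∂expM a =
      ∫⁻ u, f u * (∫⁻ s in Set.Ioo 0 u, ENNReal.ofReal (Real.exp ((b - a) * s))) ∂expM b := by
  have hm : Measurable fun s => ∫⁻ t, f (s + t) ∂expM b :=
    Measurable.lintegral_prod_right' (f := fun p : ℝ × ℝ => f (p.1 + p.2)) (by fun_prop)
  have hm2 : Measurable fun u : ℝ =>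
      ∫⁻ s in Set.Ioo 0 u, ENNReal.ofReal (Real.exp ((b - a) * s)) := by
    refine Monotone.measurable fun u v h => ?_
    exact lintegral_mono_set (Set.Ioo_subset_Ioo_right h)
  rw [lintegral_expM _ hm, lintegral_expM _ (f := fun u => f u * _) (hf.mul hm2)]
  have h1 : ∀ s, ENNReal.ofReal (Real.exp (-(a * s))) * ∫⁻ t, f (s + t) ∂expM b =
      ENNReal.ofReal (Real.exp ((b - a) * s)) * ∫⁻ t in Set.Ioi 0,
        (fun u => ENNReal.ofReal (Real.exp (-(b * u))) * f u) (s + t) := by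
    intro s
    rw [lintegral_expM _ (by fun_prop), ← lintegral_const_mul _ (by fun_prop),
      ← lintegral_const_mul _ (by fun_prop)]
    refine lintegral_congr fun t => ?_
    simp only [← mul_assoc]
    rw [← ENNReal.ofReal_mul (Real.exp_nonneg _), ← ENNReal.ofReal_mul (Real.exp_nonneg _),
      ← Real.exp_add, ← Real.exp_add]
    congr 3
    ring
  refine (lintegral_congr h1).trans ((lintegral_lintegral_add_Ioi
    (k := fun s => ENNReal.ofReal (Real.exp ((b - a) * s)))
    (f := fun u => ENNReal.ofReal (Real.exp (-(b * u))) * f u)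
    (by fun_prop) (by fun_prop)).trans ?_)
  simp_rw [mul_assoc]

/-- Splitting an exponential holding time at a uniform point. -/
theorem lintegral_expM_split (a : ℝ) {f : ℝ → ℝ≥0∞} (hf : Measurable f) :
    ∫⁻ s, ∫⁻ t, f (s + t) ∂expM a ∂expM a = ∫⁻ u, ENNReal.ofReal u * f u ∂expM a := by
  rw [lintegral_expM_lintegral_expM_add a a hf]
  refine lintegral_congr fun u => ?_
  simp [mul_comm]

/-- The fundamental theorem of calculus for $e^{Ks}$, written without dividing by $K$ so that $K=0$
is included. -/
theorem lintegral_Ioo_exp {K u : ℝ} (hK : 0 ≤ K) (hu : 0 < u) :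
    ENNReal.ofReal K * (∫⁻ s in Set.Ioo 0 u, ENNReal.ofReal (Real.exp (K * s))) + 1 =
      ENNReal.ofReal (Real.exp (K * u)) := by
  rcases hK.eq_or_lt with rfl | hK
  · simp
  have hi : IntegrableOn (fun s : ℝ => Real.exp (K * s)) (Set.Ioo 0 u) :=
    ((by fun_prop : Continuous fun s : ℝ => Real.exp (K * s)).integrableOn_Icc).mono_set
      Set.Ioo_subset_Icc_self
  rw [← ofReal_integral_eq_lintegral_ofReal hi
    (Filter.Eventually.of_forall fun t => (Real.exp_pos _).le), ← integral_Ioc_eq_integral_Ioo,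
    ← intervalIntegral.integral_of_le hu.le, intervalIntegral.integral_comp_mul_left _ hK.ne',
    integral_exp, ← ENNReal.ofReal_mul hK.le, ← ENNReal.ofReal_one, ← ENNReal.ofReal_add]
  · congr 1
    simp only [mul_zero, Real.exp_zero, smul_eq_mul]
    field_simp
    ring
  · have := Real.one_le_exp (mul_pos hK hu).le
    simp only [mul_zero, Real.exp_zero, smul_eq_mul]
    exact mul_nonneg hK.le (mul_nonneg (inv_nonneg.mpr hK.le) (by linarith))
  · exact zero_le_one

/-- The resolvent identity for exponential holding times. -/
theorem lintegral_expM_resolvent (a : ℝ) {K : ℝ} (hK : 0 ≤ K) {f : ℝ → ℝ≥0∞}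
    (hf : Measurable f) :
    ENNReal.ofReal K * ∫⁻ s, ∫⁻ t, f (s + t) ∂expM (a + K) ∂expM a + ∫⁻ t, f t ∂expM (a + K) =
      ∫⁻ t, f t ∂expM a := by
  have hm2 : Measurable fun u : ℝ =>
      ∫⁻ s in Set.Ioo 0 u, ENNReal.ofReal (Real.exp ((a + K - a) * s)) := by
    refine Monotone.measurable fun u v h => ?_
    exact lintegral_mono_set (Set.Ioo_subset_Ioo_right h)
  rw [lintegral_expM_lintegral_expM_add _ _ hf, ← lintegral_const_mul _ (show Measurable fun u => f u * _ from hf.mul hm2),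
    ← lintegral_add_right _ hf]
  -- Both sides are now integrals against the faster exponential measure; it remains to compare the
  -- weights, which is $e^{Ku}=1+K\int_0^ue^{Ks}\,ds$.
  have h0 : ∫⁻ t, f t ∂expM a = ∫⁻ t, ENNReal.ofReal (Real.exp (K * t)) * f t ∂expM (a + K) := by
    have := lintegral_expM_mul (a + K) (-K) hf
    rw [add_neg_cancel_right] at this
    rw [← this]
    simp
  rw [h0]
  refine lintegral_congr_ae ?_
  filter_upwards [ae_pos_expM (a + K)] with u hu
  rw [← lintegral_Ioo_exp hK hu, add_sub_cancel_left]
  ring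

/-! ### Holding times along a word -/

section Words

variable {X : Type*}

/-- The measure of the timed lists with points given by a word and independent holding times, the
holding time at `x` having the measure `exp (-λ_x t) dt`. -/
def wordM (lam : X → ℝ) : List X → Measure (List (X × ℝ))
  | [] => Measure.dirac []
  | x :: w => ((expM (lam x)).prod (wordM lam w)).map fun p => (x, p.1) :: p.2

instance (lam : X → ℝ) (w : List X) : SFinite (wordM lam w) := by
  induction w with
  | nil => unfold wordM; infer_instance
  | cons x w ih => unfold wordM; infer_instance

theorem lintegral_wordM_nil (lam : X → ℝ) {G : List (X × ℝ) → ℝ≥0∞} (hG : Measurable G) :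
    ∫⁻ l, G l ∂wordM lam [] = G [] := lintegral_dirac' _ hG

theorem measurableSet_map_fst (s : Set (List X)) :
    MeasurableSet {l : List (X × ℝ) | l.map Prod.fst ∈ s} :=
  measurable_of_map_fst (β := Prop) (fun w => w ∈ s) (measurableSet_singleton True) |>.congr
    (by ext; simp)

theorem measurableSet_forall_pos :
    MeasurableSet {l : List (X × ℝ) | ∀ p ∈ l, 0 < p.2} := by
  rw [measurableSet_list_iff]
  intro n ξ
  have : timedList ξ ⁻¹' {l : List (X × ℝ) | ∀ p ∈ l, 0 < p.2} = ⋂ i, {τ | 0 < τ i} := by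
    ext τ
    simp only [timedList, Set.mem_preimage, Set.mem_ofPred_eq, List.forall_mem_ofFn_iff,
      Set.mem_iInter]
  rw [this]
  exact MeasurableSet.iInter fun i => measurableSet_lt measurable_const (measurable_pi_apply i)

/-- The total `∑ᵢ δ_{ξᵢ} τᵢ` of the holding times with weights `δ`. -/
def weightedTime (δ : X → ℝ) (l : List (X × ℝ)) : ℝ := (l.map fun p => δ p.1 * p.2).sum

theorem measurable_weightedTime (δ : X → ℝ) : Measurable (weightedTime δ) := by
  rw [measurable_list_iff]
  intro n ξ
  have : ∀ τ, weightedTime δ (timedList ξ τ) = ∑ i, δ (ξ i) * τ i := by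
    intro τ
    simp [weightedTime, timedList, List.map_ofFn, Function.comp_def, List.sum_ofFn]
  simp_rw [this]
  fun_prop

variable [Countable X]

theorem lintegral_wordM_cons (lam : X → ℝ) (x : X) (w : List X) {G : List (X × ℝ) → ℝ≥0∞}
    (hG : Measurable G) :
    ∫⁻ l, G l ∂wordM lam (x :: w) =
      ∫⁻ t, ∫⁻ l, G ((x, t) :: l) ∂wordM lam w ∂expM (lam x) := by
  rw [wordM, lintegral_map hG (measurable_cons_uncurry x),
    lintegral_prod _ (hG.fun_comp (measurable_cons_uncurry x)).aemeasurable]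

theorem lintegral_wordM_append (lam : X → ℝ) (x : X) (w : List X) {G : List (X × ℝ) → ℝ≥0∞}
    (hG : Measurable G) :
    ∫⁻ l, G l ∂wordM lam (w ++ [x]) =
      ∫⁻ l, ∫⁻ t, G (l ++ [(x, t)]) ∂expM (lam x) ∂wordM lam w := by
  have hm : ∀ {H : List (X × ℝ) → ℝ≥0∞}, Measurable H →
      Measurable fun l => ∫⁻ t, H (l ++ [(x, t)]) ∂expM (lam x) := fun {H} hH =>
    Measurable.lintegral_prod_left' (f := fun p : ℝ × List (X × ℝ) => H (p.2 ++ [(x, p.1)]))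
      (hH.fun_comp (measurable_append_uncurry x))
  induction w generalizing G with
  | nil =>
    rw [List.nil_append, lintegral_wordM_cons _ _ _ hG, lintegral_wordM_nil _ (hm hG)]
    refine lintegral_congr fun t => ?_
    rw [lintegral_wordM_nil lam (hG.fun_comp (Measurable.timedCons x measurable_const measurable_id'))]
    rfl
  | cons y w ih =>
    rw [List.cons_append, lintegral_wordM_cons _ _ _ hG, lintegral_wordM_cons _ _ _ (hm hG)]
    refine lintegral_congr fun t => ?_
    rw [ih (hG.fun_comp (Measurable.timedCons y measurable_const measurable_id'))]
    rfl

theorem lintegral_wordM_rotate_one (lam : X → ℝ) (w : List X) {G : List (X × ℝ) → ℝ≥0∞}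
    (hG : Measurable G) :
    ∫⁻ l, G (l.rotate 1) ∂wordM lam w = ∫⁻ l, G l ∂wordM lam (w.rotate 1) := by
  cases w with
  | nil =>
    rw [List.rotate_nil, lintegral_wordM_nil lam hG,
      lintegral_wordM_nil lam (hG.fun_comp measurable_rotate_one)]
    rfl
  | cons x w =>
    rw [List.rotate_cons_succ, List.rotate_zero, lintegral_wordM_append _ _ _ hG,
      lintegral_wordM_cons _ _ _ (hG.fun_comp measurable_rotate_one)]
    simp_rw [List.rotate_cons_succ, List.rotate_zero]
    exact lintegral_lintegral_swap (hG.fun_comp (measurable_append_uncurry x)).aemeasurable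

theorem lintegral_wordM_rotate (lam : X → ℝ) (w : List X) (k : ℕ) {G : List (X × ℝ) → ℝ≥0∞}
    (hG : Measurable G) :
    ∫⁻ l, G (l.rotate k) ∂wordM lam w = ∫⁻ l, G l ∂wordM lam (w.rotate k) := by
  induction k generalizing G with
  | zero => simp
  | succ k ih =>
    simp_rw [← List.rotate_rotate _ k 1]
    rw [← lintegral_wordM_rotate_one _ _ hG]
    exact ih (hG.fun_comp measurable_rotate_one)

theorem ae_wordM_cons (lam : X → ℝ) (x : X) (w : List X) {p : List (X × ℝ) → Prop}
    (hp : MeasurableSet {l | p l}) (h : ∀ t, 0 < t → ∀ᵐ l ∂wordM lam w, p ((x, t) :: l)) :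
    ∀ᵐ l ∂wordM lam (x :: w), p l := by
  rw [wordM, ae_map_iff (measurable_cons_uncurry x).aemeasurable hp,
    Measure.ae_prod_iff_ae_ae (p := fun q : ℝ × List (X × ℝ) => p ((x, q.1) :: q.2))
      (measurable_cons_uncurry x hp)]
  filter_upwards [ae_pos_expM (lam x)] with t ht using h t ht

theorem ae_wordM_map_fst (lam : X → ℝ) (w : List X) :
    ∀ᵐ l ∂wordM lam w, l.map Prod.fst = w := by
  induction w with
  | nil =>
    rw [wordM]
    exact (ae_dirac_iff (measurableSet_map_fst {[]})).mpr rfl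
  | cons x w ih =>
    refine ae_wordM_cons _ _ _ (measurableSet_map_fst {x :: w}) fun t _ => ?_
    filter_upwards [ih] with l hl
    simp [hl]

theorem ae_wordM_pos (lam : X → ℝ) (w : List X) :
    ∀ᵐ l ∂wordM lam w, ∀ p ∈ l, 0 < p.2 := by
  induction w with
  | nil =>
    rw [wordM, ae_dirac_iff measurableSet_forall_pos]
    simp
  | cons x w ih =>
    refine ae_wordM_cons _ _ _ measurableSet_forall_pos fun t ht => ?_
    filter_upwards [ih] with l hl
    simpa [ht] using hl

theorem lintegral_wordM_map_fst {lam : X → ℝ} {w : List X} (hlam : ∀ x ∈ w, 0 < lam x)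
    (g : List X → ℝ≥0∞) :
    ∫⁻ l, g (l.map Prod.fst) ∂wordM lam w =
      g w * (w.map fun x => ENNReal.ofReal (lam x)⁻¹).prod := by
  have h1 : ∫⁻ l, g (l.map Prod.fst) ∂wordM lam w = ∫⁻ _, g w ∂wordM lam w := by
    refine lintegral_congr_ae ?_
    filter_upwards [ae_wordM_map_fst lam w] with l hl
    rw [hl]
  rw [h1, lintegral_const]
  congr 1
  induction w with
  | nil => simp [wordM]
  | cons x w ih =>
    rw [wordM, Measure.map_apply (measurable_cons_uncurry x) MeasurableSet.univ, Set.preimage_univ,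
      ← Set.univ_prod_univ, Measure.prod_prod, ih fun y hy => hlam y (List.mem_cons_of_mem x hy),
      expM_univ (hlam x List.mem_cons_self), List.map_cons, List.prod_cons]
    · refine lintegral_congr_ae ?_
      filter_upwards [ae_wordM_map_fst lam w] with l hl
      rw [hl]

theorem lintegral_wordM_exp_weightedTime (lam δ : X → ℝ) (w : List X) {G : List (X × ℝ) → ℝ≥0∞}
    (hG : Measurable G) :
    ∫⁻ l, ENNReal.ofReal (Real.exp (-weightedTime δ l)) * G l ∂wordM lam w =
      ∫⁻ l, G l ∂wordM (fun x => lam x + δ x) w := by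
  have hw := measurable_weightedTime δ
  induction w generalizing G with
  | nil =>
    rw [lintegral_wordM_nil _ hG, lintegral_wordM_nil _ (by fun_prop)]
    simp [weightedTime]
  | cons x w ih =>
    rw [lintegral_wordM_cons _ _ _ hG, lintegral_wordM_cons _ _ _ (by fun_prop)]
    have hmc : ∀ t : ℝ, Measurable fun l : List (X × ℝ) => (x, t) :: l :=
      fun t => Measurable.timedCons x measurable_const measurable_id'
    have h1 : ∀ t, ∫⁻ l, ENNReal.ofReal (Real.exp (-weightedTime δ ((x, t) :: l))) *
        G ((x, t) :: l) ∂wordM lam w = ENNReal.ofReal (Real.exp (-(δ x * t))) *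
        ∫⁻ l, G ((x, t) :: l) ∂wordM (fun x => lam x + δ x) w := by
      intro t
      have hGc : Measurable fun l => G ((x, t) :: l) := hG.fun_comp (hmc t)
      rw [← ih hGc, ← lintegral_const_mul _ (by fun_prop)]
      refine lintegral_congr fun l => ?_
      rw [← mul_assoc, ← ENNReal.ofReal_mul (Real.exp_nonneg _), ← Real.exp_add, weightedTime,
        List.map_cons, List.sum_cons, neg_add]
      rfl
    simp_rw [h1]
    exact lintegral_expM_mul _ _ (Measurable.lintegral_prod_right' (f := fun p : ℝ × List (X × ℝ) =>
      G ((x, p.1) :: p.2)) (hG.fun_comp (measurable_cons_uncurry x)))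

/-- This identifies the density on $\mathbb R^n$ used in the loop measure with the recursive measure
`wordM`, by Tonelli in the first coordinate. -/
theorem lintegral_timedList (lam : X → ℝ) {n : ℕ} (ξ : Fin n → X) {G : List (X × ℝ) → ℝ≥0∞}
    (hG : Measurable G) :
    ∫⁻ τ in {τ : Fin n → ℝ | ∀ i, 0 < τ i},
        ENNReal.ofReal (∏ i, Real.exp (-(lam (ξ i) * τ i))) * G (timedList ξ τ) =
      ∫⁻ l, G l ∂wordM lam (List.ofFn ξ) := by
  have hS : ∀ n : ℕ, MeasurableSet {τ : Fin n → ℝ | ∀ i, 0 < τ i} := fun n => by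
    have : {τ : Fin n → ℝ | ∀ i, 0 < τ i} = ⋂ i, {τ | 0 < τ i} := by ext; simp
    rw [this]
    exact MeasurableSet.iInter fun i => measurableSet_lt measurable_const (measurable_pi_apply i)
  have hF : ∀ (n : ℕ) (ξ : Fin n → X) {G : List (X × ℝ) → ℝ≥0∞}, Measurable G →
      Measurable ({τ : Fin n → ℝ | ∀ i, 0 < τ i}.indicator fun τ =>
        ENNReal.ofReal (∏ i, Real.exp (-(lam (ξ i) * τ i))) * G (timedList ξ τ)) := by
    intro n ξ G hG
    refine Measurable.indicator ?_ (hS n)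
    have := hG.fun_comp (measurable_timedList ξ)
    exact Measurable.mul (by fun_prop) this
  rw [← lintegral_indicator (hS n)]
  induction n generalizing G with
  | zero =>
    rw [List.ofFn_zero, lintegral_wordM_nil _ hG]
    simp [timedList_zero, lintegral_unique, volume_pi]
  | succ n ih =>
    have hp := volume_preserving_piFinSuccAbove (fun _ : Fin (n + 1) => ℝ) 0
    have hG1 := hG.fun_comp (measurable_cons_uncurry (ξ 0))
    rw [List.ofFn_succ, lintegral_wordM_cons _ _ _ hG,
      ← hp.symm.lintegral_comp (hF (n + 1) ξ hG), Measure.volume_eq_prod,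
      lintegral_prod _ ((hF (n + 1) ξ hG).fun_comp hp.symm.measurable).aemeasurable, 
      lintegral_expM _ (Measurable.lintegral_prod_right' hG1),
      ← lintegral_indicator measurableSet_Ioi]
    refine lintegral_congr fun t => ?_
    have hGc : Measurable fun l => G ((ξ 0, t) :: l) :=
      hG.fun_comp (Measurable.timedCons _ measurable_const measurable_id')
    have h1 : ∀ τ : Fin n → ℝ, ({τ : Fin (n + 1) → ℝ | ∀ i, 0 < τ i}.indicator fun τ =>
        ENNReal.ofReal (∏ i, Real.exp (-(lam (ξ i) * τ i))) * G (timedList ξ τ))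
          ((MeasurableEquiv.piFinSuccAbove (fun _ : Fin (n + 1) => ℝ) 0).symm (t, τ)) =
        (Set.Ioi (0 : ℝ)).indicator (fun t => ENNReal.ofReal (Real.exp (-(lam (ξ 0) * t)))) t *
        ({τ : Fin n → ℝ | ∀ i, 0 < τ i}.indicator fun τ =>
        ENNReal.ofReal (∏ i : Fin n, Real.exp (-(lam (ξ i.succ) * τ i))) *
          G ((ξ 0, t) :: timedList (fun i => ξ i.succ) τ)) τ := by
      intro τ
      have h2 : (MeasurableEquiv.piFinSuccAbove (fun _ : Fin (n + 1) => ℝ) 0).symm (t, τ) =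
          (Fin.cons t τ : Fin (n + 1) → ℝ) := by
        ext i
        simp [MeasurableEquiv.piFinSuccAbove]
      rw [h2]
      simp only [Set.indicator, Set.mem_ofPred_eq, Fin.forall_fin_succ, Fin.cons_zero,
        Fin.cons_succ, Set.mem_Ioi, Fin.prod_univ_succ, timedList_succ]
      by_cases ht : 0 < t <;> by_cases hτ : ∀ i, 0 < τ i <;> simp [ht, hτ]
      rw [ENNReal.ofReal_mul (Real.exp_nonneg _), mul_assoc]
    simp_rw [h1]
    rw [lintegral_const_mul _ (hF n _ hGc), ih _ hGc]
    simp only [Set.indicator]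
    split_ifs <;> simp

end Words

/-! ### Weights of words -/

section Weights

variable {X : Type*}

/-- The weight `C x w₁ * C w₁ w₂ * ⋯ * C wₙ y` of the path from `x` to `y` through the word `w`. -/
def linkW (C : X → X → ℝ≥0∞) : X → List X → X → ℝ≥0∞
  | x, [], y => C x y
  | x, z :: w, y => C x z * linkW C z w y

/-- The cyclic weight of a word. -/
def cycW (C : X → X → ℝ≥0∞) : List X → ℝ≥0∞
  | [] => 0
  | x :: w => linkW C x w x

theorem linkW_append (C : X → X → ℝ≥0∞) (x : X) (w : List X) (z y : X) :
    linkW C x (w ++ [z]) y = linkW C x w z * C z y := by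
  induction w generalizing x with
  | nil => rfl
  | cons a w ih => rw [List.cons_append, linkW, linkW, ih, mul_assoc]

theorem cycW_rotate_one (C : X → X → ℝ≥0∞) (w : List X) : cycW C (w.rotate 1) = cycW C w := by
  rcases w with _ | ⟨x, _ | ⟨z, w⟩⟩
  · rfl
  · rw [List.rotate_singleton]
  · rw [List.rotate_cons_succ, List.rotate_zero, List.cons_append, cycW, linkW_append, cycW, linkW,
      mul_comm]

theorem cycW_rotate (C : X → X → ℝ≥0∞) (w : List X) (k : ℕ) : cycW C (w.rotate k) = cycW C w := by
  induction k with
  | zero => simp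
  | succ k ih => rw [← List.rotate_rotate _ k 1, cycW_rotate_one, ih]

theorem linkW_ofFn (C : X → X → ℝ≥0∞) {n : ℕ} (ξ : Fin (n + 1) → X) (y : X) :
    linkW C (ξ 0) (List.ofFn fun i : Fin n => ξ i.succ) y =
      (∏ i : Fin n, C (ξ i.castSucc) (ξ i.succ)) * C (ξ (Fin.last n)) y := by
  induction n with
  | zero => simp [linkW]
  | succ n ih =>
    rw [List.ofFn_succ, linkW, ih fun i => ξ i.succ, Fin.prod_univ_succ, mul_assoc]
    rfl

theorem cycW_ofFn (C : X → X → ℝ≥0∞) {n : ℕ} (ξ : Fin (n + 1) → X) :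
    cycW C (List.ofFn ξ) = ∏ i, C (ξ i) (ξ (i + 1)) := by
  rw [List.ofFn_succ, cycW, linkW_ofFn, Fin.prod_univ_castSucc, Fin.last_add_one]
  simp_rw [Fin.coeSucc_eq_succ]

/-- The weight of a word in the loop measure. -/
def loopW (C : X → X → ℝ≥0∞) (w : List X) : ℝ≥0∞ :=
  if 2 ≤ w.length then cycW C w / w.length else 0

theorem tsum_list_cons [Fintype X] (f : List X → ℝ≥0∞) :
    ∑' w, f w = f [] + ∑ x, ∑' w, f (x :: w) := by
  classical
  rw [ENNReal.tsum_eq_add_tsum_ite []]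
  congr 1
  have hinj : Function.Injective fun p : X × List X => p.1 :: p.2 := by
    rintro ⟨a, l⟩ ⟨b, m⟩ h
    simpa using h
  refine (hinj.tsum_eq fun w hw => ?_).symm.trans ?_
  · cases w with
    | nil => simp at hw
    | cons a l => exact ⟨(a, l), rfl⟩
  · rw [ENNReal.tsum_prod', tsum_fintype]
    simp

theorem tsum_list_append [Fintype X] (f : List X → ℝ≥0∞) :
    ∑' w, f w = f [] + ∑ x, ∑' w, f (w ++ [x]) := by
  classical
  rw [ENNReal.tsum_eq_add_tsum_ite []]
  congr 1
  have hinj : Function.Injective fun p : X × List X => p.2 ++ [p.1] := by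
    rintro ⟨a, l⟩ ⟨b, m⟩ h
    have := List.append_inj' h rfl
    simp_all
  refine (hinj.tsum_eq fun w hw => ?_).symm.trans ?_
  · rcases List.eq_nil_or_concat w with rfl | ⟨l, a, rfl⟩
    · simp at hw
    · exact ⟨(a, l), by simp⟩
  · rw [ENNReal.tsum_prod', tsum_fintype]
    simp

theorem tsum_list_ofFn [Fintype X] (f : List X → ℝ≥0∞) :
    ∑' w, f w = ∑' n : ℕ, ∑ ξ : Fin n → X, f (List.ofFn ξ) := by
  rw [← (List.equivSigmaTuple (α := X)).symm.tsum_eq, ENNReal.tsum_sigma']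
  refine tsum_congr fun n => ?_
  rw [tsum_fintype]
  rfl

/-- For fixed $k$, rotation by $k$ permutes the words and preserves both their length and `c`, so it
can be removed from the argument of `J`; the $|w|$ values of $k$ then contribute equally. -/
theorem tsum_rotate [Fintype X] (c J : List X → ℝ≥0∞) (hc : ∀ w k, c (w.rotate k) = c w) :
    ∑' w, ∑ k ∈ Finset.range w.length, c w * J (w.rotate k) = ∑' w, w.length * (c w * J w) := by
  have h1 : ∀ (F : ℕ → ℝ≥0∞) (n : ℕ), ∑ k ∈ Finset.range n, F k =
      ∑' k, if k < n then F k else 0 := by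
    intro F n
    rw [tsum_eq_sum (s := Finset.range n)]
    · exact Finset.sum_congr rfl fun k hk => (if_pos (Finset.mem_range.mp hk)).symm
    · exact fun k hk => if_neg (by simpa using hk)
  have h2 : ∀ w : List X, (w.length : ℝ≥0∞) * (c w * J w) =
      ∑ k ∈ Finset.range w.length, c w * J w := fun w => by simp
  simp_rw [h2, h1]
  rw [ENNReal.tsum_comm, ENNReal.tsum_comm (f := fun w k => if k < w.length then c w * J w else 0)]
  refine tsum_congr fun k => ?_
  have hb : Function.Bijective fun w : List X => w.rotate k :=
    ⟨List.rotate_injective k, fun w => ⟨w.rotate (w.length - k % w.length), by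
      change (w.rotate _).rotate k = w
      rw [List.rotate_rotate]
      rcases Nat.eq_zero_or_pos w.length with h0 | h0
      · rw [List.length_eq_zero_iff.mp h0, List.rotate_nil]
      · have h := Nat.mod_lt k h0
        rw [← List.rotate_mod, Nat.add_mod, ← Nat.mod_mod k, ← Nat.add_mod, Nat.mod_mod,
          Nat.sub_add_cancel h.le, Nat.mod_self, List.rotate_zero]⟩⟩
  rw [← (Equiv.ofBijective _ hb).tsum_eq fun w => if k < w.length then c w * J w else 0]
  simp [hc]

end Weights

/-! ### The loop measure as a sum over words -/

section WordLoops

variable {X : Type*}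

/-- The measure `exp (-a t) dt / t` on `t > 0`. -/
def trivM (a : ℝ) : Measure ℝ :=
  (volume.restrict (Set.Ioi 0)).withDensity fun t => ENNReal.ofReal (Real.exp (-(a * t)) / t)

theorem lintegral_trivM (a : ℝ) {f : ℝ → ℝ≥0∞} (hf : Measurable f) :
    ∫⁻ t, f t ∂trivM a = ∫⁻ t in Set.Ioi 0, ENNReal.ofReal (Real.exp (-(a * t)) / t) * f t := by
  rw [trivM, lintegral_withDensity_eq_lintegral_mul _ (by fun_prop) hf]
  rfl

theorem ae_pos_trivM (a : ℝ) : ∀ᵐ t ∂trivM a, 0 < t :=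
  (withDensity_absolutelyContinuous _ _).ae_le (ae_restrict_mem measurableSet_Ioi)

theorem lintegral_trivM_ofReal_mul (a : ℝ) {f : ℝ → ℝ≥0∞} (hf : Measurable f) :
    ∫⁻ t, ENNReal.ofReal t * f t ∂trivM a = ∫⁻ t, f t ∂expM a := by
  rw [lintegral_trivM _ (by fun_prop), lintegral_expM _ hf]
  refine setLIntegral_congr_fun measurableSet_Ioi fun t ht => ?_
  rw [← mul_assoc, ← ENNReal.ofReal_mul (div_nonneg (Real.exp_nonneg _) (le_of_lt ht)),
    div_mul_cancel₀ _ (ne_of_gt ht)]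

/-- The loop measure of the conductances `C` and the masses `lam`, restricted to the trivial loops
at points of `S` for the trivial part. -/
def wordLoops (S : Finset X) (C : X → X → ℝ≥0∞) (lam : X → ℝ) : Measure (Loop X) :=
  (∑ x ∈ S, (trivM (lam x)).map fun t => ((([(x, t)] : List (X × ℝ))) : Loop X)) +
    Measure.sum fun w : List X => loopW C w • (wordM lam w).map fun l : List (X × ℝ) => (l : Loop X)

theorem measurable_coe_singleton [Countable X] (x : X) :
    Measurable fun t : ℝ => ((([(x, t)] : List (X × ℝ))) : Loop X) :=
  measurable_coe_loop.comp (Measurable.timedCons x measurable_id' measurable_const)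

theorem lintegral_wordLoops [Countable X] (S : Finset X) (C : X → X → ℝ≥0∞) (lam : X → ℝ)
    {g : Loop X → ℝ≥0∞} (hg : Measurable g) :
    ∫⁻ l, g l ∂wordLoops S C lam =
      ∑ x ∈ S, ∫⁻ t, g ((([(x, t)] : List (X × ℝ))) : Loop X) ∂trivM (lam x) +
        ∑' w, loopW C w * ∫⁻ l, g (l : Loop X) ∂wordM lam w := by
  rw [wordLoops, lintegral_add_measure, lintegral_finsetSum_measure, lintegral_sum_measure]
  simp_rw [lintegral_smul_measure, lintegral_map hg (measurable_coe_singleton _),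
    lintegral_map hg measurable_coe_loop, smul_eq_mul]

theorem loopMeasure_eq_wordLoops [Fintype X] (e : Energy X) :
    loopMeasure e = wordLoops Finset.univ (fun x y => ENNReal.ofReal (e.C x y)) e.lam := by
  refine Measure.ext_of_lintegral _ fun g hg => ?_
  rw [lintegral_wordLoops _ _ _ hg, loopMeasure, lintegral_add_measure,
    lintegral_finsetSum_measure, lintegral_sum_measure]
  congr 1
  · refine Finset.sum_congr rfl fun x _ => ?_
    have : (fun t : ℝ => mkLoop (fun _ : Fin 1 => x) fun _ => t) =
        fun t => ((([(x, t)] : List (X × ℝ))) : Loop X) := by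
      funext t
      simp [mkLoop]
    rw [this, lintegral_map hg (measurable_coe_singleton x)]
    rfl
  · rw [tsum_list_ofFn]
    -- The empty word has no weight; removing it aligns the index $n$ of the loop measure with words
    -- of length $n+1$.
    conv_rhs => rw [tsum_eq_zero_add' ENNReal.summable]
    have h0 : ∑ ξ : Fin 0 → X, loopW (fun x y => ENNReal.ofReal (e.C x y)) (List.ofFn ξ) *
        ∫⁻ l, g (l : Loop X) ∂wordM e.lam (List.ofFn ξ) = 0 := by
      simp [loopW]
    rw [h0, zero_add]
    refine tsum_congr fun n => ?_
    rcases Nat.eq_zero_or_pos n with rfl | hn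
    · simp [loopW]
    · rw [if_neg hn.ne', lintegral_finsetSum_measure]
      refine Finset.sum_congr rfl fun ξ _ => ?_
      rw [lintegral_smul_measure, loopW, if_pos (by simp; omega), cycW_ofFn, List.length_ofFn,
        ← ENNReal.ofReal_prod_of_nonneg (fun i _ => e.C_nonneg _ _), smul_eq_mul]
      congr 1
      · rw [ENNReal.ofReal_div_of_pos (by positivity)]
        congr 1
        rw [← Nat.cast_succ, ENNReal.ofReal_natCast]
      · have hm : mkLoop ξ = fun τ => ((timedList ξ τ : List (X × ℝ)) : Loop X) := rfl
        have hmm : Measurable fun τ => ((timedList ξ τ : List (X × ℝ)) : Loop X) :=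
          measurable_coe_loop.comp (measurable_timedList ξ)
        have hgl := measurable_loop_iff.mp hg
        rw [hm, lintegral_map hg hmm, lintegral_withDensity_eq_lintegral_mul _ (by fun_prop)
          (hg.fun_comp hmm), ← lintegral_timedList e.lam ξ hgl]
        rfl

end WordLoops

/-! ### The measure on paths -/

section Paths

variable {X : Type*}

theorem measurable_cons [Countable X] (x : X) (t : ℝ) :
    Measurable fun l : List (X × ℝ) => (x, t) :: l :=
  Measurable.timedCons x measurable_const measurable_id'

theorem measurable_lintegral_wordM_cons [Countable X] (lam : X → ℝ) (x : X) (w : List X)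
    {G : List (X × ℝ) → ℝ≥0∞} (hG : Measurable G) :
    Measurable fun t => ∫⁻ l, G ((x, t) :: l) ∂wordM lam w :=
  Measurable.lintegral_prod_right' (f := fun p : ℝ × List (X × ℝ) => G ((x, p.1) :: p.2))
    (hG.fun_comp (measurable_cons_uncurry x))

theorem measurable_lintegral_wordM [Countable X] (lam : X → ℝ) (w : List X)
    {G : ℝ → List (X × ℝ) → ℝ≥0∞} (hG : Measurable fun p : ℝ × List (X × ℝ) => G p.1 p.2) :
    Measurable fun t => ∫⁻ l, G t l ∂wordM lam w :=
  Measurable.lintegral_prod_right' (f := fun p : ℝ × List (X × ℝ) => G p.1 p.2) hG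

variable [DecidableEq X]

/-- The weight of the path that starts at `x` and then follows the word `w`, restricted to the paths
that end at `y`. -/
def pathW (C : X → X → ℝ≥0∞) (y : X) : X → List X → ℝ≥0∞
  | x, [] => if x = y then 1 else 0
  | x, z :: w => C x z * pathW C y z w

theorem pathW_append (C : X → X → ℝ≥0∞) (x y z : X) (w : List X) :
    pathW C y x (w ++ [z]) = if z = y then linkW C x w z else 0 := by
  induction w generalizing x with
  | nil => simp [pathW, linkW]
  | cons a w ih =>
    rw [List.cons_append, pathW, ih, linkW]
    split_ifs <;> simp

/-- The measure on the timed paths from `x` to `y`. -/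
def pathM (C : X → X → ℝ≥0∞) (lam : X → ℝ) (y x : X) : Measure (List (X × ℝ)) :=
  Measure.sum fun w => pathW C y x w • wordM lam (x :: w)

theorem lintegral_pathM (C : X → X → ℝ≥0∞) (lam : X → ℝ) (y x : X) (G : List (X × ℝ) → ℝ≥0∞) :
    ∫⁻ l, G l ∂pathM C lam y x = ∑' w, pathW C y x w * ∫⁻ l, G l ∂wordM lam (x :: w) := by
  rw [pathM, lintegral_sum_measure]
  simp_rw [lintegral_smul_measure, smul_eq_mul]

theorem measurable_lintegral_pathM [Fintype X] (C : X → X → ℝ≥0∞) (lam : X → ℝ) (y x : X)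
    {G : ℝ → List (X × ℝ) → ℝ≥0∞} (hG : Measurable fun p : ℝ × List (X × ℝ) => G p.1 p.2) :
    Measurable fun t => ∫⁻ l, G t l ∂pathM C lam y x := by
  simp_rw [lintegral_pathM]
  exact Measurable.tsum fun w => (measurable_lintegral_wordM lam (x :: w) hG).const_mul _

/-- Decomposition of a path at its first jump. -/
theorem lintegral_pathM_rec [Fintype X] (C : X → X → ℝ≥0∞) (lam : X → ℝ) (y x : X)
    {G : List (X × ℝ) → ℝ≥0∞} (hG : Measurable G) :
    ∫⁻ l, G l ∂pathM C lam y x =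
      (if x = y then 1 else 0) * ∫⁻ t, G [(x, t)] ∂expM (lam x) +
        ∑ z, C x z * ∫⁻ t, ∫⁻ l, G ((x, t) :: l) ∂pathM C lam y z ∂expM (lam x) := by
  rw [lintegral_pathM, tsum_list_cons]
  congr 1
  · rw [pathW, lintegral_wordM_cons _ _ _ hG]
    congr 1
    exact lintegral_congr fun t => lintegral_wordM_nil lam (hG.fun_comp (measurable_cons x t))
  · refine Finset.sum_congr rfl fun z _ => ?_
    simp_rw [lintegral_pathM]
    rw [lintegral_tsum fun w => ((measurable_lintegral_wordM_cons lam x (z :: w) hG).const_mul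
      _).aemeasurable, ← ENNReal.tsum_mul_left]
    refine tsum_congr fun w => ?_
    rw [lintegral_const_mul _ (measurable_lintegral_wordM_cons lam x (z :: w) hG), pathW,
      lintegral_wordM_cons _ _ _ hG, mul_assoc]

end Paths

/-! ### Marking a loop at a uniform time of its visits of a set -/

section TimeMarking

variable {X : Type*} [DecidableEq X]

/-- The time spent in `F` at an entry of a loop. -/
def entryTime (F : Finset X) (p : X × ℝ) : ℝ≥0∞ := if p.1 ∈ F then ENNReal.ofReal p.2 else 0

/-- The total time spent in `F` by a loop. -/
def Loop.timeIn (F : Finset X) (l : Loop X) : ℝ≥0∞ := (l.toMultiset.map (entryTime F)).sum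

theorem timeIn_coe (F : Finset X) (l : List (X × ℝ)) :
    Loop.timeIn F (l : Loop X) = (l.map (entryTime F)).sum := by
  simp [Loop.timeIn]

theorem measurable_entryTime (F : Finset X) (x : X) : Measurable fun t => entryTime F (x, t) := by
  by_cases h : x ∈ F
  · simpa [entryTime, h] using ENNReal.measurable_ofReal
  · simp [entryTime, h]

theorem measurable_timeIn (F : Finset X) : Measurable (Loop.timeIn F) := by
  rw [measurable_loop_iff, measurable_list_iff]
  intro n ξ
  simp_rw [timeIn_coe, timedList, List.map_ofFn, List.sum_ofFn]
  exact Finset.measurable_sum _ fun i _ =>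
    (measurable_entryTime F (ξ i)).comp (measurable_pi_apply i)

/-- The time spent in `F` at the first entry of a list. -/
def headTime (F : Finset X) : List (X × ℝ) → ℝ≥0∞
  | [] => 0
  | p :: _ => entryTime F p

theorem measurable_headTime (F : Finset X) : Measurable (headTime F) := by
  rw [measurable_list_iff]
  intro n ξ
  cases n with
  | zero =>
    simp_rw [timedList_zero]
    exact measurable_const
  | succ n =>
    simp_rw [timedList_succ, headTime]
    exact (measurable_entryTime F (ξ 0)).comp (measurable_pi_apply 0)

theorem sum_entryTime (F : Finset X) (l : List (X × ℝ)) :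
    (l.map (entryTime F)).sum = ∑ k ∈ Finset.range l.length, headTime F (l.rotate k) := by
  rw [Finset.sum_range, ← Fin.sum_univ_fun_getElem]
  refine Finset.sum_congr rfl fun k _ => ?_
  have h := List.head?_rotate (l := l) k.2
  rw [List.getElem?_eq_getElem k.2] at h
  obtain ⟨m, hm⟩ : ∃ m, l.rotate k = l[(k : ℕ)] :: m := by
    cases hr : l.rotate k with
    | nil => simp [hr] at h
    | cons a m =>
      rw [hr] at h
      simp only [List.head?_cons, Option.some.injEq] at h
      exact ⟨m, by rw [h]⟩
  rw [hm, headTime]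

variable [Fintype X]

/-- The time spent in $F$ is the sum over all rotations of the time at the first entry. The measure
and `G` being invariant under rotation, the $p$ rotations contribute equally and cancel the factor
$1/p$. -/
theorem lintegral_timeIn_words (F : Finset X) (C : X → X → ℝ≥0∞) (lam : X → ℝ)
    {G : List (X × ℝ) → ℝ≥0∞} (hG : Measurable G) (hrot : ∀ l k, G (l.rotate k) = G l) :
    ∑' w, loopW C w * ∫⁻ l, Loop.timeIn F (l : Loop X) * G l ∂wordM lam w =
      ∑' w, (if 2 ≤ w.length then cycW C w else 0) *
        ∫⁻ l, headTime F l * G l ∂wordM lam w := by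
  have hH : Measurable fun l => headTime F l * G l := (measurable_headTime F).mul hG
  have h1 : ∀ w, loopW C w * ∫⁻ l, Loop.timeIn F (l : Loop X) * G l ∂wordM lam w =
      ∑ k ∈ Finset.range w.length, loopW C w *
        ∫⁻ l, headTime F l * G l ∂wordM lam (w.rotate k) := by
    intro w
    rw [← Finset.mul_sum]
    congr 1
    have h2 : ∫⁻ l, Loop.timeIn F (l : Loop X) * G l ∂wordM lam w =
        ∫⁻ l, ∑ k ∈ Finset.range w.length, headTime F (l.rotate k) * G (l.rotate k)
          ∂wordM lam w := by
      refine lintegral_congr_ae ?_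
      filter_upwards [ae_wordM_map_fst lam w] with l hl
      have hlen : w.length = l.length := by rw [← hl, List.length_map]
      simp_rw [timeIn_coe, sum_entryTime, hrot, hlen, Finset.sum_mul]
    rw [h2, lintegral_finsetSum _ fun k _ => hH.fun_comp (measurable_rotate k)]
    exact Finset.sum_congr rfl fun k _ => lintegral_wordM_rotate lam w k hH
  simp_rw [h1]
  rw [tsum_rotate (loopW C) fun w => ∫⁻ l, headTime F l * G l ∂wordM lam w]
  · refine tsum_congr fun w => ?_
    rw [← mul_assoc]
    congr 1
    unfold loopW
    split_ifs with h
    · exact ENNReal.mul_div_cancel (by simp; rintro rfl; simp at h) (by simp)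
    · simp
  · intro w k
    rw [loopW, loopW, List.length_rotate, cycW_rotate]

/-- The factor $t$ at the first point turns $e^{-\lambda t}dt$ into the law of a sum of two
independent times (`lintegral_expM_split`). Moving the second one to the end of the list opens the
loop into a path from $x$ to $x$, and `hmerge` says that `G` does not see where the visit was cut.
-/
theorem lintegral_headTime_words (F : Finset X) (C : X → X → ℝ≥0∞) (hC : ∀ x, C x x = 0)
    (lam : X → ℝ) {G : List (X × ℝ) → ℝ≥0∞} (hG : Measurable G)
    (hmerge : ∀ x ∈ F, ∀ s t l, G ((x, s) :: (l ++ [(x, t)])) = G ((x, s + t) :: l)) :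
    ∑' w, (if 2 ≤ w.length then cycW C w else 0) * ∫⁻ l, headTime F l * G l ∂wordM lam w =
      ∑ x ∈ F, ∑' w, linkW C x w x * ∫⁻ l, G l ∂wordM lam (x :: (w ++ [x])) := by
  have hH : Measurable fun l => headTime F l * G l := (measurable_headTime F).mul hG
  rw [tsum_list_cons, if_neg (by simp), zero_mul, zero_add]
  rw [← Finset.sum_subset (Finset.subset_univ F)]
  · refine Finset.sum_congr rfl fun x hx => tsum_congr fun w => ?_
    -- A one-letter word would use $C_{x,x}=0$, so the restriction on the length is automatic.
    have hlen : (if 2 ≤ (x :: w).length then cycW C (x :: w) else 0) = linkW C x w x := by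
      cases w with
      | nil => simp [linkW, hC]
      | cons z w => simp [cycW]
    rw [hlen]
    congr 1
    rw [lintegral_wordM_cons _ _ _ hH, lintegral_wordM_cons _ _ _ hG]
    have h1 : ∀ t, ∫⁻ l, headTime F ((x, t) :: l) * G ((x, t) :: l) ∂wordM lam w =
        ENNReal.ofReal t * ∫⁻ l, G ((x, t) :: l) ∂wordM lam w := by
      intro t
      simp only [headTime, entryTime, hx, if_true]
      exact lintegral_const_mul _ (hG.fun_comp (measurable_cons x t))
    simp_rw [h1]
    rw [← lintegral_expM_split (lam x) (measurable_lintegral_wordM_cons lam x w hG)]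
    refine lintegral_congr fun s => ?_
    rw [lintegral_wordM_append _ _ _ (hG.fun_comp (measurable_cons x s))]
    have hm : Measurable fun p : ℝ × List (X × ℝ) => G ((x, s) :: (p.2 ++ [(x, p.1)])) :=
      (hG.fun_comp (measurable_cons x s)).fun_comp (measurable_append_uncurry x)
    rw [← lintegral_lintegral_swap (f := fun t l => G ((x, s) :: (l ++ [(x, t)])))
      hm.aemeasurable]
    simp_rw [hmerge x hx]
  · intro x _ hx
    refine ENNReal.tsum_eq_zero.mpr fun w => ?_
    rw [lintegral_wordM_cons _ _ _ hH]
    simp [headTime, entryTime, hx]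

/-- The loop measure, weighted by the time spent in `F`, in terms of the measures on the closed paths
from the points of `F`. -/
theorem lintegral_timeIn_wordLoops {F S : Finset X} (hFS : F ⊆ S) (C : X → X → ℝ≥0∞)
    (hC : ∀ x, C x x = 0) (lam : X → ℝ) {g : Loop X → ℝ≥0∞} (hg : Measurable g)
    (hmerge : ∀ x ∈ F, ∀ (s t : ℝ) (l : List (X × ℝ)),
      g (((x, s) :: (l ++ [(x, t)]) : List (X × ℝ)) : Loop X) =
        g (((x, s + t) :: l : List (X × ℝ)) : Loop X)) :
    ∫⁻ l, Loop.timeIn F l * g l ∂wordLoops S C lam =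
      ∑ x ∈ F, ∫⁻ l, g (l : Loop X) ∂pathM C lam x x := by
  have hG := measurable_loop_iff.mp hg
  have hH : Measurable fun l => Loop.timeIn F l * g l := (measurable_timeIn F).mul hg
  rw [lintegral_wordLoops _ _ _ hH,
    lintegral_timeIn_words F C lam hG
      (fun l k => congrArg g (Cycle.coe_eq_coe.mpr (List.IsRotated.symm ⟨k, rfl⟩))),
    lintegral_headTime_words F C hC lam hG hmerge, ← Finset.sum_subset hFS,
    ← Finset.sum_add_distrib]
  · refine Finset.sum_congr rfl fun x hx => ?_
    have hnil : pathW C x x [] = 1 := if_pos rfl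
    rw [lintegral_pathM]
    conv_rhs => rw [tsum_list_append]
    congr 1
    -- For trivial loops the factor $t$ cancels the $1/t$ of their measure and leaves the path from
    -- $x$ to $x$ without jumps.
    · simp only [timeIn_coe, List.map_cons, List.map_nil, List.sum_cons, List.sum_nil, add_zero,
        entryTime, hx, if_true]
      rw [lintegral_trivM_ofReal_mul _ (hg.fun_comp (measurable_coe_singleton x)), hnil,
        one_mul, lintegral_wordM_cons _ _ _ hG]
      exact lintegral_congr fun t =>
        (lintegral_wordM_nil lam (hG.fun_comp (measurable_cons x t))).symm
    · rw [Finset.sum_eq_single x]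
      · simp_rw [pathW_append, if_true]
      · intro z _ hz
        simp [pathW_append, hz]
      · simp
  · intro x _ hx
    simp [timeIn_coe, entryTime, hx]

end TimeMarking

/-! ### The Green function -/

section Green

namespace Energy

variable {X : Type*} [Fintype X] (e : Energy X)

theorem lam_pos' (x : X) : 0 < e.lam x := e.lam_pos x

/-- The mass gap, for the quadratic form of `M_λ - C` on real functions. -/
theorem exists_gap : ∃ ε : ℝ, 0 < ε ∧ ∀ z : X → ℝ,
    ε * ∑ x, e.lam x * z x ^ 2 ≤ ∑ x, z x * (e.lam x * z x - ∑ y, e.C x y * z y) := by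
  obtain ⟨ε, hε, h⟩ := e.mass_gap
  refine ⟨ε, hε, fun z => ?_⟩
  have h1 := h fun x => (z x : ℂ)
  have h2 : ∀ x y, ‖(z x : ℂ) - z y‖ ^ 2 = (z x - z y) ^ 2 := fun x y => by
    rw [← Complex.ofReal_sub, Complex.norm_real, Real.norm_eq_abs, sq_abs]
  simp only [h2, Complex.norm_real, Real.norm_eq_abs, sq_abs] at h1
  refine h1.trans (le_of_eq ?_)
  have h3 : ∑ x, ∑ y, e.C x y * (z x - z y) ^ 2 =
      2 * ∑ x, (∑ y, e.C x y) * z x ^ 2 - 2 * ∑ x, z x * ∑ y, e.C x y * z y := by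
    have h4 : ∑ x, ∑ y, e.C x y * z y ^ 2 = ∑ x, (∑ y, e.C x y) * z x ^ 2 := by
      rw [Finset.sum_comm]
      refine Finset.sum_congr rfl fun y _ => ?_
      rw [Finset.sum_mul]
      exact Finset.sum_congr rfl fun x _ => by rw [e.C_symm]
    have h5 : ∑ x, ∑ y, e.C x y * (z x - z y) ^ 2 = ∑ x, (∑ y, e.C x y) * z x ^ 2 +
        ∑ x, ∑ y, e.C x y * z y ^ 2 - 2 * ∑ x, z x * ∑ y, e.C x y * z y := by
      simp only [Finset.sum_mul, Finset.mul_sum, ← Finset.sum_add_distrib, ← Finset.sum_sub_distrib]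
      exact Finset.sum_congr rfl fun x _ => Finset.sum_congr rfl fun y _ => by ring
    rw [h5, h4]
    ring
  rw [h3]
  simp only [lam, mul_sub, Finset.sum_sub_distrib]
  have h6 : ∑ x, z x * ((e.κ x + ∑ y, e.C x y) * z x) =
      ∑ x, (∑ y, e.C x y) * z x ^ 2 + ∑ x, e.κ x * z x ^ 2 := by
    rw [← Finset.sum_add_distrib]
    exact Finset.sum_congr rfl fun x _ => by ring
  rw [h6]
  ring

/-- The maximum principle. -/
theorem nonneg_of_supersolution (z : X → ℝ)
    (h : ∀ x, z x < 0 → 0 ≤ e.lam x * z x - ∑ y, e.C x y * z y) (x : X) : 0 ≤ z x := by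
  obtain ⟨ε, hε, hgap⟩ := e.exists_gap
  -- The mass gap is applied to the negative part of $z$. Since $C\ge0$, the quadratic form is
  -- nonpositive there, so the negative part vanishes.
  have h1 := hgap fun x => max (-z x) 0
  have h2 : ∀ x, max (-z x) 0 * (e.lam x * max (-z x) 0 - ∑ y, e.C x y * max (-z y) 0) ≤ 0 := by
    intro x
    rcases le_or_gt 0 (z x) with hx | hx
    · rw [max_eq_right (by linarith), zero_mul]
    · refine mul_nonpos_of_nonneg_of_nonpos (le_max_right _ _) ?_
      rw [max_eq_left (by linarith)]
      have h3 : ∑ y, e.C x y * -z y ≤ ∑ y, e.C x y * max (-z y) 0 :=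
        Finset.sum_le_sum fun y _ => mul_le_mul_of_nonneg_left (le_max_left _ _) (e.C_nonneg x y)
      simp only [mul_neg, Finset.sum_neg_distrib] at h3
      linarith [h x hx]
  have h4 := h1.trans (Finset.sum_nonpos fun x _ => h2 x)
  have h5 : ∀ y ∈ Finset.univ, 0 ≤ e.lam y * max (-z y) 0 ^ 2 := fun y _ =>
    mul_nonneg (e.lam_pos' y).le (sq_nonneg _)
  have h6 : ∑ y, e.lam y * max (-z y) 0 ^ 2 = 0 :=
    le_antisymm (nonpos_of_mul_nonpos_right h4 hε) (Finset.sum_nonneg h5)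
  have h7 := (Finset.sum_eq_zero_iff_of_nonneg h5).mp h6 x (Finset.mem_univ x)
  have h8 : max (-z x) 0 = 0 := by
    rcases mul_eq_zero.mp h7 with h | h
    · exact absurd h (e.lam_pos' x).ne'
    · exact pow_eq_zero_iff (two_ne_zero) |>.mp h
  linarith [le_max_left (-z x) 0]

variable [DecidableEq X] (F : Finset X)

/-- The restriction of `M_λ - C` to the complement of `F`. -/
def genOff : Matrix {x // x ∉ F} {x // x ∉ F} ℝ :=
  (Matrix.diagonal e.lam - Matrix.of e.C).submatrix Subtype.val Subtype.val

/-- The extension by `0` of a function on the complement of `F`. -/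
def extendOff (v : {x // x ∉ F} → ℝ) (x : X) : ℝ := if h : x ∉ F then v ⟨x, h⟩ else 0

theorem sum_extendOff (v : {x // x ∉ F} → ℝ) (f : X → ℝ → ℝ) (hf : ∀ x, f x 0 = 0) :
    ∑ x, f x (extendOff F v x) = ∑ a : {x // x ∉ F}, f a (v a) := by
  rw [← Finset.sum_subset (Finset.subset_univ Fᶜ)]
  · rw [← Finset.sum_coe_sort]
    refine Fintype.sum_equiv (Equiv.subtypeEquivRight fun x => Finset.mem_compl) _ _ fun a => ?_
    have ha : (a : X) ∉ F := Finset.mem_compl.mp a.2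
    rw [extendOff, dif_pos ha]
    rfl
  · intro x _ hx
    have : x ∈ F := by simpa using hx
    simp [extendOff, this, hf]

theorem extendOff_coe (v : {x // x ∉ F} → ℝ) (a : {x // x ∉ F}) : extendOff F v a = v a := by
  simp [extendOff, a.2]

theorem genOff_mulVec (v : {x // x ∉ F} → ℝ) (a : {x // x ∉ F}) :
    (e.genOff F).mulVec v a = e.lam a * v a - ∑ b : {x // x ∉ F}, e.C a b * v b := by
  simp only [genOff, Matrix.mulVec, dotProduct, Matrix.submatrix_apply, Matrix.sub_apply,
    Matrix.of_apply, sub_mul, Finset.sum_sub_distrib]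
  congr 1
  rw [Finset.sum_eq_single a]
  · simp
  · intro b _ hb
    rw [Matrix.diagonal_apply_ne _ fun h => hb (Subtype.ext h.symm), zero_mul]
  · simp

/-- A function on $D$ extended by $0$ has the same quadratic form, so the mass gap on $X$ passes to
$D$. -/
theorem genOff_posDef : (e.genOff F).PosDef := by
  obtain ⟨ε, hε, hgap⟩ := e.exists_gap
  refine Matrix.PosDef.of_dotProduct_mulVec_pos ?_ fun v hv => ?_
  · ext a b
    simp only [genOff, Matrix.conjTranspose_apply, Matrix.submatrix_apply, Matrix.sub_apply,
      Matrix.of_apply, star_trivial, e.C_symm b a]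
    by_cases h : (a : X) = b
    · simp [h]
    · rw [Matrix.diagonal_apply_ne _ h, Matrix.diagonal_apply_ne _ (Ne.symm h)]
  · have h1 := hgap (extendOff F v)
    rw [sum_extendOff F v (fun x r => e.lam x * r ^ 2) (by simp)] at h1
    have h2 : ∀ x, ∑ y, e.C x y * extendOff F v y = ∑ b : {x // x ∉ F}, e.C x b * v b :=
      fun x => sum_extendOff F v (fun y r => e.C x y * r) (by simp)
    simp_rw [h2] at h1
    rw [sum_extendOff F v (fun x r => r * (e.lam x * r - ∑ b : {x // x ∉ F}, e.C x b * v b))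
      (by simp)] at h1
    simp only [star_trivial, dotProduct, genOff_mulVec]
    refine lt_of_lt_of_le (mul_pos hε ?_) h1
    obtain ⟨a, ha⟩ := Function.ne_iff.mp hv
    refine Finset.sum_pos' (fun b _ => mul_nonneg (e.lam_pos' b).le (sq_nonneg _))
      ⟨a, Finset.mem_univ a, mul_pos (e.lam_pos' a) ?_⟩
    have : v a ≠ 0 := ha
    positivity

theorem Zoff_pos : 0 < e.Zoff F := (e.genOff_posDef F).inv.det_pos

theorem genOff_mul_greenOff : e.genOff F * e.greenOff F = 1 :=
  Matrix.mul_nonsing_inv _ (e.genOff_posDef F).det_pos.ne'.isUnit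

theorem greenOff_mul_genOff : e.greenOff F * e.genOff F = 1 :=
  Matrix.nonsing_inv_mul _ (e.genOff_posDef F).det_pos.ne'.isUnit

/-- The maximum principle applies to each column of $G^D$ extended by $0$: on $D$ its image under
$M_\lambda-C$ is an indicator, hence nonnegative. -/
theorem greenOff_nonneg (a b : {x // x ∉ F}) : 0 ≤ e.greenOff F a b := by
  have h := e.nonneg_of_supersolution (extendOff F fun a => e.greenOff F a b) (fun x hx => ?_) a
  · rwa [extendOff_coe] at h
  · by_cases hxF : x ∈ F
    · simp [extendOff, hxF] at hx
    · rw [sum_extendOff F _ (fun y r => e.C x y * r) (by simp)]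
      have h1 := e.genOff_mulVec F (fun a => e.greenOff F a b) ⟨x, hxF⟩
      have h2 : (e.genOff F).mulVec (fun a => e.greenOff F a b) ⟨x, hxF⟩ =
          (1 : Matrix {x // x ∉ F} {x // x ∉ F} ℝ) ⟨x, hxF⟩ b := by
        rw [← e.genOff_mul_greenOff F]
        rfl
      have h3 := extendOff_coe F (fun a => e.greenOff F a b) ⟨x, hxF⟩
      simp only at h1 h3
      rw [h3, ← h1, h2, Matrix.one_apply]
      split_ifs <;> norm_num

theorem excursionMass_nonneg (x y : X) : 0 ≤ e.excursionMass F x y :=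
  Finset.sum_nonneg fun a _ => Finset.sum_nonneg fun b _ =>
    mul_nonneg (mul_nonneg (e.C_nonneg _ _) (e.C_nonneg _ _)) (e.greenOff_nonneg F a b)

theorem traceC_nonneg (x y : X) : 0 ≤ e.traceC F x y := by
  unfold traceC
  split_ifs
  · exact le_rfl
  · exact add_nonneg (e.C_nonneg _ _) (e.excursionMass_nonneg F _ _)

/-- The function is $G\mathbf 1$, with no killing set. It serves as a finite upper bound for the
masses of the path measures. -/
theorem exists_supersolution : ∃ f : X → ℝ, (∀ x, 0 ≤ f x) ∧
    ∀ x, e.lam x * f x = 1 + ∑ y, e.C x y * f y := by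
  let v : {x // x ∉ (∅ : Finset X)} → ℝ := (e.greenOff ∅).mulVec 1
  refine ⟨extendOff ∅ v, fun x => ?_, fun x => ?_⟩
  · have h3 := extendOff_coe ∅ v ⟨x, Finset.notMem_empty x⟩
    simp only at h3
    rw [h3]
    exact Finset.sum_nonneg fun b _ => mul_nonneg (e.greenOff_nonneg _ _ _) zero_le_one
  · have hx : x ∉ (∅ : Finset X) := Finset.notMem_empty x
    have h1 := e.genOff_mulVec ∅ v ⟨x, hx⟩
    rw [Matrix.mulVec_mulVec, e.genOff_mul_greenOff, Matrix.one_mulVec, Pi.one_apply] at h1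
    rw [sum_extendOff ∅ v (fun y r => e.C x y * r) (by simp)]
    have h3 := extendOff_coe ∅ v ⟨x, hx⟩
    simp only at h1 h3
    rw [h3]
    linarith

/-- If `u` is `(M_λ - C)`-harmonic off `F`, its mean over the neighbours of any point is expressed
by its values on `F`. -/
theorem sum_C_mul_of_harmonic (u : X → ℝ) (hu : ∀ a ∉ F, e.lam a * u a = ∑ y, e.C a y * u y)
    (z : X) : ∑ y, e.C z y * u y = ∑ w ∈ F, (e.C z w + e.excursionMass F z w) * u w := by
  have hsplit : ∀ x, ∑ y, e.C x y * u y =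
      ∑ w ∈ F, e.C x w * u w + ∑ a : {x // x ∉ F}, e.C x a * u a := by
    intro x
    rw [← Finset.sum_add_sum_compl F, ← Finset.sum_coe_sort Fᶜ]
    congr 1
    exact Fintype.sum_equiv (Equiv.subtypeEquivRight fun x => Finset.mem_compl) _ _ fun a => rfl
  -- On $D$, `u` solves a Dirichlet problem whose right side comes from its values on $F$; it is
  -- solved by $G^D$.
  have h1 : (e.genOff F).mulVec (fun a => u a) =
      fun a : {x // x ∉ F} => ∑ w ∈ F, e.C a w * u w := by
    funext a
    rw [genOff_mulVec, hu a a.2, hsplit]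
    ring
  have h2 : (fun a : {x // x ∉ F} => u a) =
      (e.greenOff F).mulVec fun a : {x // x ∉ F} => ∑ w ∈ F, e.C a w * u w := by
    rw [← h1, Matrix.mulVec_mulVec, greenOff_mul_genOff, Matrix.one_mulVec]
  have h3 : ∀ a : {x // x ∉ F}, u a =
      ∑ b : {x // x ∉ F}, e.greenOff F a b * ∑ w ∈ F, e.C b w * u w :=
    fun a => congrFun h2 a
  rw [hsplit]
  simp only [add_mul, Finset.sum_add_distrib, excursionMass]
  congr 1
  rw [Finset.sum_congr rfl fun a _ => by rw [h3 a]]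
  simp only [Finset.mul_sum, Finset.sum_mul]
  refine (Finset.sum_congr rfl fun a _ => ?_).trans Finset.sum_comm
  refine Finset.sum_comm.trans (Finset.sum_congr rfl fun w _ => Finset.sum_congr rfl fun b _ => ?_)
  ring

end Energy

end Green

/-! ### The trace of the path measures -/

namespace Energy

variable {X : Type*} [Fintype X]

/-- The conductances, with values in `[0, ∞]`. -/
def Cw (e : Energy X) (x y : X) : ℝ≥0∞ := ENNReal.ofReal (e.C x y)

variable [DecidableEq X]

/-- The conductances of the trace on `F`, extended by `0`, with values in `[0, ∞]`. -/
def traceCw (e : Energy X) (F : Finset X) (x y : X) : ℝ≥0∞ :=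
  if x ∈ F ∧ y ∈ F then ENNReal.ofReal (e.traceC F x y) else 0

end Energy

/-! ### Finiteness of the path measures -/

section PathMass

variable {X : Type*} [Fintype X] [DecidableEq X]

theorem pathM_univ (C : X → X → ℝ≥0∞) (lam : X → ℝ) (y x : X) :
    pathM C lam y x Set.univ = ∑' w, pathW C y x w * wordM lam (x :: w) Set.univ := by
  simp_rw [← lintegral_one]
  exact lintegral_pathM C lam y x fun _ => 1

theorem wordM_cons_univ {lam : X → ℝ} (hlam : ∀ x, 0 < lam x) (x : X) (w : List X) :
    wordM lam (x :: w) Set.univ = ENNReal.ofReal (lam x)⁻¹ * wordM lam w Set.univ := by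
  simp_rw [← lintegral_one]
  rw [lintegral_wordM_map_fst (w := x :: w) (fun x _ => hlam x) fun _ => 1,
    lintegral_wordM_map_fst (w := w) (fun x _ => hlam x) fun _ => 1]
  simp

theorem pathM_univ_ne_top (e : Energy X) (y x : X) : pathM e.Cw e.lam y x Set.univ ≠ ∞ := by
  obtain ⟨f, hf, hsup⟩ := e.exists_supersolution
  -- The masses of the paths with at most $n$ jumps are built by iterating the equation of `f` from
  -- below, so induction on $n$ bounds them by `f`.
  have key : ∀ n x, (∑' w : List X, if w.length ≤ n then
      pathW e.Cw y x w * wordM e.lam (x :: w) Set.univ else 0) ≤ ENNReal.ofReal (f x) := by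
    have hx : ∀ x, f x = (e.lam x)⁻¹ * 1 + ∑ z, (e.lam x)⁻¹ * (e.C x z * f z) := by
      intro x
      rw [← Finset.mul_sum, ← mul_add, ← hsup x, inv_mul_cancel_left₀ (e.lam_pos' x).ne']
    have hl : ∀ x, 0 ≤ (e.lam x)⁻¹ := fun x => (inv_pos.mpr (e.lam_pos' x)).le
    have h0 : ∀ x, pathW e.Cw y x [] * wordM e.lam [x] Set.univ ≤
        ENNReal.ofReal ((e.lam x)⁻¹ * 1) := by
      intro x
      rw [wordM_cons_univ e.lam_pos', mul_one, pathW]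
      split_ifs <;> simp [wordM]
    have hs : ∀ x, ENNReal.ofReal (f x) = ENNReal.ofReal ((e.lam x)⁻¹ * 1) +
        ∑ z, ENNReal.ofReal (e.lam x)⁻¹ * (e.Cw x z * ENNReal.ofReal (f z)) := by
      intro x
      have h1 : ∀ z, 0 ≤ (e.lam x)⁻¹ * (e.C x z * f z) := fun z =>
        mul_nonneg (hl x) (mul_nonneg (e.C_nonneg x z) (hf z))
      rw [hx, ENNReal.ofReal_add (mul_nonneg (hl x) zero_le_one) (Finset.sum_nonneg fun z _ => h1 z),
        ENNReal.ofReal_sum_of_nonneg fun z _ => h1 z]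
      congr 1
      refine Finset.sum_congr rfl fun z _ => ?_
      rw [ENNReal.ofReal_mul (hl x), ENNReal.ofReal_mul (e.C_nonneg x z), Energy.Cw]
    intro n
    induction n with
    | zero =>
      intro x
      rw [tsum_list_cons, hs x]
      refine add_le_add (by simpa using h0 x) ?_
      simp
    | succ n ih =>
      intro x
      rw [tsum_list_cons, hs x]
      refine add_le_add (by simpa using h0 x) (Finset.sum_le_sum fun z _ => ?_)
      rw [← mul_assoc]
      refine le_trans (le_of_eq ?_) (mul_le_mul_right (ih z) _)
      rw [← ENNReal.tsum_mul_left]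
      refine tsum_congr fun w => ?_
      simp only [List.length_cons, add_le_add_iff_right]
      split_ifs
      · rw [pathW, wordM_cons_univ e.lam_pos' x]
        ring
      · simp
  refine ne_top_of_le_ne_top (b := ENNReal.ofReal (f x)) ENNReal.ofReal_ne_top ?_
  rw [pathM_univ, ENNReal.tsum_eq_iSup_sum]
  refine iSup_le fun s => ?_
  refine le_trans ?_ (key (s.sup List.length) x)
  refine le_trans (le_of_eq ?_) (ENNReal.sum_le_tsum s)
  exact Finset.sum_congr rfl fun w hw => (if_pos (Finset.le_sup (f := List.length) hw)).symm

instance (e : Energy X) (y x : X) : IsFiniteMeasure (pathM e.Cw e.lam y x) :=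
  ⟨(pathM_univ_ne_top e y x).lt_top⟩

end PathMass

/-! ### Merging successive visits -/

section MergeCons

variable {X : Type*} [DecidableEq X]

theorem mergeCons_mergeCons_self (x : X) (s t : ℝ) (l : List (X × ℝ)) :
    mergeCons (x, s) (mergeCons (x, t) l) = mergeCons (x, s + t) l := by
  cases l with
  | nil => simp [mergeCons]
  | cons q l =>
    by_cases h : x = q.1 <;> simp [mergeCons, h, add_assoc]

theorem mergeCons_mergeCons_of_ne {x z : X} (h : x ≠ z) (s t : ℝ) (l : List (X × ℝ)) :
    mergeCons (x, s) (mergeCons (z, t) l) = (x, s) :: mergeCons (z, t) l := by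
  cases l with
  | nil => simp [mergeCons, h]
  | cons q l =>
    obtain ⟨a, r⟩ := q
    by_cases h' : z = a
    · subst h'
      simp [mergeCons, h]
    · simp [mergeCons, h', h]

end MergeCons

/-! ### First-jump decomposition of traced paths -/

section PathTrace

variable {X : Type*} [Fintype X] [DecidableEq X]

/-- The image by the trace on `F` of the measure on the timed paths from `x` to `y`. -/
def traceM (e : Energy X) (F : Finset X) (y x : X) : Measure (List (X × ℝ)) :=
  (pathM e.Cw e.lam y x).map (tracePath F)

instance (e : Energy X) (F : Finset X) (y x : X) : IsFiniteMeasure (traceM e F y x) := by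
  unfold traceM
  infer_instance

theorem lintegral_traceM (e : Energy X) (F : Finset X) (y x : X) {G : List (X × ℝ) → ℝ≥0∞}
    (hG : Measurable G) :
    ∫⁻ l, G l ∂traceM e F y x = ∫⁻ l, G (tracePath F l) ∂pathM e.Cw e.lam y x :=
  lintegral_map hG (measurable_tracePath F)

/-- A starting point outside $F$ leaves nothing in the trace, and its holding time integrates to
$1/\lambda_x$. Thus the traced path measure is a harmonic function of its starting point off $F$. -/
theorem lintegral_traceM_of_notMem (e : Energy X) {F : Finset X} {y x : X} (hy : y ∈ F)
    (hx : x ∉ F) {G : List (X × ℝ) → ℝ≥0∞} (hG : Measurable G) :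
    ENNReal.ofReal (e.lam x) * ∫⁻ l, G l ∂traceM e F y x =
      ∑ z, e.Cw x z * ∫⁻ l, G l ∂traceM e F y z := by
  have hxy : x ≠ y := fun h => hx (h ▸ hy)
  rw [lintegral_traceM _ _ _ _ hG,
    lintegral_pathM_rec _ _ _ _ (hG.fun_comp (measurable_tracePath F)), if_neg hxy, zero_mul,
    zero_add, Finset.mul_sum]
  refine Finset.sum_congr rfl fun z _ => ?_
  simp_rw [tracePath_cons_of_notMem hx, lintegral_const, expM_univ (e.lam_pos' x)]
  have hinv : ENNReal.ofReal (e.lam x) * ENNReal.ofReal (e.lam x)⁻¹ = 1 := by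
    rw [← ENNReal.ofReal_mul (e.lam_pos' x).le, mul_inv_cancel₀ (e.lam_pos' x).ne',
      ENNReal.ofReal_one]
  rw [lintegral_traceM _ _ _ _ hG, mul_left_comm, mul_left_comm (ENNReal.ofReal _), hinv, mul_one]

theorem lintegral_traceM_of_mem (e : Energy X) {F : Finset X} (y : X) {x : X}
    (hx : x ∈ F) {G : List (X × ℝ) → ℝ≥0∞} (hG : Measurable G) :
    ∫⁻ l, G l ∂traceM e F y x =
      (if x = y then 1 else 0) * ∫⁻ t, G [(x, t)] ∂expM (e.lam x) +
        ∑ z, e.Cw x z * ∫⁻ t, ∫⁻ m, G (mergeCons (x, t) m) ∂traceM e F y z ∂expM (e.lam x) := by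
  rw [lintegral_traceM _ _ _ _ hG,
    lintegral_pathM_rec _ _ _ _ (hG.fun_comp (measurable_tracePath F))]
  simp_rw [tracePath_cons_of_mem hx]
  congr 1
  refine Finset.sum_congr rfl fun z _ => ?_
  congr 1
  refine lintegral_congr fun t => ?_
  rw [lintegral_traceM e F y z
    (hG.fun_comp (Measurable.mergeCons x measurable_const measurable_id'))]

/-- Leaving the complement of `F` by its Green function. -/
theorem sum_Cw_lintegral_traceM (e : Energy X) {F : Finset X} {y : X} (hy : y ∈ F) (x : X)
    (G : List (X × ℝ) → ℝ≥0∞) :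
    ∑ z, e.Cw x z * ∫⁻ l, G l ∂traceM e F y z =
      ∑ z ∈ F, ENNReal.ofReal (e.C x z + e.excursionMass F x z) * ∫⁻ l, G l ∂traceM e F y z := by
  -- The harmonic extension formula is real-valued, so it is applied to the finite masses of each
  -- measurable set; the resulting equality of measures is then integrated.
  have hm : Measure.sum (fun z => e.Cw x z • traceM e F y z) =
      Measure.sum fun z : F => ENNReal.ofReal (e.C x z + e.excursionMass F x z) •
        traceM e F y z := by
    ext B hB
    rw [Measure.sum_apply _ hB, Measure.sum_apply _ hB, tsum_fintype, tsum_fintype]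
    simp only [Measure.smul_apply, smul_eq_mul]
    have hfin : ∀ z, traceM e F y z B ≠ ∞ := fun z => measure_ne_top _ _
    have hu : ∀ a ∉ F, e.lam a * (traceM e F y a B).toReal =
        ∑ z, e.C a z * (traceM e F y z B).toReal := by
      intro a ha
      have h := lintegral_traceM_of_notMem e hy ha
        (G := B.indicator 1) (measurable_one.indicator hB)
      simp_rw [lintegral_indicator_one hB] at h
      have h2 := congrArg ENNReal.toReal h
      rw [ENNReal.toReal_mul, ENNReal.toReal_ofReal (e.lam_pos' a).le, ENNReal.toReal_sum] at h2
      · simpa only [ENNReal.toReal_mul, Energy.Cw, ENNReal.toReal_ofReal (e.C_nonneg _ _)] using h2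
      · exact fun z _ => ENNReal.mul_ne_top ENNReal.ofReal_ne_top (hfin z)
    have h := e.sum_C_mul_of_harmonic F (fun z => (traceM e F y z B).toReal) hu x
    have hK : ∀ z, 0 ≤ e.C x z + e.excursionMass F x z := fun z =>
      add_nonneg (e.C_nonneg _ _) (e.excursionMass_nonneg F _ _)
    rw [Finset.sum_coe_sort F fun z => ENNReal.ofReal (e.C x z + e.excursionMass F x z) *
      traceM e F y z B]
    have h3 : ∀ (c : X → ℝ) (s : Finset X), (∀ z, 0 ≤ c z) →
        ∑ z ∈ s, ENNReal.ofReal (c z) * traceM e F y z B =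
          ENNReal.ofReal (∑ z ∈ s, c z * (traceM e F y z B).toReal) := by
      intro c s hc
      rw [ENNReal.ofReal_sum_of_nonneg fun z _ => mul_nonneg (hc z) ENNReal.toReal_nonneg]
      refine Finset.sum_congr rfl fun z _ => ?_
      rw [ENNReal.ofReal_mul (hc z), ENNReal.ofReal_toReal (hfin z)]
    have h4 := h3 (e.C x) Finset.univ (e.C_nonneg x)
    rw [h3 _ _ hK, ← h]
    exact h4
  have h := congrArg (fun M : Measure (List (X × ℝ)) => ∫⁻ l, G l ∂M) hm
  simp only [lintegral_sum_measure, lintegral_smul_measure, tsum_fintype, smul_eq_mul] at h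
  rw [h, Finset.sum_coe_sort F fun z => ENNReal.ofReal (e.C x z + e.excursionMass F x z) *
      ∫⁻ l, G l ∂traceM e F y z]

theorem lintegral_lintegral_traceM_comm (e : Energy X) (F : Finset X) (y z x : X) (a : ℝ)
    {G : List (X × ℝ) → ℝ≥0∞} (hG : Measurable G) :
    ∫⁻ t, ∫⁻ m, G (mergeCons (x, t) m) ∂traceM e F y z ∂expM a =
      ∫⁻ m, ∫⁻ t, G (mergeCons (x, t) m) ∂expM a ∂traceM e F y z :=
  lintegral_lintegral_swap (hG.fun_comp (measurable_mergeCons_uncurry x)).aemeasurable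

theorem lintegral_traceM_rec (e : Energy X) {F : Finset X} {y x : X} (hy : y ∈ F)
    (hx : x ∈ F) {G : List (X × ℝ) → ℝ≥0∞} (hG : Measurable G) :
    ∫⁻ l, G l ∂traceM e F y x =
      (if x = y then 1 else 0) * ∫⁻ t, G [(x, t)] ∂expM (e.lam x) +
        ∑ z ∈ F, ENNReal.ofReal (e.C x z + e.excursionMass F x z) *
          ∫⁻ t, ∫⁻ m, G (mergeCons (x, t) m) ∂traceM e F y z ∂expM (e.lam x) := by
  rw [lintegral_traceM_of_mem e y hx hG]
  -- The integral over the holding time is moved inside, so that the sum over `z` involves integrals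
  -- of one and the same functional.
  simp_rw [lintegral_lintegral_traceM_comm e F y _ x (e.lam x) hG]
  rw [sum_Cw_lintegral_traceM e hy x]

/-- Let $m$ be the finite mass of the traced paths from $x$ to $x$ and $K$ the excursion mass at
$x$. Keeping only the path without jumps and those that first return to $x$ gives
$1+Km\le\lambda_xm$, hence $(\lambda_x-K)m>0$. -/
theorem traceLam_pos (e : Energy X) {F : Finset X} {x : X} (hx : x ∈ F) : 0 < e.traceLam F x := by
  have h := lintegral_traceM_rec e hx hx (G := fun _ => 1) measurable_const
  simp only [lintegral_one, expM_univ (e.lam_pos' x), if_true, one_mul, lintegral_const] at h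
  have h1 : ENNReal.ofReal (e.lam x)⁻¹ + ENNReal.ofReal (e.C x x + e.excursionMass F x x) *
      (traceM e F x x Set.univ * ENNReal.ofReal (e.lam x)⁻¹) ≤ traceM e F x x Set.univ := by
    conv_rhs => rw [h]
    exact add_le_add le_rfl (Finset.single_le_sum (f := fun z =>
      ENNReal.ofReal (e.C x z + e.excursionMass F x z) *
      (traceM e F x z Set.univ * ENNReal.ofReal (e.lam x)⁻¹)) (fun _ _ => zero_le) hx)
  obtain ⟨m, hm, hM⟩ : ∃ m : ℝ, 0 ≤ m ∧ traceM e F x x Set.univ = ENNReal.ofReal m :=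
    ⟨_, ENNReal.toReal_nonneg, (ENNReal.ofReal_toReal (measure_ne_top _ _)).symm⟩
  have hl := e.lam_pos' x
  have hK := e.excursionMass_nonneg F x x
  have hl' : 0 ≤ (e.lam x)⁻¹ := (inv_pos.mpr hl).le
  rw [hM, e.C_diag, zero_add, ← ENNReal.ofReal_mul hm, ← ENNReal.ofReal_mul hK,
    ← ENNReal.ofReal_add hl' (by positivity), ENNReal.ofReal_le_ofReal_iff hm] at h1
  have h2 : 1 + e.excursionMass F x x * m ≤ e.lam x * m := by
    have := mul_le_mul_of_nonneg_left h1 hl.le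
    rw [mul_add, mul_inv_cancel₀ hl.ne'] at this
    refine le_trans (le_of_eq ?_) this
    field_simp
  have h3 : 0 < (e.lam x - e.excursionMass F x x) * m := by linarith
  exact pos_of_mul_pos_left h3 hm

/-- A path started at $z\in F$ has a trace that begins at $z$, so no merging with $x\ne z$ can
occur. -/
theorem lintegral_mergeCons_traceM (e : Energy X) {F : Finset X} {x z : X} (y : X) (hz : z ∈ F)
    (hxz : x ≠ z) (t : ℝ) {G : List (X × ℝ) → ℝ≥0∞} (hG : Measurable G) :
    ∫⁻ m, G (mergeCons (x, t) m) ∂traceM e F y z = ∫⁻ m, G ((x, t) :: m) ∂traceM e F y z := by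
  rw [lintegral_traceM e F y z (hG.fun_comp (Measurable.mergeCons x measurable_const measurable_id')),
    lintegral_traceM e F y z (hG.fun_comp (measurable_cons x t)), lintegral_pathM, lintegral_pathM]
  refine tsum_congr fun w => ?_
  congr 1
  refine lintegral_congr_ae ?_
  filter_upwards [ae_wordM_map_fst e.lam (z :: w)] with l hl
  rcases l with _ | ⟨⟨z', s⟩, l⟩
  · simp at hl
  · simp only [List.map_cons, List.cons.injEq] at hl
    obtain ⟨rfl, -⟩ := hl
    rw [tracePath_cons_of_mem hz, mergeCons_mergeCons_of_ne hxz]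

/-- Decomposition at the first jump of a traced path, after merging. -/
theorem lintegral_traceM_jump (e : Energy X) {F : Finset X} {y x : X} (hy : y ∈ F)
    (hx : x ∈ F) {G : List (X × ℝ) → ℝ≥0∞} (hG : Measurable G) (hG1 : ∀ l, G l ≤ 1) :
    ∫⁻ l, G l ∂traceM e F y x =
      ∫⁻ t, ((if x = y then 1 else 0) * G [(x, t)] +
        ∑ z ∈ F, e.traceCw F x z * ∫⁻ m, G ((x, t) :: m) ∂traceM e F y z)
          ∂expM (e.traceLam F x) := by
  have hmc : ∀ {G : List (X × ℝ) → ℝ≥0∞}, Measurable G → ∀ z,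
      Measurable fun t => ∫⁻ m, G ((x, t) :: m) ∂traceM e F y z := fun {G} hG z =>
    Measurable.lintegral_prod_right' (f := fun p : ℝ × List (X × ℝ) => G ((x, p.1) :: p.2))
      (hG.fun_comp (measurable_cons_uncurry x))
  have hmm : ∀ {G : List (X × ℝ) → ℝ≥0∞}, Measurable G → ∀ z,
      Measurable fun t => ∫⁻ m, G (mergeCons (x, t) m) ∂traceM e F y z := fun {G} hG z =>
    Measurable.lintegral_prod_right' (f := fun p : ℝ × List (X × ℝ) => G (mergeCons (x, p.1) p.2))
      (hG.fun_comp (measurable_mergeCons_uncurry x))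
  have hms : ∀ {G : List (X × ℝ) → ℝ≥0∞}, Measurable G →
      Measurable fun t => (if x = y then 1 else 0) * G [(x, t)] := fun {G} hG =>
    (hG.fun_comp (Measurable.timedCons x measurable_id' measurable_const)).const_mul _
  have hmS : ∀ {G : List (X × ℝ) → ℝ≥0∞}, Measurable G → Measurable fun t =>
      ∑ z ∈ F, e.traceCw F x z * ∫⁻ m, G ((x, t) :: m) ∂traceM e F y z := fun {G} hG =>
    Finset.measurable_sum _ fun z _ => (hmc hG z).const_mul _
  set K := e.excursionMass F x x with hK
  have hK0 : 0 ≤ K := e.excursionMass_nonneg F x x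
  -- The term with target $x$ itself is set apart: a direct jump is impossible, so its weight is the
  -- excursion mass `K`, and only there does a merging take place.
  have stepA : ∀ {G : List (X × ℝ) → ℝ≥0∞}, Measurable G → ∫⁻ l, G l ∂traceM e F y x =
      ∫⁻ t, ((if x = y then 1 else 0) * G [(x, t)] +
        ∑ z ∈ F, e.traceCw F x z * ∫⁻ m, G ((x, t) :: m) ∂traceM e F y z) ∂expM (e.lam x) +
      ENNReal.ofReal K * ∫⁻ t, ∫⁻ m, G (mergeCons (x, t) m) ∂traceM e F y x ∂expM (e.lam x) := by
    intro G hG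
    rw [lintegral_traceM_rec e hy hx hG, lintegral_add_left (hms hG),
      lintegral_const_mul _ (hG.fun_comp (Measurable.timedCons x measurable_id' measurable_const)),
      add_assoc, lintegral_finsetSum _ fun z _ => (hmc hG z).const_mul _]
    congr 1
    rw [← Finset.sum_erase_add _ _ hx, ← Finset.sum_erase_add F (fun z => ∫⁻ t, e.traceCw F x z *
      ∫⁻ m, G ((x, t) :: m) ∂traceM e F y z ∂expM (e.lam x)) hx]
    have h0 : e.traceCw F x x = 0 := by simp [Energy.traceCw, Energy.traceC]
    simp only [h0, zero_mul, lintegral_zero, add_zero, e.C_diag, zero_add]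
    congr 1
    refine Finset.sum_congr rfl fun z hz => ?_
    have hz' := Finset.mem_of_mem_erase hz
    have hxz := (Finset.ne_of_mem_erase hz).symm
    rw [lintegral_const_mul _ (hmc hG z), Energy.traceCw, if_pos ⟨hx, hz'⟩, Energy.traceC,
      if_neg hxz]
    simp_rw [lintegral_mergeCons_traceM e y hz' hxz _ hG]
  have ha := traceLam_pos e hx
  have hlam : e.lam x = e.traceLam F x + K := by rw [Energy.traceLam]; ring
  have hH : Measurable fun t => (if x = y then 1 else 0) * G [(x, t)] +
        ∑ z ∈ F, e.traceCw F x z * ∫⁻ m, G ((x, t) :: m) ∂traceM e F y z := (hms hG).add (hmS hG)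
  have hφ := hmm hG x
  rw [stepA hG]
  -- Write $H$ for the integrand on the right of the statement and $\varphi(s)$ for the integral of
  -- `G` over traced paths with time $s$ added at the start. After the resolvent identity for $H$,
  -- what remains is $\int\varphi\,d\mathrm{exp}_{\lambda}=\int\!\int H(s+t)$, with $s,t$ of rates
  -- $\lambda^{\{F\}}$ and $\lambda$. It follows by equating two expressions of
  -- $\int\varphi\,d\mathrm{exp}_{\lambda^{\{F\}}}$, one from the resolvent identity for $\varphi$
  -- and one from `stepA`, and cancelling the common term.
  have hres := lintegral_expM_resolvent (e.traceLam F x) hK0 hφ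
  have hresH := lintegral_expM_resolvent (e.traceLam F x) hK0 hH
  rw [← hlam] at hres hresH
  rw [← hresH, add_comm]
  congr 2
  -- The common term must be finite to be cancelled in $[0,\infty]$; this is where the bound on `G`
  -- is used.
  have hfin : ENNReal.ofReal K * ∫⁻ s, ∫⁻ t, ∫⁻ m, G (mergeCons (x, s + t) m) ∂traceM e F y x
      ∂expM (e.lam x) ∂expM (e.traceLam F x) ≠ ∞ := by
    refine ENNReal.mul_ne_top ENNReal.ofReal_ne_top ?_
    refine ne_top_of_le_ne_top (b := ∫⁻ s, ∫⁻ t, ∫⁻ m, 1 ∂traceM e F y x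
      ∂expM (e.lam x) ∂expM (e.traceLam F x)) ?_
      (lintegral_mono fun s => lintegral_mono fun t => lintegral_mono fun m => hG1 _)
    simp only [lintegral_const, one_mul, expM_univ ha, expM_univ (e.lam_pos' x)]
    exact ENNReal.mul_ne_top (ENNReal.mul_ne_top (measure_ne_top _ _) ENNReal.ofReal_ne_top)
      ENNReal.ofReal_ne_top
  -- This is `stepA` for the functional that first adds time $s$ at $x$; two successive additions at
  -- $x$ merge into one.
  have hstep : ∀ s, ∫⁻ m, G (mergeCons (x, s) m) ∂traceM e F y x =
      ∫⁻ t, ((if x = y then 1 else 0) * G [(x, s + t)] +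
        ∑ z ∈ F, e.traceCw F x z * ∫⁻ m, G ((x, s + t) :: m) ∂traceM e F y z) ∂expM (e.lam x) +
      ENNReal.ofReal K * ∫⁻ t, ∫⁻ m, G (mergeCons (x, s + t) m) ∂traceM e F y x
        ∂expM (e.lam x) := by
    intro s
    have h := stepA (hG.fun_comp (Measurable.mergeCons x (measurable_const (a := s)) measurable_id'))
    simp_rw [mergeCons_mergeCons_self] at h
    simpa only [mergeCons, if_true] using h
  have hm2 : Measurable fun s => ∫⁻ t, ∫⁻ m, G (mergeCons (x, s + t) m) ∂traceM e F y x
        ∂expM (e.lam x) :=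
    Measurable.lintegral_prod_right' (f := fun p : ℝ × ℝ =>
      ∫⁻ m, G (mergeCons (x, p.1 + p.2) m) ∂traceM e F y x) (hφ.fun_comp (by fun_prop))
  have h1 := lintegral_congr (μ := expM (e.traceLam F x)) hstep
  rw [lintegral_add_right _ (hm2.const_mul _), lintegral_const_mul _ hm2] at h1
  rw [h1, add_comm] at hres
  exact (ENNReal.add_left_inj hfin).mp hres

/-- A family of measures on paths is determined by its decomposition at the first jump. -/
theorem measure_ext_of_jump {U V : X → Measure (List (X × ℝ))} (S : Finset X)
    (K : X → X → ℝ≥0∞) (a : X → ℝ) (y : X)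
    (hU : ∀ x ∈ S, ∀ G : List (X × ℝ) → ℝ≥0∞, Measurable G → (∀ l, G l ≤ 1) →
      ∫⁻ l, G l ∂U x = ∫⁻ t, ((if x = y then 1 else 0) * G [(x, t)] +
        ∑ z ∈ S, K x z * ∫⁻ m, G ((x, t) :: m) ∂U z) ∂expM (a x))
    (hV : ∀ x ∈ S, ∀ G : List (X × ℝ) → ℝ≥0∞, Measurable G → (∀ l, G l ≤ 1) →
      ∫⁻ l, G l ∂V x = ∫⁻ t, ((if x = y then 1 else 0) * G [(x, t)] +
        ∑ z ∈ S, K x z * ∫⁻ m, G ((x, t) :: m) ∂V z) ∂expM (a x)) :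
    ∀ x ∈ S, U x = V x := by
  have hlen : ∀ n, MeasurableSet {l : List (X × ℝ) | l.length = n} := fun n => by
    have h : {l : List (X × ℝ) | l.length = n} =
        {l : List (X × ℝ) | l.map Prod.fst ∈ {w : List X | w.length = n}} := by ext; simp
    rw [h]
    exact measurableSet_map_fst _
  -- Induction on the length: on lists of length $n+1$ the equation involves both families only
  -- through lists of length $n$.
  have key : ∀ n, ∀ x ∈ S, ∀ B, MeasurableSet B → (∀ l ∈ B, l.length = n) → U x B = V x B := by
    intro n
    induction n with
    | zero =>
      intro x hx B hB hBn
      have hBm : Measurable (B.indicator (1 : List (X × ℝ) → ℝ≥0∞)) := measurable_one.indicator hB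
      have hB1 : ∀ l, B.indicator (1 : List (X × ℝ) → ℝ≥0∞) l ≤ 1 :=
        fun l => Set.indicator_le_self' (by simp) l
      have hc : ∀ (p : X × ℝ) l, B.indicator (1 : List (X × ℝ) → ℝ≥0∞) (p :: l) = 0 :=
        fun p l => Set.indicator_of_notMem (fun h => by simpa using hBn _ h) _
      rw [← lintegral_indicator_one hB, ← lintegral_indicator_one hB, hU x hx _ hBm hB1,
        hV x hx _ hBm hB1]
      simp [hc]
    | succ n ih =>
      intro x hx B hB hBn
      have hBm : Measurable (B.indicator (1 : List (X × ℝ) → ℝ≥0∞)) := measurable_one.indicator hB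
      have hB1 : ∀ l, B.indicator (1 : List (X × ℝ) → ℝ≥0∞) l ≤ 1 :=
        fun l => Set.indicator_le_self' (by simp) l
      rw [← lintegral_indicator_one hB, ← lintegral_indicator_one hB, hU x hx _ hBm hB1,
        hV x hx _ hBm hB1]
      refine lintegral_congr fun t => ?_
      congr 1
      refine Finset.sum_congr rfl fun z hz => ?_
      congr 1
      have hBt : MeasurableSet ((fun l => (x, t) :: l) ⁻¹' B) := measurable_cons x t hB
      have h1 : ∀ l, B.indicator (1 : List (X × ℝ) → ℝ≥0∞) ((x, t) :: l) =
          ((fun l => (x, t) :: l) ⁻¹' B).indicator 1 l := fun l => rfl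
      simp_rw [h1]
      rw [lintegral_indicator_one hBt, lintegral_indicator_one hBt]
      exact ih z hz _ hBt fun l hl => by simpa using hBn _ hl
  intro x hx
  ext B hB
  have hd : B = ⋃ n, B ∩ {l : List (X × ℝ) | l.length = n} := by
    ext l
    simp
  have hdis : Pairwise (Function.onFun Disjoint fun n => B ∩ {l : List (X × ℝ) | l.length = n}) := by
    intro m n hmn
    refine Set.disjoint_left.mpr fun l hl hl' => hmn (hl.2.symm.trans hl'.2)
  rw [hd, measure_iUnion hdis fun n => hB.inter (hlen n),
    measure_iUnion hdis fun n => hB.inter (hlen n)]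
  exact tsum_congr fun n => key n x hx _ (hB.inter (hlen n)) fun l hl => hl.2

/-- The traces of the timed paths are the timed paths of the trace of the chain. -/
theorem traceM_eq_pathM (e : Energy X) {F : Finset X} {y : X} (hy : y ∈ F) :
    ∀ x ∈ F, traceM e F y x = pathM (e.traceCw F) (e.traceLam F) y x := by
  refine measure_ext_of_jump F (e.traceCw F) (e.traceLam F) y
    (fun x hx G hG hG1 => lintegral_traceM_jump e hy hx hG hG1) fun x hx G hG _ => ?_
  have hmc : ∀ z, Measurable fun t =>
      ∫⁻ m, G ((x, t) :: m) ∂pathM (e.traceCw F) (e.traceLam F) y z := fun z =>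
    measurable_lintegral_pathM _ _ _ _ (hG.fun_comp (measurable_cons_uncurry x))
  have hs : Measurable fun t => G [(x, t)] :=
    hG.fun_comp (Measurable.timedCons x measurable_id' measurable_const)
  rw [lintegral_pathM_rec _ _ _ _ hG, lintegral_add_left (hs.const_mul _),
    lintegral_const_mul _ hs, lintegral_finsetSum _ fun z _ => (hmc z).const_mul _]
  congr 1
  rw [← Finset.sum_subset (Finset.subset_univ F)]
  · exact Finset.sum_congr rfl fun z _ => (lintegral_const_mul _ (hmc z)).symm
  · intro z _ hz
    rw [Energy.traceCw, if_neg fun h => hz h.2, zero_mul]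

end PathTrace

/-! ### The trace of the loop measure -/

section NullSets

variable {X : Type*} [Fintype X]

theorem ae_wordM (lam : X → ℝ) (w : List X) :
    ∀ᵐ l ∂wordM lam w, (∀ p ∈ l, 0 < p.2) ∧ l.map Prod.fst = w :=
  (ae_wordM_pos lam w).and (ae_wordM_map_fst lam w)

/-- Only loops with positive holding times and, if non trivial, with a word of nonzero weight carry
mass; two functionals need only agree there. -/
theorem lintegral_wordLoops_congr {S : Finset X} {C : X → X → ℝ≥0∞} {lam : X → ℝ}
    {f g : Loop X → ℝ≥0∞} (hf : Measurable f) (hg : Measurable g)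
    (htriv : ∀ x ∈ S, ∀ t, 0 < t →
      f (([(x, t)] : List (X × ℝ)) : Loop X) = g (([(x, t)] : List (X × ℝ)) : Loop X))
    (hw : ∀ l : List (X × ℝ), (∀ p ∈ l, 0 < p.2) → loopW C (l.map Prod.fst) ≠ 0 →
      f (l : Loop X) = g (l : Loop X)) :
    ∫⁻ l, f l ∂wordLoops S C lam = ∫⁻ l, g l ∂wordLoops S C lam := by
  rw [lintegral_wordLoops _ _ _ hf, lintegral_wordLoops _ _ _ hg]
  congr 1
  · refine Finset.sum_congr rfl fun x hx => lintegral_congr_ae ?_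
    filter_upwards [ae_pos_trivM (lam x)] with t ht using htriv x hx t ht
  · refine tsum_congr fun w => ?_
    by_cases h0 : loopW C w = 0
    · rw [h0, zero_mul, zero_mul]
    · congr 1
      refine lintegral_congr_ae ?_
      filter_upwards [ae_wordM lam w] with l hl using hw l hl.1 (by rwa [hl.2])

theorem ae_wordLoops {S : Finset X} {C : X → X → ℝ≥0∞} {lam : X → ℝ}
    {p : Loop X → Prop} (hp : MeasurableSet {l | p l})
    (htriv : ∀ x ∈ S, ∀ t, 0 < t → p (([(x, t)] : List (X × ℝ)) : Loop X))
    (hw : ∀ l : List (X × ℝ), (∀ p ∈ l, 0 < p.2) → loopW C (l.map Prod.fst) ≠ 0 →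
      p (l : Loop X)) :
    ∀ᵐ l ∂wordLoops S C lam, p l := by
  have h := lintegral_wordLoops_congr (S := S) (C := C) (lam := lam)
    (f := {l | p l}ᶜ.indicator 1) (g := fun _ => 0)
    (measurable_one.indicator hp.compl) measurable_const
    (fun x hx t ht => Set.indicator_of_notMem (fun h => (show ¬ p _ from h) (htriv x hx t ht)) _)
    (fun l hl hl' => Set.indicator_of_notMem (fun h => (show ¬ p _ from h) (hw l hl hl')) _)
  rw [lintegral_indicator_one hp.compl, lintegral_zero] at h
  exact h

end NullSets

/-! ### Invariants of the trace of a list -/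

section TraceLists

variable {X : Type*} [DecidableEq X]

theorem mergeCons_nonneg {p : X × ℝ} {l : List (X × ℝ)} (hp : 0 ≤ p.2) (hl : ∀ q ∈ l, 0 ≤ q.2) :
    ∀ q ∈ mergeCons p l, 0 ≤ q.2 := by
  cases l with
  | nil => simpa [mergeCons] using hp
  | cons r l =>
    simp only [List.forall_mem_cons] at hl
    by_cases h : p.1 = r.1
    · simp only [mergeCons, h, if_true, List.forall_mem_cons]
      exact ⟨add_nonneg hp hl.1, hl.2⟩
    · simp only [mergeCons, h, if_false, List.forall_mem_cons]
      exact ⟨hp, hl.1, hl.2⟩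

theorem tracePath_nonneg (F : Finset X) {l : List (X × ℝ)} (hl : ∀ q ∈ l, 0 ≤ q.2) :
    ∀ q ∈ tracePath F l, 0 ≤ q.2 := by
  induction l with
  | nil => simp [tracePath_nil]
  | cons p l ih =>
    obtain ⟨x, t⟩ := p
    simp only [List.forall_mem_cons] at hl
    by_cases hx : x ∈ F
    · rw [tracePath_cons_of_mem hx]
      exact mergeCons_nonneg hl.1 (ih hl.2)
    · rw [tracePath_cons_of_notMem hx]
      exact ih hl.2

theorem entryTime_add (F : Finset X) (x : X) {s t : ℝ} (hs : 0 ≤ s) (ht : 0 ≤ t) :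
    entryTime F (x, s + t) = entryTime F (x, s) + entryTime F (x, t) := by
  unfold entryTime
  split_ifs
  · exact ENNReal.ofReal_add hs ht
  · simp

theorem sum_entryTime_mergeCons (F : Finset X) {p : X × ℝ} {l : List (X × ℝ)} (hp : 0 ≤ p.2)
    (hl : ∀ q ∈ l, 0 ≤ q.2) :
    ((mergeCons p l).map (entryTime F)).sum = entryTime F p + (l.map (entryTime F)).sum := by
  cases l with
  | nil => simp [mergeCons]
  | cons r l =>
    obtain ⟨x, s⟩ := p
    obtain ⟨y, t⟩ := r
    by_cases h : x = y
    · subst h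
      simp only [mergeCons, if_true, List.map_cons, List.sum_cons]
      rw [entryTime_add F x hp (hl (x, t) (by simp)), add_assoc]
    · simp [mergeCons, h]

theorem sum_entryTime_tracePath {F' F : Finset X} (hF : F' ⊆ F) {l : List (X × ℝ)}
    (hl : ∀ q ∈ l, 0 ≤ q.2) :
    ((tracePath F l).map (entryTime F')).sum = (l.map (entryTime F')).sum := by
  induction l with
  | nil => simp [tracePath_nil]
  | cons p l ih =>
    obtain ⟨x, t⟩ := p
    simp only [List.forall_mem_cons] at hl
    by_cases hx : x ∈ F
    · rw [tracePath_cons_of_mem hx, sum_entryTime_mergeCons F' hl.1 (tracePath_nonneg F hl.2),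
        ih hl.2, List.map_cons, List.sum_cons]
    · rw [tracePath_cons_of_notMem hx, ih hl.2, List.map_cons, List.sum_cons, entryTime,
        if_neg fun h => hx (hF h), zero_add]

theorem sum_entryTime_mergeEnds (F : Finset X) {l : List (X × ℝ)} (hl : ∀ q ∈ l, 0 ≤ q.2) :
    ((mergeEnds l).map (entryTime F)).sum = (l.map (entryTime F)).sum := by
  rcases l with _ | ⟨⟨x, s⟩, l⟩
  · rfl
  rcases List.eq_nil_or_concat l with rfl | ⟨m, ⟨y, t⟩, rfl⟩
  · rfl
  · rw [List.concat_eq_append, mergeEnds_cons_concat]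
    split_ifs with h
    · change x = y at h
      subst h
      simp only [List.map_cons, List.sum_cons, List.map_append, List.map_nil, List.sum_append,
        List.sum_nil, add_zero]
      rw [entryTime_add F x (hl (x, s) (by simp)) (hl (x, t) (by simp)), add_assoc,
        add_comm (entryTime F (x, t))]
    · rfl

theorem timeIn_trace {F' F : Finset X} (hF : F' ⊆ F) {l : List (X × ℝ)}
    (hl : ∀ q ∈ l, 0 ≤ q.2) :
    Loop.timeIn F' (Loop.trace F (l : Loop X)) = Loop.timeIn F' (l : Loop X) := by
  rw [trace_coe, timeIn_coe, timeIn_coe]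
  change ((mergeEnds (tracePath F l)).map (entryTime F')).sum = _
  rw [sum_entryTime_mergeEnds F' (tracePath_nonneg F hl), sum_entryTime_tracePath hF hl]

/-- After a rotation the two pieces of the visit are adjacent and are merged by the trace. This is
the insensitivity to the starting time needed for marking a loop. -/
theorem trace_merge {F : Finset X} {x : X} (hx : x ∈ F) (s t : ℝ) (l : List (X × ℝ)) :
    Loop.trace F (((x, s) :: (l ++ [(x, t)]) : List (X × ℝ)) : Loop X) =
      Loop.trace F (((x, s + t) :: l : List (X × ℝ)) : Loop X) := by
  have h : (((x, s) :: (l ++ [(x, t)]) : List (X × ℝ)) : Loop X) =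
      (((x, t) :: (x, s) :: l : List (X × ℝ)) : Loop X) :=
    Cycle.coe_eq_coe.mpr (List.IsRotated.symm ⟨1, by simp⟩)
  rw [h, trace_coe, trace_coe]
  change ((mergeEnds (tracePath F _) : List (X × ℝ)) : Loop X) = (mergeEnds (tracePath F _) : List (X × ℝ))
  rw [tracePath_cons_of_mem hx, tracePath_cons_of_mem hx, tracePath_cons_of_mem hx,
    mergeCons_mergeCons_self, add_comm]

theorem tracePath_eq_self {F : Finset X} {l : List (X × ℝ)} (hF : ∀ x ∈ l.map Prod.fst, x ∈ F)
    (hc : (l.map Prod.fst).IsChain (· ≠ ·)) : tracePath F l = l := by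
  induction l with
  | nil => rfl
  | cons p l ih =>
    obtain ⟨x, t⟩ := p
    simp only [List.map_cons, List.forall_mem_cons] at hF hc
    rw [tracePath_cons_of_mem hF.1, ih hF.2 hc.tail]
    cases l with
    | nil => rfl
    | cons q l =>
      rw [List.map_cons, List.isChain_cons_cons] at hc
      simp [mergeCons, hc.1]

theorem pathW_ne_zero {C : X → X → ℝ≥0∞} {F : Finset X}
    (hC : ∀ x z, C x z ≠ 0 → x ≠ z ∧ z ∈ F) {x y : X} {w : List X} (h : pathW C y x w ≠ 0) :
    (x :: w).IsChain (· ≠ ·) ∧ ∀ z ∈ w, z ∈ F := by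
  induction w generalizing x with
  | nil => simp
  | cons z w ih =>
    rw [pathW] at h
    have h1 := hC x z (left_ne_zero_of_mul h)
    have h2 := ih (right_ne_zero_of_mul h)
    rw [List.isChain_cons_cons]
    exact ⟨⟨h1.1, h2.1⟩, List.forall_mem_cons.mpr ⟨h1.2, h2.2⟩⟩

/-- A nonzero cyclic weight forces all points to lie in $F$ and cyclically successive points to
differ, so nothing is deleted or merged. Hence loops of the traced chain are their own traces. -/
theorem traceList_eq_self {C : X → X → ℝ≥0∞} {F : Finset X}
    (hC : ∀ x z, C x z ≠ 0 → x ≠ z ∧ z ∈ F) {l : List (X × ℝ)}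
    (h : cycW C (l.map Prod.fst) ≠ 0) : traceList F l = l := by
  rcases l with _ | ⟨⟨x, s⟩, l⟩
  · rfl
  change linkW C x (l.map Prod.fst) x ≠ 0 at h
  have h1 := pathW_ne_zero (C := C) (F := F) (y := x) hC (x := x) (w := l.map Prod.fst ++ [x])
    (by rwa [pathW_append, if_pos rfl])
  have h2 : tracePath F ((x, s) :: l) = (x, s) :: l := by
    refine tracePath_eq_self ?_ ?_
    · intro z hz
      rcases List.mem_cons.mp hz with rfl | hz
      · exact h1.2 _ (by simp)
      · exact h1.2 _ (List.mem_append_left _ hz)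
    · have h3 := h1.1
      rw [← List.cons_append] at h3
      exact h3.left_of_append
  change mergeEnds (tracePath F ((x, s) :: l)) = _
  rw [h2]
  rcases List.eq_nil_or_concat l with rfl | ⟨m, ⟨y, t⟩, rfl⟩
  · rfl
  · rw [List.concat_eq_append, mergeEnds_cons_concat, if_neg]
    rw [List.concat_eq_append, List.map_append, List.map_cons, List.map_nil, linkW_append] at h
    exact fun hxy => (hC y x (right_ne_zero_of_mul h)).1 hxy.symm

theorem timeIn_ne_top (F : Finset X) (l : List (X × ℝ)) : Loop.timeIn F (l : Loop X) ≠ ∞ := by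
  rw [timeIn_coe]
  induction l with
  | nil => simp
  | cons p l ih =>
    rw [List.map_cons, List.sum_cons]
    refine ENNReal.add_ne_top.mpr ⟨?_, ih⟩
    unfold entryTime
    split_ifs <;> simp

theorem timeIn_ne_zero_iff (F : Finset X) {l : List (X × ℝ)} (hl : ∀ p ∈ l, 0 < p.2) :
    Loop.timeIn F (l : Loop X) ≠ 0 ↔ ∃ p ∈ (l : Loop X), p.1 ∈ F := by
  rw [timeIn_coe, Ne, List.sum_eq_zero_iff]
  simp only [List.mem_map, forall_exists_index, and_imp, forall_apply_eq_imp_iff₂, not_forall,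
    Cycle.mem_coe_iff]
  refine exists_congr fun p => ?_
  rw [exists_prop]
  refine and_congr_right fun hp => ?_
  unfold entryTime
  split_ifs with h
  · simp [h, hl p hp]
  · simp [h]

end TraceLists

theorem measurableSet_hits {X : Type*} [Countable X] (F : Finset X) :
    MeasurableSet {l : Loop X | ∃ p ∈ l, p.1 ∈ F} := by
  rw [measurableSet_loop_iff]
  have h : {l : List (X × ℝ) | (l : Loop X) ∈ {l : Loop X | ∃ p ∈ l, p.1 ∈ F}} =
      {l : List (X × ℝ) | l.map Prod.fst ∈ {w : List X | ∃ x ∈ w, x ∈ F}} := by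
    ext l
    simp
  rw [h]
  exact measurableSet_map_fst _

/-! ### The trace of the loop measure -/

section TraceMeasure

variable {X : Type*} [Fintype X] [DecidableEq X]

theorem traceCw_ne_zero (e : Energy X) {F : Finset X} {x z : X} (h : e.traceCw F x z ≠ 0) :
    x ≠ z ∧ z ∈ F := by
  unfold Energy.traceCw at h
  split_ifs at h with hm
  · refine ⟨fun hxz => h ?_, hm.2⟩
    rw [Energy.traceC, if_pos hxz, ENNReal.ofReal_zero]
  · exact absurd rfl h

/-- The loop measure of the trace of the chain on `F`. -/
def traceLoops (e : Energy X) (F : Finset X) : Measure (Loop X) :=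
  wordLoops F (e.traceCw F) (e.traceLam F)

/-- The trace on `F` of the loop measure is the loop measure of the trace. -/
theorem lintegral_trace (e : Energy X) (F : Finset X) {f : Loop X → ℝ≥0∞} (hf : Measurable f) :
    ∫⁻ l in {l | ∃ p ∈ l, p.1 ∈ F}, f (l.trace F) ∂loopMeasure e = ∫⁻ l, f l ∂traceLoops e F := by
  have hft := hf.fun_comp (measurable_trace F)
  have hT := measurable_timeIn F
  -- The functional is divided by the time spent in $F$, which tracing preserves, so that the
  -- marking formula applies to both loop measures.
  have hgt : Measurable fun l => (Loop.timeIn F l)⁻¹ * f l := hT.inv.mul hf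
  have hg : Measurable fun l : Loop X => (Loop.timeIn F (l.trace F))⁻¹ * f (l.trace F) :=
    hgt.fun_comp (measurable_trace F)
  have hTg : Measurable fun l : Loop X =>
      Loop.timeIn F l * ((Loop.timeIn F (l.trace F))⁻¹ * f (l.trace F)) := hT.mul hg
  have hcancel : ∀ l : List (X × ℝ), (∀ p ∈ l, 0 < p.2) → (∃ p ∈ (l : Loop X), p.1 ∈ F) →
      Loop.timeIn F (l : Loop X) * ((Loop.timeIn F (Loop.trace F (l : Loop X)))⁻¹ *
        f (Loop.trace F (l : Loop X))) = f (Loop.trace F (l : Loop X)) := by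
    intro l hl hF
    rw [timeIn_trace subset_rfl fun q hq => (hl q hq).le, ← mul_assoc,
      ENNReal.mul_inv_cancel ((timeIn_ne_zero_iff F hl).mpr hF) (timeIn_ne_top F l), one_mul]
  have hmerge : ∀ x ∈ F, ∀ (s t : ℝ) (l : List (X × ℝ)),
      (Loop.timeIn F (Loop.trace F (((x, s) :: (l ++ [(x, t)]) : List (X × ℝ)) : Loop X)))⁻¹ *
        f (Loop.trace F (((x, s) :: (l ++ [(x, t)]) : List (X × ℝ)) : Loop X)) =
      (Loop.timeIn F (Loop.trace F (((x, s + t) :: l : List (X × ℝ)) : Loop X)))⁻¹ *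
        f (Loop.trace F (((x, s + t) :: l : List (X × ℝ)) : Loop X)) := by
    intro x hx s t l
    rw [trace_merge hx]
  have h1 : ∫⁻ l in {l | ∃ p ∈ l, p.1 ∈ F}, f (l.trace F) ∂loopMeasure e =
      ∑ x ∈ F, ∫⁻ l, (Loop.timeIn F (Loop.trace F (l : Loop X)))⁻¹ *
        f (Loop.trace F (l : Loop X)) ∂pathM e.Cw e.lam x x := by
    rw [← lintegral_timeIn_wordLoops (Finset.subset_univ F) e.Cw
      (fun x => by simp [Energy.Cw, e.C_diag]) e.lam hg hmerge, loopMeasure_eq_wordLoops,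
      ← lintegral_indicator (measurableSet_hits F)]
    have key : ∀ l : List (X × ℝ), (∀ p ∈ l, 0 < p.2) →
        {l : Loop X | ∃ p ∈ l, p.1 ∈ F}.indicator (fun l => f (l.trace F)) (l : Loop X) =
        Loop.timeIn F (l : Loop X) * ((Loop.timeIn F (Loop.trace F (l : Loop X)))⁻¹ *
          f (Loop.trace F (l : Loop X))) := by
      intro l hl
      by_cases hF : ∃ p ∈ (l : Loop X), p.1 ∈ F
      · rw [hcancel l hl hF]
        exact Set.indicator_of_mem (s := {l : Loop X | ∃ p ∈ l, p.1 ∈ F}) hF _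
      · rw [not_not.mp (mt (timeIn_ne_zero_iff F hl).mp hF), zero_mul]
        exact Set.indicator_of_notMem (s := {l : Loop X | ∃ p ∈ l, p.1 ∈ F}) hF _
    exact lintegral_wordLoops_congr (hft.indicator (measurableSet_hits F)) hTg
      (fun x _ t ht => key _ (by simpa using ht)) fun l hl _ => key l hl
  have h2 : ∫⁻ l, f l ∂traceLoops e F =
      ∑ x ∈ F, ∫⁻ l, (Loop.timeIn F (Loop.trace F (l : Loop X)))⁻¹ *
        f (Loop.trace F (l : Loop X)) ∂pathM (e.traceCw F) (e.traceLam F) x x := by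
    rw [← lintegral_timeIn_wordLoops (subset_refl F) (e.traceCw F)
      (fun x => by simp [Energy.traceCw, Energy.traceC]) (e.traceLam F) hg hmerge, traceLoops]
    refine lintegral_wordLoops_congr hf hTg (fun x hx t ht => ?_) fun l hl hw => ?_
    · rw [hcancel _ (by simpa using ht) (by simpa using hx), trace_coe]
      congr 2
      change _ = mergeEnds (tracePath F _)
      rw [tracePath_cons_of_mem hx]
      rfl
    · have hc : cycW (e.traceCw F) (l.map Prod.fst) ≠ 0 := by
        intro h0
        simp [loopW, h0] at hw
      have hts := traceList_eq_self (F := F) (fun x z => traceCw_ne_zero e) hc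
      have hF : ∃ p ∈ (l : Loop X), p.1 ∈ F := by
        rcases l with _ | ⟨⟨x, s⟩, l⟩
        · simp [loopW] at hw
        · have h3 := pathW_ne_zero (C := e.traceCw F) (F := F) (y := x)
            (fun x z => traceCw_ne_zero e) (x := x) (w := l.map Prod.fst ++ [x])
            (by rwa [pathW_append, if_pos rfl])
          exact ⟨(x, s), by simp, h3.2 x (by simp)⟩
      rw [hcancel l hl hF, trace_coe, hts]
  rw [h1, h2]
  -- Both sides are now integrals over closed paths. Tracing a loop is tracing the path and then
  -- merging its ends, so the law of the traced paths concludes; paths of the traced chain are fixed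
  -- by `tracePath`.
  refine Finset.sum_congr rfl fun x hx => ?_
  have hge : Measurable fun m : List (X × ℝ) => (Loop.timeIn F ((mergeEnds m : List (X × ℝ)) : Loop X))⁻¹ *
      f ((mergeEnds m : List (X × ℝ)) : Loop X) :=
    (measurable_loop_iff.mp hgt).fun_comp measurable_mergeEnds
  have h3 := lintegral_traceM e F x x hge
  rw [traceM_eq_pathM e hx x hx] at h3
  refine h3.symm.trans ?_
  rw [lintegral_pathM, lintegral_pathM]
  refine tsum_congr fun w => ?_
  by_cases h0 : pathW (e.traceCw F) x x w = 0
  · rw [h0, zero_mul, zero_mul]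
  congr 1
  refine lintegral_congr_ae ?_
  filter_upwards [ae_wordM_map_fst (e.traceLam F) (x :: w)] with l hl
  have h4 := pathW_ne_zero (F := F) (fun x z => traceCw_ne_zero e) h0
  have h5 : tracePath F l = l := by
    refine tracePath_eq_self ?_ (by rw [hl]; exact h4.1)
    rw [hl]
    exact List.forall_mem_cons.mpr ⟨hx, h4.2⟩
  have h6 : traceList F l = mergeEnds l := congrArg mergeEnds h5
  rw [trace_coe, h6]

end TraceMeasure

/-! ### Changing the conductances and the masses of a loop measure -/

section WordSteps

variable {X : Type*}

/-- The cyclic steps of a word. -/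
def wordSteps (w : List X) : List (X × X) := List.zipWith Prod.mk w (w.rotate 1)

theorem cyclicSteps_eq_wordSteps (l : List (X × ℝ)) :
    cyclicSteps l = wordSteps (l.map Prod.fst) := by
  rw [cyclicSteps, wordSteps, ← List.map_rotate, List.zipWith_map]

theorem prod_map_zipWith (ρ : X → X → ℝ≥0∞) (x y : X) (w : List X) :
    ((List.zipWith Prod.mk (x :: w) (w ++ [y])).map fun p => ρ p.1 p.2).prod = linkW ρ x w y := by
  induction w generalizing x with
  | nil => simp [linkW]
  | cons z w ih =>
    rw [List.cons_append, List.zipWith_cons_cons, List.map_cons, List.prod_cons, ih, linkW]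

theorem prod_map_wordSteps (ρ : X → X → ℝ≥0∞) {w : List X} (hw : w ≠ []) :
    ((wordSteps w).map fun p => ρ p.1 p.2).prod = cycW ρ w := by
  cases w with
  | nil => exact absurd rfl hw
  | cons x w =>
    rw [wordSteps, List.rotate_cons_succ, List.rotate_zero, prod_map_zipWith, cycW]

theorem linkW_mul (ρ C : X → X → ℝ≥0∞) (x y : X) (w : List X) :
    linkW (fun x y => ρ x y * C x y) x w y = linkW ρ x w y * linkW C x w y := by
  induction w generalizing x with
  | nil => rfl
  | cons z w ih =>
    simp only [linkW, ih]
    ring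

theorem cycW_mul (ρ C : X → X → ℝ≥0∞) (w : List X) :
    cycW (fun x y => ρ x y * C x y) w = cycW ρ w * cycW C w := by
  cases w with
  | nil => simp [cycW]
  | cons x w => exact linkW_mul ρ C x x w

theorem loopW_mul (ρ C : X → X → ℝ≥0∞) (w : List X) :
    loopW (fun x y => ρ x y * C x y) w = cycW ρ w * loopW C w := by
  unfold loopW
  split_ifs
  · rw [cycW_mul, mul_div_assoc]
  · simp

theorem linkW_left (c : X → ℝ≥0∞) (x y : X) (w : List X) :
    linkW (fun x _ => c x) x w y = ((x :: w).map c).prod := by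
  induction w generalizing x with
  | nil => simp [linkW]
  | cons z w ih => rw [linkW, ih, List.map_cons (a := x), List.prod_cons]

theorem cycW_left (c : X → ℝ≥0∞) {w : List X} (hw : w ≠ []) :
    cycW (fun x _ => c x) w = (w.map c).prod := by
  cases w with
  | nil => exact absurd rfl hw
  | cons x w => exact linkW_left c x x w

theorem linkW_support {C : X → X → ℝ≥0∞} {S : Finset X} (hC : ∀ x y, C x y ≠ 0 → y ∈ S)
    {x y : X} {w : List X} (h : linkW C x w y ≠ 0) : ∀ z ∈ y :: w, z ∈ S := by
  induction w generalizing x with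
  | nil => simpa using hC x y h
  | cons a w ih =>
    rw [linkW] at h
    have h1 := ih (right_ne_zero_of_mul h)
    have h2 := hC x a (left_ne_zero_of_mul h)
    simp only [List.forall_mem_cons] at h1 ⊢
    exact ⟨h1.1, h2, h1.2⟩

theorem loopW_support {C : X → X → ℝ≥0∞} {S : Finset X} (hC : ∀ x y, C x y ≠ 0 → y ∈ S)
    {w : List X} (h : loopW C w ≠ 0) : 2 ≤ w.length ∧ ∀ z ∈ w, z ∈ S := by
  unfold loopW at h
  split_ifs at h with h2
  · refine ⟨h2, ?_⟩
    cases w with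
    | nil => simp
    | cons x w =>
      refine linkW_support hC (x := x) (C := C) fun h0 => h ?_
      rw [cycW, h0, ENNReal.zero_div]
  · exact absurd rfl h

theorem wordM_congr {lam lam' : X → ℝ} {w : List X} (h : ∀ x ∈ w, lam x = lam' x) :
    wordM lam w = wordM lam' w := by
  induction w with
  | nil => rfl
  | cons x w ih =>
    rw [List.forall_mem_cons] at h
    rw [wordM, wordM, ih h.2, h.1]

variable [DecidableEq X]

theorem N_coe (x y : X) (l : List (X × ℝ)) :
    Loop.N x y (l : Loop X) =
      if (l.map Prod.fst).length ≤ 1 then 0 else (wordSteps (l.map Prod.fst)).count (x, y) := by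
  rw [List.length_map, ← cyclicSteps_eq_wordSteps]
  rfl

theorem occ_coe (x : X) (l : List (X × ℝ)) :
    Loop.occ x (l : Loop X) = (l.map fun p => if p.1 = x then p.2 else 0).sum := by
  have h : Loop.occ x (l : Loop X) = ((l.filter fun p => p.1 = x).map Prod.snd).sum := by
    simp [Loop.occ]
  rw [h]
  induction l with
  | nil => rfl
  | cons p l ih =>
    have ih' := ih (by simp [Loop.occ])
    by_cases hp : p.1 = x
    · rw [List.filter_cons_of_pos (by simpa using hp), List.map_cons, List.sum_cons, ih',
        List.map_cons, List.sum_cons, if_pos hp]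
    · rw [List.filter_cons_of_neg (by simpa using hp), ih', List.map_cons, List.sum_cons,
        if_neg hp, zero_add]

theorem measurable_N [Countable X] (x y : X) : Measurable (Loop.N x y : Loop X → ℕ) := by
  rw [measurable_loop_iff]
  simp_rw [N_coe]
  exact measurable_of_map_fst
    (fun w : List X => if w.length ≤ 1 then 0 else (wordSteps w).count (x, y))

theorem measurable_occ (x : X) : Measurable (Loop.occ x : Loop X → ℝ) := by
  rw [measurable_loop_iff]
  have h : ∀ l : List (X × ℝ), Loop.occ x (l : Loop X) =
      weightedTime (fun z => if z = x then 1 else 0) l := by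
    intro l
    rw [occ_coe, weightedTime]
    congr 1
    refine List.map_congr_left fun p _ => ?_
    split_ifs <;> simp
  simp_rw [h]
  exact measurable_weightedTime _

theorem occ_nonneg (x : X) {l : List (X × ℝ)} (hl : ∀ p ∈ l, 0 ≤ p.2) :
    0 ≤ Loop.occ x (l : Loop X) := by
  rw [occ_coe]
  refine List.sum_nonneg fun r hr => ?_
  obtain ⟨p, hp, rfl⟩ := List.mem_map.mp hr
  split_ifs
  · exact hl p hp
  · exact le_rfl

theorem ofReal_occ (x : X) {l : List (X × ℝ)} (hl : ∀ p ∈ l, 0 ≤ p.2) :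
    ENNReal.ofReal (Loop.occ x (l : Loop X)) = Loop.timeIn {x} (l : Loop X) := by
  rw [timeIn_coe]
  induction l with
  | nil =>
    rw [occ_coe]
    simp
  | cons p l ih =>
    have h1 := occ_nonneg x (l := l) fun q hq => hl q (List.mem_cons_of_mem _ hq)
    rw [occ_coe] at h1
    rw [List.map_cons, List.sum_cons, ← ih fun q hq => hl q (List.mem_cons_of_mem _ hq), occ_coe,
      List.map_cons, List.sum_cons, occ_coe, ENNReal.ofReal_add _ h1]
    · unfold entryTime
      simp only [Finset.mem_singleton]
      split_ifs <;> simp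
    · split_ifs
      · exact hl p List.mem_cons_self
      · exact le_rfl

variable [Fintype X]

theorem sum_mul_occ (δ : X → ℝ) (l : List (X × ℝ)) :
    ∑ x, δ x * Loop.occ x (l : Loop X) = weightedTime δ l := by
  simp_rw [occ_coe]
  induction l with
  | nil => simp [weightedTime]
  | cons p l ih =>
    simp only [List.map_cons, List.sum_cons, mul_add, Finset.sum_add_distrib, ih, weightedTime]
    congr 1
    simp

theorem prod_pow_count (f : X × X → ℝ≥0∞) (L : List (X × X)) :
    ∏ p : X × X, f p ^ L.count (p.1, p.2) = (L.map f).prod := by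
  induction L with
  | nil => simp
  | cons q L ih =>
    simp_rw [List.count_cons, pow_add, Finset.prod_mul_distrib]
    rw [ih, List.map_cons, List.prod_cons, mul_comm]
    congr 1
    rw [Finset.prod_eq_single q]
    · simp
    · intro p _ hp
      simp [hp.symm]
    · simp

/-- The density `∏ ρ_{x,y}^{N_{x,y}(l)} exp (- ∑ δ_x l̂_x)`. -/
def Loop.tilt (ρ : X → X → ℝ≥0∞) (δ : X → ℝ) (l : Loop X) : ℝ≥0∞ :=
  (∏ p : X × X, ρ p.1 p.2 ^ l.N p.1 p.2) * ENNReal.ofReal (Real.exp (-∑ x, δ x * l.occ x))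

theorem measurable_tilt (ρ : X → X → ℝ≥0∞) (δ : X → ℝ) : Measurable (Loop.tilt ρ δ) := by
  have hN := fun p : X × X => measurable_N p.1 p.2
  have hO := fun x : X => measurable_occ x
  unfold Loop.tilt
  refine Measurable.mul (Finset.measurable_prod _ fun p _ => ?_) ?_
  · exact (measurable_of_countable fun n : ℕ => ρ p.1 p.2 ^ n).comp (hN p)
  · exact ENNReal.measurable_ofReal.comp (Real.measurable_exp.comp
      (Finset.measurable_sum _ fun x _ => (hO x).const_mul _).neg)

theorem tilt_coe (ρ : X → X → ℝ≥0∞) (δ : X → ℝ) (l : List (X × ℝ)) :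
    Loop.tilt ρ δ (l : Loop X) =
      (if (l.map Prod.fst).length ≤ 1 then 1 else cycW ρ (l.map Prod.fst)) *
        ENNReal.ofReal (Real.exp (-weightedTime δ l)) := by
  rw [Loop.tilt, sum_mul_occ]
  congr 1
  simp_rw [N_coe]
  split_ifs with h
  · simp
  · have h0 : l.map Prod.fst ≠ [] := by
      intro h0
      simp [h0] at h
    rw [← prod_map_wordSteps ρ h0]
    exact prod_pow_count (fun p : X × X => ρ p.1 p.2) _

/-- The tilt multiplies each conductance $C$ along the loop by $\rho$ and each factor $e^{-\lambda
t}$ by $e^{-\delta t}$. It is thus the density between the two loop measures; trivial loops make no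
jump and see only $\delta$. -/
theorem lintegral_tilt_mul {S₀ S : Finset X} (hS : S₀ ⊆ S) {C C' ρ : X → X → ℝ≥0∞} {lam lam' δ : X → ℝ}
    (hC : ∀ x y, C x y ≠ 0 → y ∈ S) (hC' : ∀ x y, C' x y = ρ x y * C x y)
    (hlam : ∀ x ∈ S, lam' x = lam x + δ x) {f : Loop X → ℝ≥0∞} (hf : Measurable f) :
    ∫⁻ l, Loop.tilt ρ δ l * f l ∂wordLoops S₀ C lam = ∫⁻ l, f l ∂wordLoops S₀ C' lam' := by
  have hm : Measurable fun l => Loop.tilt ρ δ l * f l := (measurable_tilt ρ δ).mul hf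
  obtain rfl : C' = fun x y => ρ x y * C x y := funext fun x => funext fun y => hC' x y
  rw [lintegral_wordLoops _ _ _ hm, lintegral_wordLoops _ _ _ hf]
  congr 1
  · refine Finset.sum_congr rfl fun x hx => ?_
    have hfx := hf.fun_comp (measurable_coe_singleton x)
    have h1 : ∀ t, Loop.tilt ρ δ (([(x, t)] : List (X × ℝ)) : Loop X) =
        ENNReal.ofReal (Real.exp (-(δ x * t))) := by
      intro t
      rw [tilt_coe]
      simp [weightedTime]
    simp_rw [h1]
    have hme : Measurable fun t : ℝ => ENNReal.ofReal (Real.exp (-(δ x * t))) := by fun_prop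
    rw [lintegral_trivM _ (hme.fun_mul hfx), lintegral_trivM _ hfx]
    refine setLIntegral_congr_fun measurableSet_Ioi fun t ht => ?_
    rw [← mul_assoc, ← ENNReal.ofReal_mul (div_nonneg (Real.exp_nonneg _) (le_of_lt ht)), hlam x (hS hx),
      div_mul_eq_mul_div, ← Real.exp_add]
    congr 4
    ring
  · refine tsum_congr fun w => ?_
    rw [loopW_mul]
    by_cases h0 : loopW C w = 0
    · simp [h0]
    have hw := loopW_support hC h0
    have hfl := measurable_loop_iff.mp hf
    rw [mul_comm (cycW ρ w), mul_assoc]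
    congr 1
    rw [wordM_congr (lam := lam') (lam' := fun x => lam x + δ x) fun x hx => hlam x (hw.2 x hx),
      ← lintegral_wordM_exp_weightedTime lam δ w hfl]
    have hmw : Measurable fun l : List (X × ℝ) => ENNReal.ofReal (Real.exp (-weightedTime δ l)) *
        f (l : Loop X) :=
      (ENNReal.measurable_ofReal.comp (Real.measurable_exp.comp
        (measurable_weightedTime δ).neg)).mul hfl
    rw [← lintegral_const_mul _ hmw]
    refine lintegral_congr_ae ?_
    filter_upwards [ae_wordM_map_fst lam w] with l hl
    rw [tilt_coe, hl, if_neg (by omega), mul_assoc]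

/-- Non trivial loops without their holding times: a change of the masses is a change of the
conductances. -/
theorem lintegral_tilt_discrete {S₀ S : Finset X} (hS : S₀ ⊆ S) {C : X → X → ℝ≥0∞} {lam lam' : X → ℝ}
    (hC : ∀ x y, C x y ≠ 0 → y ∈ S) (hl : ∀ x ∈ S, 0 < lam x) (hl' : ∀ x ∈ S, 0 < lam' x)
    (ρ : X → X → ℝ≥0∞) {δ : X → ℝ} (hlam : ∀ x ∈ S, lam' x = lam x + δ x)
    (φ : Cycle X → ℝ≥0∞) (hφ : ∀ c, c.length ≤ 1 → φ c = 0) :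
    ∫⁻ l, Loop.tilt ρ δ l * φ l.discrete ∂wordLoops S₀ C lam =
      ∫⁻ l, Loop.tilt (fun x y => ρ x y * ENNReal.ofReal (lam x / lam' x)) 0 l * φ l.discrete
        ∂wordLoops S₀ C lam := by
  have hfm : Measurable fun l : Loop X => φ l.discrete := by
    rw [measurable_loop_iff]
    exact measurable_of_map_fst (fun w : List X => φ w)
  rw [lintegral_tilt_mul hS hC (C' := fun x y => ρ x y * C x y) (fun x y => rfl) hlam hfm,
    lintegral_tilt_mul hS hC
      (C' := fun x y => ρ x y * ENNReal.ofReal (lam x / lam' x) * C x y) (lam' := lam)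
      (fun x y => rfl) (by simp) hfm, lintegral_wordLoops _ _ _ hfm, lintegral_wordLoops _ _ _ hfm]
  have hd : ∀ l : List (X × ℝ), Loop.discrete (l : Loop X) = ((l.map Prod.fst : List X) : Cycle X) :=
    fun l => rfl
  congr 1
  · refine Finset.sum_congr rfl fun x hx => ?_
    simp [hd, hφ]
  · refine tsum_congr fun w => ?_
    simp only [hd]
    rw [loopW_mul, loopW_mul]
    by_cases h0 : loopW C w = 0
    · simp [h0]
    have hw := loopW_support hC h0
    have hne : w ≠ [] := by
      rintro rfl
      simp at hw
    rw [lintegral_wordM_map_fst (w := w) (fun x hx => hl' x (hw.2 x hx)) fun w => φ w,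
      lintegral_wordM_map_fst (w := w) (fun x hx => hl x (hw.2 x hx)) fun w => φ w,
      cycW_mul, cycW_left _ hne]
    -- The integrated holding times give $\prod1/\lambda'_{x}$ over the points of the word. As each
    -- point has one outgoing jump, the ratio to $\prod1/\lambda_x$ can be charged to the
    -- conductances.
    have hp : (w.map fun x => ENNReal.ofReal (lam' x)⁻¹).prod =
        (w.map fun x => ENNReal.ofReal (lam x / lam' x)).prod *
          (w.map fun x => ENNReal.ofReal (lam x)⁻¹).prod := by
      rw [← List.prod_map_mul]
      congr 1
      refine List.map_congr_left fun x hx => ?_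
      have h1 := hl x (hw.2 x hx)
      rw [← ENNReal.ofReal_mul (div_pos h1 (hl' x (hw.2 x hx))).le]
      congr 1
      field_simp
    rw [hp]
    ring

end WordSteps

/-! ### Multiplicative functionals -/

theorem ep_ofReal_mul {α : ℝ} (hα : 0 < α) (a : ℝ≥0∞) : ep (ENNReal.ofReal α * a) = ep a ^ α := by
  by_cases ha : a = ∞
  · rw [ha, ENNReal.mul_top (by simpa using hα), ep_top, ENNReal.top_rpow_of_pos hα]
  · rw [← ENNReal.ofReal_toReal ha, ← ENNReal.ofReal_mul hα.le, ep_ofReal ENNReal.toReal_nonneg,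
      ep_ofReal (mul_nonneg hα.le ENNReal.toReal_nonneg),
      ENNReal.ofReal_rpow_of_pos (Real.exp_pos _), ← Real.exp_mul, mul_comm]

theorem ep_ne_top {a : ℝ≥0∞} (ha : a ≠ ∞) : ep a ≠ ∞ := fun h => ha (ep_eq_top_iff.mp h)

theorem inv_ep_add (a b : ℝ≥0∞) : (ep (a + b))⁻¹ = (ep a)⁻¹ * (ep b)⁻¹ := by
  rw [ep_add, ENNReal.mul_inv (Or.inl (ep_ne_zero a)) (Or.inr (ep_ne_zero b))]

/-- This is $e^{a-b}=e^{c-d}$ without subtraction. The negative exponents $b$ and $d$ may be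
infinite, but then both are, and both sides vanish. -/
theorem ep_mul_inv_eq_of_add_eq {a b c d : ℝ≥0∞} (ha : a ≠ ∞) (hc : c ≠ ∞) (h : a + d = c + b) :
    ep a * (ep b)⁻¹ = ep c * (ep d)⁻¹ := by
  by_cases hb : b = ∞
  · have hd : d = ∞ := by
      by_contra hd
      rw [hb, add_top] at h
      exact ENNReal.add_ne_top.mpr ⟨ha, hd⟩ h
    rw [hb, hd, ep_top, ENNReal.inv_top, mul_zero, mul_zero]
  · have hd : d ≠ ∞ := by
      intro hd
      rw [hd, add_top] at h
      exact ENNReal.add_ne_top.mpr ⟨hc, hb⟩ h.symm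
    have h1 : ep a * ep d = ep c * ep b := by rw [← ep_add, ← ep_add, h]
    rw [← div_eq_mul_inv, ← div_eq_mul_inv, ENNReal.div_eq_div_iff (ep_ne_zero d) (ep_ne_top hd)
      (ep_ne_zero b) (ep_ne_top hb), mul_comm (ep d), h1, mul_comm]

section ExpDiff

variable {S S' : Type*} [MeasurableSpace S] [MeasurableSpace S']

/-- `exp (∫ (F - 1) dm)`, where the positive and the negative part of `F - 1` are integrated
separately; this is the expectation of the product of `F` over a Poisson process of intensity `m`. -/
def expDiff (m : Measure S) (F : S → ℝ≥0∞) : ℝ≥0∞ :=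
  ep (∫⁻ s, (F s - 1) ∂m) * (ep (∫⁻ s, (1 - F s) ∂m))⁻¹

theorem expDiff_one (m : Measure S) : expDiff m (fun _ => 1) = 1 := by simp [expDiff]

theorem expDiff_zero_measure (F : S → ℝ≥0∞) : expDiff (0 : Measure S) F = 1 := by simp [expDiff]

theorem expDiff_congr_ae {m : Measure S} {F G : S → ℝ≥0∞} (h : F =ᵐ[m] G) :
    expDiff m F = expDiff m G := by
  unfold expDiff
  congr 2
  · exact lintegral_congr_ae (h.mono fun s hs => by simp only [hs])
  · congr 1
    exact lintegral_congr_ae (h.mono fun s hs => by simp only [hs])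

theorem expDiff_add (m m' : Measure S) (F : S → ℝ≥0∞) :
    expDiff (m + m') F = expDiff m F * expDiff m' F := by
  unfold expDiff
  rw [lintegral_add_measure, lintegral_add_measure, ep_add, inv_ep_add]
  ring

theorem expDiff_finsetSum {ι : Type*} (s : Finset ι) (m : ι → Measure S) (F : S → ℝ≥0∞) :
    expDiff (∑ i ∈ s, m i) F = ∏ i ∈ s, expDiff (m i) F := by
  classical
  induction s using Finset.induction_on with
  | empty => simp [expDiff_zero_measure]
  | insert i s hi ih => rw [Finset.sum_insert hi, Finset.prod_insert hi, expDiff_add, ih]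

theorem expDiff_map (m : Measure S) {τ : S → S'} (hτ : Measurable τ) {F : S' → ℝ≥0∞}
    (hF : Measurable F) : expDiff (m.map τ) F = expDiff m fun s => F (τ s) := by
  unfold expDiff
  have h1 : Measurable fun s => F s - 1 := hF.sub_const 1
  have h2 : Measurable fun s => 1 - F s := measurable_const.sub hF
  rw [lintegral_map h1 hτ, lintegral_map h2 hτ]

theorem expDiff_smul (m : Measure S) {α : ℝ} (hα : 0 < α) (F : S → ℝ≥0∞) :
    expDiff (ENNReal.ofReal α • m) F = expDiff m F ^ α := by
  unfold expDiff
  rw [lintegral_smul_measure, lintegral_smul_measure, smul_eq_mul, smul_eq_mul, ep_ofReal_mul hα,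
    ep_ofReal_mul hα, ENNReal.mul_rpow_of_nonneg _ _ hα.le, ENNReal.inv_rpow]

theorem expDiff_restrict (m : Measure S) {A : Set S} (hA : MeasurableSet A) (F : S → ℝ≥0∞) :
    expDiff m F = expDiff (m.restrict A) F * expDiff (m.restrict Aᶜ) F := by
  rw [← expDiff_add, Measure.restrict_add_restrict_compl hA]

theorem lintegral_sub_one_add (m : Measure S) {F : S → ℝ≥0∞} (hF : Measurable F) :
    ∫⁻ s, F s ∂m + ∫⁻ s, (1 - F s) ∂m = m Set.univ + ∫⁻ s, (F s - 1) ∂m := by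
  rw [← lintegral_one, ← lintegral_add_left hF, ← lintegral_add_left measurable_const]
  refine lintegral_congr fun s => ?_
  rcases le_total (F s) 1 with h | h
  · rw [add_tsub_cancel_of_le h, tsub_eq_zero_of_le h, add_zero]
  · rw [add_tsub_cancel_of_le h, tsub_eq_zero_of_le h, add_zero]

theorem expDiff_of_finite (m : Measure S) [IsFiniteMeasure m] {F : S → ℝ≥0∞} (hF : Measurable F)
    (hfin : ∫⁻ s, F s ∂m ≠ ∞) :
    expDiff m F = ep (∫⁻ s, F s ∂m) * (ep (m Set.univ))⁻¹ := by
  refine ep_mul_inv_eq_of_add_eq ?_ hfin ?_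
  · exact ne_top_of_le_ne_top hfin (lintegral_mono fun s => tsub_le_self)
  · rw [lintegral_sub_one_add m hF, add_comm]

/-- Two densities `h` and `k` which agree after conditioning on `τ` have the same functional, after
multiplication by a function of `τ`. -/
theorem expDiff_eq_of_lintegral_eq {m : Measure S} {τ : S → S'} (hτ : Measurable τ)
    {h k : S → ℝ≥0∞} (hh : Measurable h) (hk : Measurable k)
    (heq : ∀ φ : S' → ℝ≥0∞, Measurable φ → ∫⁻ s, h s * φ (τ s) ∂m = ∫⁻ s, k s * φ (τ s) ∂m)
    {n : S' → ℕ} (hn : Measurable n)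
    (hm : ∀ j, m {s | n (τ s) = j} ≠ ∞) (hhn : ∀ j, ∫⁻ s in {s | n (τ s) = j}, h s ∂m ≠ ∞)
    {T : S' → ℝ≥0∞} (hT : Measurable T) (hT1 : ∀ s, T s ≤ 1)
    (hhfin : ∫⁻ s, (h s - 1) ∂m ≠ ∞) (hkfin : ∫⁻ s, (k s - 1) ∂m ≠ ∞) :
    expDiff m (fun s => h s * T (τ s)) = expDiff m (fun s => k s * T (τ s)) := by
  have hTτ : Measurable fun s => T (τ s) := hT.comp hτ
  have hle : ∀ (g : S → ℝ≥0∞), ∫⁻ s, (g s - 1) ∂m ≠ ∞ → ∫⁻ s, (g s * T (τ s) - 1) ∂m ≠ ∞ :=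
    fun g hg => ne_top_of_le_ne_top hg (lintegral_mono fun s =>
      tsub_le_tsub_right (mul_le_of_le_one_right' (hT1 _)) 1)
  refine ep_mul_inv_eq_of_add_eq (hle h hhfin) (hle k hkfin) ?_
  have hA : ∀ j, MeasurableSet {s | n (τ s) = j} := fun j =>
    (hn.comp hτ) (measurableSet_singleton j)
  -- The truncations $(f-1)^+$ and $(1-f)^+$ are not linear in the density, but
  -- $f+(1-f)^+=1+(f-1)^+$. On a level set of finite mass this converts equality of the integrals of
  -- $hT$ and $kT$ into the required balance, and the level sets are then summed.
  have hcov : ∀ (f : S → ℝ≥0∞), ∫⁻ s, f s ∂m = ∑' j, ∫⁻ s in {s | n (τ s) = j}, f s ∂m := by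
    intro f
    rw [← lintegral_iUnion hA]
    · have : (⋃ j, {s | n (τ s) = j}) = Set.univ := by
        ext s
        simp
      rw [this, setLIntegral_univ]
    · intro i j hij
      exact Set.disjoint_left.mpr fun s hs hs' => hij (hs.symm.trans hs')
  rw [hcov, hcov fun s => 1 - k s * T (τ s), hcov fun s => k s * T (τ s) - 1,
    hcov fun s => 1 - h s * T (τ s), ← ENNReal.tsum_add, ← ENNReal.tsum_add]
  refine tsum_congr fun j => ?_
  have hhT : Measurable fun s => h s * T (τ s) := hh.mul hTτ
  have hkT : Measurable fun s => k s * T (τ s) := hk.mul hTτ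
  have h1 := lintegral_sub_one_add (m.restrict {s | n (τ s) = j}) hhT
  have h2 := lintegral_sub_one_add (m.restrict {s | n (τ s) = j}) hkT
  have hS : MeasurableSet {s' | n s' = j} := hn (measurableSet_singleton j)
  have h3 : ∫⁻ s in {s | n (τ s) = j}, h s * T (τ s) ∂m =
      ∫⁻ s in {s | n (τ s) = j}, k s * T (τ s) ∂m := by
    have h4 := heq ({s' | n s' = j}.indicator T) (hT.indicator hS)
    rw [← lintegral_indicator (hA j), ← lintegral_indicator (hA j)]
    refine Eq.trans (lintegral_congr fun s => ?_) (h4.trans (lintegral_congr fun s => ?_))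
    · by_cases hs : n (τ s) = j <;> simp [Set.indicator, hs]
    · by_cases hs : n (τ s) = j <;> simp [Set.indicator, hs]
  have h5 : ∫⁻ s in {s | n (τ s) = j}, h s * T (τ s) ∂m ≠ ∞ :=
    ne_top_of_le_ne_top (hhn j) (lintegral_mono fun s => mul_le_of_le_one_right' (hT1 _))
  rw [← h3] at h2
  rw [Measure.restrict_apply_univ] at h1 h2
  -- Finiteness on the level set allows the quantity $\int hT+m$ to be added to both sides and
  -- cancelled.
  have h6 := ENNReal.add_ne_top.mpr ⟨h5, hm j⟩
  refine (ENNReal.add_right_inj h6).mp ?_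
  calc _ = (∫⁻ s in {s | n (τ s) = j}, h s * T (τ s) ∂m +
        ∫⁻ s in {s | n (τ s) = j}, (1 - k s * T (τ s)) ∂m) +
        (m {s | n (τ s) = j} + ∫⁻ s in {s | n (τ s) = j}, (h s * T (τ s) - 1) ∂m) := by ring
    _ = _ := by
      rw [h2, ← h1]
      ring

end ExpDiff

/-! ### Products over a Poisson process -/

namespace IsPoissonProcess

variable {Ω S : Type*} [MeasurableSpace Ω] [MeasurableSpace S] {P : Measure Ω} {ν : Measure S}
  {L : Ω → Set S}

theorem lintegral_encard (hL : IsPoissonProcess P ν L) [IsProbabilityMeasure P] {B : Set S}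
    (hB : MeasurableSet B) : ∫⁻ ω, ((L ω ∩ B).encard : ℝ≥0∞) ∂P = ν B := by
  by_cases hν : ν B = ∞
  · rw [hν]
    have h : ∀ᵐ ω ∂P, ((L ω ∩ B).encard : ℝ≥0∞) = ∞ := by
      filter_upwards [hL.law_top B hB hν] with ω hω
      rw [hω, ENat.toENNReal_top]
    rw [lintegral_congr_ae h]
    simp
  · rw [hL.lintegral_count hB hν fun n => (n : ℝ≥0∞), lintegral_countable']
    set r := (ν B).toNNReal
    have h1 : ∀ k : ℕ, (((k + 1 : ℕ) : ℕ∞) : ℝ≥0∞) * poissonMeasure r {k + 1} =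
        r * poissonMeasure r {k} := by
      intro k
      rw [poissonMeasure_singleton, poissonMeasure_singleton, ENat.toENNReal_coe,
        ← ENNReal.ofReal_natCast, ← ENNReal.ofReal_coe_nnreal,
        ← ENNReal.ofReal_mul (Nat.cast_nonneg _), ← ENNReal.ofReal_mul r.coe_nonneg]
      congr 1
      rw [Nat.factorial_succ]
      push_cast
      field_simp
      ring
    rw [tsum_eq_zero_add' ENNReal.summable]
    simp_rw [h1]
    have h2 : ∑' k : ℕ, poissonMeasure r {k} = 1 := by
      have h3 := lintegral_countable' (μ := poissonMeasure r) (fun _ : ℕ => (1 : ℝ≥0∞))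
      simpa using h3.symm
    rw [ENNReal.tsum_mul_left, h2, mul_one]
    simp [r, ENNReal.coe_toNNReal hν]

/-- Campbell's formula: the mean of the random counting measure is a measure that agrees with the
intensity on every measurable set. -/
theorem lintegral_lintegral (hL : IsPoissonProcess P ν L) [IsProbabilityMeasure P]
    {u : S → ℝ≥0∞} (hu : Measurable u) :
    ∫⁻ ω, ∫⁻ s, u s ∂pointMeasure (L ω) id ∂P = ∫⁻ s, u s ∂ν := by
  have hm : Measurable fun ω => pointMeasure (L ω) (id : S → S) := by
    refine Measure.measurable_of_measurable_coe _ fun B hB => ?_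
    simp_rw [pointMeasure_apply _ _ hB]
    exact measurable_natCast_toENNReal.comp (hL.measurable_count B hB)
  have h : P.bind (fun ω => pointMeasure (L ω) (id : S → S)) = ν := by
    ext B hB
    rw [Measure.bind_apply hB hm.aemeasurable]
    simp_rw [pointMeasure_apply _ _ hB]
    exact hL.lintegral_encard hB
  rw [← h, Measure.lintegral_bind hm.aemeasurable hu.aemeasurable]

theorem ae_lintegral_ne_top (hL : IsPoissonProcess P ν L) [IsProbabilityMeasure P]
    {u : S → ℝ≥0∞} (hu : Measurable u) (hfin : ∫⁻ s, u s ∂ν ≠ ∞) :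
    ∀ᵐ ω ∂P, ∫⁻ s, u s ∂pointMeasure (L ω) id ≠ ∞ := by
  filter_upwards [ae_lt_top (hL.measurable_lintegral hu) (hL.lintegral_lintegral hu ▸ hfin)]
    with ω hω using hω.ne

/-- The exponents $a$ and $b$ may overlap, so they are replaced by the positive and negative parts
of $\log F=a-b$, to which the Laplace functional applies. Almost surely the sum of $a$ over the
process is finite, which makes the replacement legitimate for each outcome. -/
theorem lintegral_prod (hL : IsPoissonProcess P ν L) [IsProbabilityMeasure P]
    {a b : S → ℝ≥0∞} (ha : Measurable a) (hb : Measurable b) (htop : ∀ s, a s ≠ ∞)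
    (hafin : ∫⁻ s, a s ∂ν ≠ ∞) (hfin : ∫⁻ s, (ep (a s) * (ep (b s))⁻¹ - 1) ∂ν ≠ ∞) :
    ∫⁻ ω, ep (∫⁻ s, a s ∂pointMeasure (L ω) id) * (ep (∫⁻ s, b s ∂pointMeasure (L ω) id))⁻¹ ∂P =
      expDiff ν fun s => ep (a s) * (ep (b s))⁻¹ := by
  set F : S → ℝ≥0∞ := fun s => ep (a s) * (ep (b s))⁻¹ with hF
  have hFm : Measurable F := (measurable_ep.comp ha).mul (measurable_ep.comp hb).inv
  have hu : Measurable fun s => lp (F s) := measurable_lp.comp hFm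
  have hv : Measurable fun s => lp (F s)⁻¹ := measurable_lp.comp hFm.inv
  have h1 : ∀ s, ep (lp (F s)) - 1 = F s - 1 := by
    intro s
    rw [ep_lp]
    rcases le_total (F s) 1 with h | h
    · rw [max_eq_left h, tsub_self, tsub_eq_zero_of_le h]
    · rw [max_eq_right h]
  have h2 : ∀ s, 1 - (ep (lp (F s)⁻¹))⁻¹ = 1 - F s := by
    intro s
    rw [inv_ep_lp_inv]
    rcases le_total (F s) 1 with h | h
    · rw [min_eq_right h]
    · rw [min_eq_left h, tsub_self, tsub_eq_zero_of_le h]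
  have h3 := hL.laplace hu hv (fun s => lp_eq_zero_or _) (by simp_rw [h1]; exact hfin)
  simp_rw [h1, h2] at h3
  rw [expDiff, ← h3]
  refine lintegral_congr_ae ?_
  filter_upwards [hL.ae_lintegral_ne_top ha hafin] with ω hω
  refine ep_mul_inv_eq_of_add_eq hω ?_ ?_
  · exact ne_top_of_le_ne_top hω (lintegral_mono fun s => lp_ep_mul_inv_le _ _)
  · rw [← lintegral_add_left ha, ← lintegral_add_left hu]
    exact lintegral_congr fun s => by rw [add_comm, lp_add_eq (htop s)]

end IsPoissonProcess

/-! ### The functionals of the loop measures -/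

/-- Frullani's integral; integrability follows from $(e^{-at}-e^{-bt})/t\le(b-a)e^{-at}$. -/
theorem lintegral_exp_sub_div {a b : ℝ} (ha : 0 < a) (hab : a ≤ b) :
    ∫⁻ t in Set.Ioi 0, ENNReal.ofReal ((Real.exp (-(a * t)) - Real.exp (-(b * t))) / t) =
      ENNReal.ofReal (Real.log (b / a)) := by
  have hb : 0 < b := ha.trans_le hab
  have hnn : ∀ t ∈ Set.Ioi (0 : ℝ), 0 ≤ (Real.exp (-(a * t)) - Real.exp (-(b * t))) / t := by
    intro t ht
    refine div_nonneg (sub_nonneg.mpr (Real.exp_le_exp.mpr ?_)) (le_of_lt ht)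
    exact neg_le_neg (mul_le_mul_of_nonneg_right hab (le_of_lt ht))
  have hint : IntegrableOn (fun t => (Real.exp (-(a * t)) - Real.exp (-(b * t))) / t)
      (Set.Ioi 0) := by
    have hdom : IntegrableOn (fun t => (b - a) * Real.exp (-a * t)) (Set.Ioi 0) :=
      (integrableOn_exp_mul_Ioi (neg_lt_zero.mpr ha) 0).const_mul _
    refine Integrable.mono' hdom ?_ ?_
    · exact (Measurable.div (by fun_prop) measurable_id).aestronglyMeasurable
    · refine (ae_restrict_iff' measurableSet_Ioi).mpr (Filter.Eventually.of_forall fun t ht => ?_)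
      have ht' : 0 < t := ht
      rw [Real.norm_of_nonneg (hnn t ht), div_le_iff₀ ht']
      have h1 : Real.exp (-(b * t)) = Real.exp (-a * t) * Real.exp (-((b - a) * t)) := by
        rw [← Real.exp_add]
        congr 1
        ring
      have h2 := Real.one_sub_le_exp_neg ((b - a) * t)
      have h3 := Real.exp_pos (-a * t)
      rw [h1, neg_mul]
      rw [neg_mul] at h3
      nlinarith
  have hf : LocallyIntegrableOn (fun x : ℝ => Real.exp (-x)) (Set.Ioi 0) :=
    (by fun_prop : Continuous fun x : ℝ => Real.exp (-x)).locallyIntegrable.locallyIntegrableOn _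
  have hL : Filter.Tendsto (fun x : ℝ => Real.exp (-x)) (nhdsWithin 0 (Set.Ioi 0)) (nhds 1) := by
    have h : Filter.Tendsto (fun x : ℝ => Real.exp (-x)) (nhds 0) (nhds (Real.exp (-0))) :=
      (by fun_prop : Continuous fun x : ℝ => Real.exp (-x)).tendsto 0
    rw [neg_zero, Real.exp_zero] at h
    exact h.mono_left nhdsWithin_le_nhds
  have heq : ∀ t, (t⁻¹ : ℝ) • (Real.exp (-(a * t)) - Real.exp (-(b * t))) =
      (Real.exp (-(a * t)) - Real.exp (-(b * t))) / t := fun t => by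
    rw [smul_eq_mul, div_eq_inv_mul]
  have h := Frullani.integral_Ioi_eq hf ha hb hL Real.tendsto_exp_neg_atTop_nhds_zero
    (by simpa only [heq] using hint)
  simp only [heq, sub_zero, smul_eq_mul, mul_one] at h
  rw [← h, ofReal_integral_eq_lintegral_ofReal hint]
  exact (ae_restrict_iff' measurableSet_Ioi).mpr (Filter.Eventually.of_forall hnn)

theorem lintegral_trivM_exp_sub_one {a δ : ℝ} (ha : 0 < a) (hδ : 0 < a + δ) :
    ∫⁻ t, (ENNReal.ofReal (Real.exp (-(δ * t))) - 1) ∂trivM a =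
      ENNReal.ofReal (Real.log (a / (a + δ))) := by
  rw [lintegral_trivM _ (by fun_prop)]
  rcases le_total δ 0 with h | h
  · rw [← lintegral_exp_sub_div hδ (by linarith : a + δ ≤ a)]
    refine setLIntegral_congr_fun measurableSet_Ioi fun t ht => ?_
    have ht' : (0 : ℝ) < t := ht
    rw [← ENNReal.ofReal_one, ← ENNReal.ofReal_sub _ zero_le_one, ← ENNReal.ofReal_mul (by positivity),
      div_mul_eq_mul_div, mul_sub, ← Real.exp_add]
    congr 3
    · congr 1
      ring
    · ring
  · rw [ENNReal.ofReal_of_nonpos]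
    · rw [lintegral_eq_zero_iff (by fun_prop)]
      refine (ae_restrict_iff' measurableSet_Ioi).mpr (Filter.Eventually.of_forall fun t ht => ?_)
      have ht' : (0 : ℝ) < t := ht
      have h1 : ENNReal.ofReal (Real.exp (-(δ * t))) ≤ 1 := by
        rw [ENNReal.ofReal_le_one, Real.exp_le_one_iff]
        nlinarith
      simp [tsub_eq_zero_of_le h1]
    · exact Real.log_nonpos (div_pos ha hδ).le ((div_le_one hδ).mpr (by linarith))

theorem lintegral_trivM_one_sub_exp {a δ : ℝ} (ha : 0 < a) (hδ : 0 < a + δ) :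
    ∫⁻ t, (1 - ENNReal.ofReal (Real.exp (-(δ * t)))) ∂trivM a =
      ENNReal.ofReal (Real.log ((a + δ) / a)) := by
  rw [lintegral_trivM _ (by fun_prop)]
  rcases le_total 0 δ with h | h
  · rw [← lintegral_exp_sub_div ha (by linarith : a ≤ a + δ)]
    refine setLIntegral_congr_fun measurableSet_Ioi fun t ht => ?_
    have ht' : (0 : ℝ) < t := ht
    rw [← ENNReal.ofReal_one, ← ENNReal.ofReal_sub _ (Real.exp_nonneg _),
      ← ENNReal.ofReal_mul (by positivity), div_mul_eq_mul_div, mul_sub, ← Real.exp_add]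
    congr 3
    · ring
    · congr 1
      ring
  · rw [ENNReal.ofReal_of_nonpos]
    · rw [lintegral_eq_zero_iff (by fun_prop)]
      refine (ae_restrict_iff' measurableSet_Ioi).mpr (Filter.Eventually.of_forall fun t ht => ?_)
      have ht' : (0 : ℝ) < t := ht
      have h1 : 1 ≤ ENNReal.ofReal (Real.exp (-(δ * t))) := by
        rw [ENNReal.one_le_ofReal, Real.one_le_exp_iff]
        nlinarith
      simp [tsub_eq_zero_of_le h1]
    · exact Real.log_nonpos (div_pos hδ ha).le ((div_le_one ha).mpr (by linarith))

/-- According to the sign of $\delta$, one of the two parts of $e^{-\delta t}-1$ vanishes and the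
other has Frullani's integral as its mass. The result is the same in both cases. -/
theorem expDiff_trivM {a δ : ℝ} (ha : 0 < a) (hδ : 0 < a + δ) :
    expDiff (trivM a) (fun t => ENNReal.ofReal (Real.exp (-(δ * t)))) =
      ENNReal.ofReal (a / (a + δ)) := by
  have h1 : 0 < a / (a + δ) := div_pos ha hδ
  rw [expDiff, lintegral_trivM_exp_sub_one ha hδ, lintegral_trivM_one_sub_exp ha hδ,
    ← inv_div a (a + δ), Real.log_inv]
  rcases le_total 0 (Real.log (a / (a + δ))) with h | h
  · rw [ENNReal.ofReal_of_nonpos (neg_nonpos.mpr h), ep_zero, inv_one, mul_one, ep_ofReal h,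
      Real.exp_log h1]
  · rw [ENNReal.ofReal_of_nonpos h, ep_zero, one_mul, ep_ofReal (neg_nonneg.mpr h), Real.exp_neg,
      Real.exp_log h1, ENNReal.ofReal_inv_of_pos h1, inv_inv]

section

variable {X : Type*}

/-- The loop measure is the sum of the measure on trivial loops and of the measure on non trivial
loops. -/
theorem wordLoops_eq_add (S : Finset X) (C : X → X → ℝ≥0∞) (lam : X → ℝ) :
    wordLoops S C lam =
      (∑ x ∈ S, (trivM (lam x)).map fun t => ((([(x, t)] : List (X × ℝ))) : Loop X)) +
        wordLoops ∅ C lam := by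
  simp [wordLoops]

theorem lintegral_wordLoops_empty [Countable X] (C : X → X → ℝ≥0∞) (lam : X → ℝ)
    {g : Loop X → ℝ≥0∞} (hg : Measurable g) :
    ∫⁻ l, g l ∂wordLoops ∅ C lam = ∑' w, loopW C w * ∫⁻ l, g (l : Loop X) ∂wordM lam w := by
  rw [lintegral_wordLoops _ _ _ hg, Finset.sum_empty, zero_add]

variable [Fintype X]

theorem measurable_length : Measurable (Cycle.length : Loop X → ℕ) := by
  rw [measurable_loop_iff]
  have h : ∀ l : List (X × ℝ), Cycle.length (l : Loop X) = (l.map Prod.fst).length :=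
    fun l => by simp
  simp_rw [h]
  exact measurable_of_map_fst (fun w : List X => w.length)

theorem ae_wordLoops_empty (C : X → X → ℝ≥0∞) (lam : X → ℝ) :
    ∀ᵐ l ∂wordLoops ∅ C lam, 2 ≤ Cycle.length l := by
  refine ae_wordLoops (measurable_length (measurableSet_Ici (a := 2))) (by simp) fun l _ hw => ?_
  unfold loopW at hw
  split_ifs at hw with h
  · simpa using h
  · exact absurd rfl hw

variable [DecidableEq X]

/-- Conductances and masses of a transient chain on `S`. -/
structure IsTransient (S : Finset X) (C : X → X → ℝ≥0∞) (lam : X → ℝ) : Prop where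
  mem : ∀ x y, C x y ≠ 0 → y ∈ S
  diag : ∀ x, C x x = 0
  pos : ∀ x ∈ S, 0 < lam x
  path_ne_top : ∀ x ∈ S, pathM C lam x x Set.univ ≠ ∞

theorem Energy.isTransient (e : Energy X) : IsTransient Finset.univ e.Cw e.lam where
  mem _ _ _ := Finset.mem_univ _
  diag x := by simp [Energy.Cw, e.C_diag]
  pos x _ := e.lam_pos' x
  path_ne_top x _ := pathM_univ_ne_top e x x

theorem Energy.isTransient_trace (e : Energy X) (F : Finset X) :
    IsTransient F (e.traceCw F) (e.traceLam F) where
  mem _ _ h := (traceCw_ne_zero e h).2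
  diag x := by simp [Energy.traceCw, Energy.traceC]
  pos x hx := traceLam_pos e hx
  path_ne_top x hx := by
    rw [← traceM_eq_pathM e hx x hx]
    exact measure_ne_top _ _

namespace IsTransient

variable {S : Finset X} {C : X → X → ℝ≥0∞} {lam : X → ℝ}

/-- The number of points of a non trivial loop is integrable. -/
theorem lintegral_length_ne_top (h : IsTransient S C lam) :
    ∫⁻ l, (Cycle.length l : ℝ≥0∞) ∂wordLoops ∅ C lam ≠ ∞ := by
  obtain ⟨hC, -, hlam, hpath⟩ := h
  have hm : Measurable fun l : Loop X => (Cycle.length l : ℝ≥0∞) :=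
    (measurable_of_countable fun n : ℕ => (n : ℝ≥0∞)).comp measurable_length
  set M : List X → ℝ≥0∞ := fun w => (w.map fun x => ENNReal.ofReal (lam x)⁻¹).prod with hM
  have hmass : ∀ w, (∀ x ∈ w, x ∈ S) → wordM lam w Set.univ = M w := by
    intro w hw
    rw [← lintegral_one, lintegral_wordM_map_fst (w := w) (fun x hx => hlam x (hw x hx)) fun _ => 1,
      one_mul]
  -- The length cancels the factor $1/p$. A cyclic word based at $x$ is a closed path from $x$
  -- deprived of its last holding time, whose mass $1/\lambda_x$ accounts for the factor
  -- $\lambda_x$.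
  refine ne_top_of_le_ne_top (b := ∑ x ∈ S, ENNReal.ofReal (lam x) * pathM C lam x x Set.univ)
    (ENNReal.sum_ne_top.mpr fun x hx => ENNReal.mul_ne_top ENNReal.ofReal_ne_top (hpath x hx)) ?_
  have h1 : ∫⁻ l, (Cycle.length l : ℝ≥0∞) ∂wordLoops ∅ C lam ≤ ∑' w, cycW C w * M w := by
    rw [lintegral_wordLoops_empty _ _ hm]
    refine ENNReal.tsum_le_tsum fun w => ?_
    by_cases h0 : loopW C w = 0
    · simp [h0]
    have hw := loopW_support hC h0
    have h2 : ∀ l : List (X × ℝ), (Cycle.length (l : Loop X) : ℝ≥0∞) = ((l.map Prod.fst).length : ℕ) :=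
      fun l => by simp
    simp_rw [h2]
    rw [lintegral_wordM_map_fst (w := w) (fun x hx => hlam x (hw.2 x hx)) fun w => (w.length : ℝ≥0∞),
      ← mul_assoc]
    refine mul_le_mul_left (le_of_eq ?_) _
    rw [loopW, if_pos hw.1]
    exact ENNReal.div_mul_cancel (by simp; rintro rfl; simp at hw) (by simp)
  refine h1.trans ?_
  rw [tsum_list_cons, cycW, zero_mul, zero_add, ← Finset.sum_subset (Finset.subset_univ S)]
  · refine Finset.sum_le_sum fun x hx => ?_
    have h3 : ∑' w, cycW C (x :: w) * M (x :: w) = ENNReal.ofReal (lam x) *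
        ∑' w, pathW C x x (w ++ [x]) * wordM lam (x :: (w ++ [x])) Set.univ := by
      rw [← ENNReal.tsum_mul_left]
      refine tsum_congr fun w => ?_
      rw [cycW, pathW_append, if_pos rfl]
      by_cases h0 : linkW C x w x = 0
      · simp [h0]
      have hw := linkW_support hC h0
      have hinv : ENNReal.ofReal (lam x) * ENNReal.ofReal (lam x)⁻¹ = 1 := by
        rw [← ENNReal.ofReal_mul (hlam x hx).le, mul_inv_cancel₀ (hlam x hx).ne',
          ENNReal.ofReal_one]
      rw [hmass _ (by simpa [or_comm] using hw)]
      have h4 : M (x :: (w ++ [x])) = M (x :: w) * ENNReal.ofReal (lam x)⁻¹ := by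
        simp [hM, mul_assoc]
      rw [h4, mul_left_comm, mul_left_comm (ENNReal.ofReal _), hinv, mul_one]
    rw [h3]
    gcongr
    rw [pathM_univ]
    conv_rhs => rw [tsum_list_append]
    refine le_trans ?_ le_add_self
    exact Finset.single_le_sum (f := fun z => ∑' w, pathW C x x (w ++ [z]) *
      wordM lam (x :: (w ++ [z])) Set.univ) (fun _ _ => zero_le) (Finset.mem_univ x)
  · intro x _ hx
    refine ENNReal.tsum_eq_zero.mpr fun w => ?_
    by_cases h0 : linkW C x w x = 0
    · rw [cycW, h0, zero_mul]
    · exact absurd (linkW_support hC h0 x List.mem_cons_self) hx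

theorem measure_univ_ne_top (h : IsTransient S C lam) : wordLoops ∅ C lam Set.univ ≠ ∞ := by
  refine ne_top_of_le_ne_top h.lintegral_length_ne_top ?_
  rw [← lintegral_one]
  refine lintegral_mono_ae ?_
  filter_upwards [ae_wordLoops_empty C lam] with l hl
  exact Nat.one_le_cast.mpr (by omega)

theorem measure_nontrivial_ne_top (h : IsTransient S C lam) :
    wordLoops S C lam {l | 2 ≤ Cycle.length l} ≠ ∞ := by
  have hB : MeasurableSet {l : Loop X | 2 ≤ Cycle.length l} :=
    measurable_length (measurableSet_Ici (a := 2))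
  rw [← lintegral_indicator_one hB, wordLoops_eq_add, lintegral_add_measure,
    lintegral_finsetSum_measure]
  refine ENNReal.add_ne_top.mpr ⟨ENNReal.sum_ne_top.mpr fun x _ => ?_, ?_⟩
  · rw [lintegral_map (measurable_one.indicator hB) (measurable_coe_singleton x)]
    simp
  · refine ne_top_of_le_ne_top h.measure_univ_ne_top ?_
    rw [← lintegral_one]
    exact lintegral_mono fun l => Set.indicator_le_self' (by simp) l

theorem lintegral_N_ne_top (h : IsTransient S C lam) (x y : X) :
    ∫⁻ l, (Loop.N x y l : ℝ≥0∞) ∂wordLoops S C lam ≠ ∞ := by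
  have hm : Measurable fun l : Loop X => (Loop.N x y l : ℝ≥0∞) :=
    (measurable_of_countable fun n : ℕ => (n : ℝ≥0∞)).comp (measurable_N x y)
  rw [wordLoops_eq_add, lintegral_add_measure, lintegral_finsetSum_measure]
  refine ENNReal.add_ne_top.mpr ⟨ENNReal.sum_ne_top.mpr fun z _ => ?_, ?_⟩
  · rw [lintegral_map hm (measurable_coe_singleton z)]
    simp [N_coe]
  · refine ne_top_of_le_ne_top h.lintegral_length_ne_top (lintegral_mono fun l => ?_)
    induction l using Quotient.inductionOn with
    | _ l =>
      refine Nat.cast_le.mpr ?_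
      change Loop.N x y (l : Loop X) ≤ l.length
      rw [N_coe]
      split_ifs
      · exact Nat.zero_le _
      · exact List.count_le_length.trans (by simp [wordSteps])

theorem lintegral_timeIn_ne_top (h : IsTransient S C lam) (F : Finset X) (hF : F ⊆ S) :
    ∫⁻ l, Loop.timeIn F l ∂wordLoops S C lam ≠ ∞ := by
  have h1 := lintegral_timeIn_wordLoops hF C h.diag lam (g := fun _ => 1) measurable_const
    fun _ _ _ _ _ => rfl
  simp only [mul_one, lintegral_one] at h1
  rw [h1]
  exact ENNReal.sum_ne_top.mpr fun x hx => h.path_ne_top x (hF hx)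

theorem lintegral_occ_ne_top (h : IsTransient S C lam) (x : X) :
    ∫⁻ l, ENNReal.ofReal (Loop.occ x l) ∂wordLoops S C lam ≠ ∞ := by
  have hm : Measurable fun l : Loop X => ENNReal.ofReal (Loop.occ x l) :=
    ENNReal.measurable_ofReal.comp (measurable_occ x)
  have h1 : ∀ l : List (X × ℝ), (∀ p ∈ l, 0 < p.2) → ENNReal.ofReal (Loop.occ x (l : Loop X)) =
      Loop.timeIn {x} (l : Loop X) := fun l hl => ofReal_occ x fun p hp => (hl p hp).le
  by_cases hx : x ∈ S
  · rw [lintegral_wordLoops_congr hm (measurable_timeIn {x})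
      (fun z _ t ht => h1 _ (by simpa using ht)) fun l hl _ => h1 l hl]
    exact h.lintegral_timeIn_ne_top {x} (by simpa using hx)
  · have h2 : ∀ l : List (X × ℝ), (∀ z ∈ l.map Prod.fst, z ∈ S) →
        ENNReal.ofReal (Loop.occ x (l : Loop X)) = 0 := by
      intro l hl
      rw [occ_coe, ENNReal.ofReal_eq_zero]
      refine (List.sum_eq_zero fun r hr => ?_).le
      obtain ⟨p, hp, rfl⟩ := List.mem_map.mp hr
      exact if_neg fun hpx : p.1 = x => hx (hpx ▸ hl _ (List.mem_map_of_mem hp))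
    rw [lintegral_wordLoops_congr hm (g := fun _ => 0) measurable_const
      (fun z hz t _ => h2 _ (by simpa using hz)) fun l _ hl => h2 l (loopW_support h.mem hl).2]
    simp

variable {C' ρ : X → X → ℝ≥0∞} {lam' δ : X → ℝ}

theorem tilt_singleton (ρ : X → X → ℝ≥0∞) (δ : X → ℝ) (x : X) (t : ℝ) :
    Loop.tilt ρ δ (([(x, t)] : List (X × ℝ)) : Loop X) = ENNReal.ofReal (Real.exp (-(δ x * t))) := by
  rw [tilt_coe]
  simp [weightedTime]

theorem lintegral_tilt_empty (h : IsTransient S C lam) (hC' : ∀ x y, C' x y = ρ x y * C x y)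
    (hlam : ∀ x ∈ S, lam' x = lam x + δ x) :
    ∫⁻ l, Loop.tilt ρ δ l ∂wordLoops ∅ C lam = wordLoops ∅ C' lam' Set.univ := by
  have h1 := lintegral_tilt_mul (Finset.empty_subset S) h.mem hC' hlam (f := fun _ => 1)
    measurable_const
  simpa using h1

/-- For trivial loops the singularity $1/t$ is compensated only after subtracting $1$, and
Frullani's integral gives a finite value. For non trivial loops the tilt itself is integrable, its
integral being the mass of the other loop measure. -/
theorem lintegral_tilt_sub_one_ne_top (h : IsTransient S C lam) (h' : IsTransient S C' lam')
    (hC' : ∀ x y, C' x y = ρ x y * C x y) (hlam : ∀ x ∈ S, lam' x = lam x + δ x) :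
    ∫⁻ l, (Loop.tilt ρ δ l - 1) ∂wordLoops S C lam ≠ ∞ := by
  have hm : Measurable fun l => Loop.tilt ρ δ l - 1 := (measurable_tilt ρ δ).sub_const 1
  rw [wordLoops_eq_add, lintegral_add_measure, lintegral_finsetSum_measure]
  refine ENNReal.add_ne_top.mpr ⟨ENNReal.sum_ne_top.mpr fun x hx => ?_, ?_⟩
  · rw [lintegral_map hm (measurable_coe_singleton x)]
    simp_rw [tilt_singleton]
    rw [lintegral_trivM_exp_sub_one (h.pos x hx) (hlam x hx ▸ h'.pos x hx)]
    exact ENNReal.ofReal_ne_top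
  · refine ne_top_of_le_ne_top (h'.measure_univ_ne_top) ?_
    rw [← h.lintegral_tilt_empty hC' hlam]
    exact lintegral_mono fun l => tsub_le_self

/-- The functional of the trivial loops. -/
theorem expDiff_trivial (h : IsTransient S C lam) (h' : IsTransient S C' lam')
    (hlam : ∀ x ∈ S, lam' x = lam x + δ x) (ρ : X → X → ℝ≥0∞) :
    expDiff (∑ x ∈ S, (trivM (lam x)).map fun t => ((([(x, t)] : List (X × ℝ))) : Loop X))
      (Loop.tilt ρ δ) = ∏ x ∈ S, ENNReal.ofReal (lam x / lam' x) := by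
  rw [expDiff_finsetSum]
  refine Finset.prod_congr rfl fun x hx => ?_
  rw [expDiff_map _ (measurable_coe_singleton x) (measurable_tilt ρ δ), hlam x hx]
  simp_rw [tilt_singleton]
  exact expDiff_trivM (h.pos x hx) (hlam x hx ▸ h'.pos x hx)

/-- The functional of the non trivial loops. -/
theorem expDiff_empty (h : IsTransient S C lam) (h' : IsTransient S C' lam')
    (hC' : ∀ x y, C' x y = ρ x y * C x y) (hlam : ∀ x ∈ S, lam' x = lam x + δ x) :
    expDiff (wordLoops ∅ C lam) (Loop.tilt ρ δ) =
      ep (wordLoops ∅ C' lam' Set.univ) * (ep (wordLoops ∅ C lam Set.univ))⁻¹ := by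
  have : IsFiniteMeasure (wordLoops ∅ C lam) := ⟨h.measure_univ_ne_top.lt_top⟩
  have h1 := h.lintegral_tilt_empty hC' hlam
  rw [expDiff_of_finite _ (measurable_tilt ρ δ) (by rw [h1]; exact h'.measure_univ_ne_top), h1]

theorem expDiff_wordLoops (h : IsTransient S C lam) (h' : IsTransient S C' lam')
    (hC' : ∀ x y, C' x y = ρ x y * C x y) (hlam : ∀ x ∈ S, lam' x = lam x + δ x) :
    expDiff (wordLoops S C lam) (Loop.tilt ρ δ) =
      (∏ x ∈ S, ENNReal.ofReal (lam x / lam' x)) *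
        (ep (wordLoops ∅ C' lam' Set.univ) * (ep (wordLoops ∅ C lam Set.univ))⁻¹) := by
  rw [wordLoops_eq_add, expDiff_add, h.expDiff_trivial h' hlam, h.expDiff_empty h' hC' hlam]

end IsTransient

end

/-! ### Traces of powers and determinants -/

section Spectral

variable {n : Type*} [Fintype n] [DecidableEq n]

theorem trace_pow_eq_sum_eigenvalues {A : Matrix n n ℝ} (hA : A.IsHermitian) (k : ℕ) :
    (A ^ k).trace = ∑ i, hA.eigenvalues i ^ k := by
  conv_lhs => rw [hA.spectral_theorem, ← map_pow, Matrix.diagonal_pow]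
  rw [Unitary.conjStarAlgAut_apply, Matrix.trace_mul_cycle, Unitary.coe_star_mul_self, one_mul,
    Matrix.trace_diagonal]
  simp

theorem det_one_sub_eq_prod {A : Matrix n n ℝ} (hA : A.IsHermitian) :
    (1 - A).det = ∏ i, (1 - hA.eigenvalues i) := by
  have h := A.eval_charpoly 1
  rw [hA.charpoly_eq, Polynomial.eval_prod] at h
  simpa using h.symm

/-- The logarithmic series is summed eigenvalue by eigenvalue. Its linear term is the trace, which
is zero, so the series may start at exponent $2$, the least length of a non trivial loop. -/
theorem hasSum_trace_pow {A : Matrix n n ℝ} (hA : A.IsHermitian) (h0 : A.trace = 0)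
    (h1 : ∀ i, |hA.eigenvalues i| < 1) :
    HasSum (fun k : ℕ => (A ^ (k + 2)).trace / (k + 2)) (-Real.log (1 - A).det) := by
  have h2 : ∀ i, HasSum (fun k : ℕ => hA.eigenvalues i ^ (k + 2) / ((k : ℝ) + 2))
      (-Real.log (1 - hA.eigenvalues i) - hA.eigenvalues i) := by
    intro i
    have h3 := Real.hasSum_pow_div_log_of_abs_lt_one (h1 i)
    rw [← hasSum_nat_add_iff' 1] at h3
    simp only [Finset.range_one, Finset.sum_singleton, zero_add, pow_one, Nat.cast_zero,
      div_one] at h3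
    refine h3.congr_fun fun k => ?_
    push_cast
    ring
  have h4 := hasSum_sum fun i (_ : i ∈ Finset.univ) => h2 i
  have h5 : ∑ i, hA.eigenvalues i = 0 := by
    have := trace_pow_eq_sum_eigenvalues hA 1
    simp only [pow_one] at this
    rw [← this, h0]
  rw [Finset.sum_sub_distrib, h5, sub_zero, Finset.sum_neg_distrib,
    ← Real.log_prod (fun i _ => ?_), ← det_one_sub_eq_prod] at h4
  · convert h4 using 2 with k
    rw [trace_pow_eq_sum_eigenvalues hA, Finset.sum_div]
  · have := abs_lt.mp (h1 i)
    linarith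

end Spectral

/-! ### Sums over words as traces of matrix powers -/

section WordSums

variable {X : Type*}

theorem tsum_length (f : List X → ℝ≥0∞) :
    ∑' w, f w = ∑' k : ℕ, ∑' w, if w.length = k then f w else 0 := by
  rw [ENNReal.tsum_comm]
  refine tsum_congr fun w => ?_
  rw [tsum_eq_single w.length fun k hk => if_neg hk.symm, if_pos rfl]

variable [Fintype X] [DecidableEq X]

theorem tsum_linkW (P : Matrix X X ℝ≥0∞) (k : ℕ) (x y : X) :
    (∑' w : List X, if w.length = k then linkW P x w y else 0) = (P ^ (k + 1)) x y := by
  induction k generalizing x with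
  | zero =>
    rw [tsum_eq_single [] fun w hw => if_neg (by simpa using hw), zero_add, pow_one]
    simp [linkW]
  | succ k ih =>
    rw [tsum_list_cons, pow_succ', Matrix.mul_apply, if_neg (by simp), zero_add]
    refine Finset.sum_congr rfl fun z _ => ?_
    rw [← ih, ← ENNReal.tsum_mul_left]
    refine tsum_congr fun w => ?_
    simp [linkW]

/-- Cyclic words of length $k+2$ based at $x$ have total weight $(P^{k+2})_{x,x}$; summing over the
base point gives the trace. -/
theorem tsum_loopW (P : Matrix X X ℝ≥0∞) :
    ∑' w, loopW P w = ∑' k : ℕ, (P ^ (k + 2)).trace / (k + 2 : ℕ) := by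
  rw [tsum_list_cons]
  have h0 : loopW P [] = 0 := by simp [loopW]
  have h1 : ∀ x, ∑' w, loopW P (x :: w) =
      ∑' k : ℕ, (P ^ (k + 2)) x x / (k + 2 : ℕ) := by
    intro x
    rw [tsum_length, tsum_eq_zero_add' ENNReal.summable]
    have h2 : (∑' w : List X, if w.length = 0 then loopW P (x :: w) else 0) = 0 := by
      refine ENNReal.tsum_eq_zero.mpr fun w => ?_
      split_ifs with h
      · unfold loopW
        rw [if_neg (by simp [h])]
      · rfl
    rw [h2, zero_add]
    refine tsum_congr fun k => ?_
    rw [← tsum_linkW P (k + 1) x x, div_eq_mul_inv, ← ENNReal.tsum_mul_right]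
    refine tsum_congr fun w => ?_
    split_ifs with h
    · unfold loopW
      rw [if_pos (by simp [h]), List.length_cons, h, div_eq_mul_inv]
      rfl
    · rw [zero_mul]
  simp_rw [h1]
  rw [h0, zero_add, ← Summable.tsum_finsetSum fun _ _ => ENNReal.summable]
  refine tsum_congr fun k => ?_
  simp only [Matrix.trace, Matrix.diag, div_eq_mul_inv, Finset.sum_mul]

theorem IsTransient.measure_univ {S : Finset X} {C : X → X → ℝ≥0∞} {lam : X → ℝ}
    (h : IsTransient S C lam) :
    wordLoops ∅ C lam Set.univ = ∑' w, loopW (fun x y => ENNReal.ofReal (lam x)⁻¹ * C x y) w := by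
  rw [← lintegral_one, lintegral_wordLoops_empty _ _ measurable_const]
  refine tsum_congr fun w => ?_
  rw [loopW_mul]
  by_cases h0 : loopW C w = 0
  · simp [h0]
  have hw := loopW_support h.mem h0
  rw [lintegral_wordM_map_fst (w := w) (fun x hx => h.pos x (hw.2 x hx)) fun _ => 1, one_mul,
    cycW_left _ (by rintro rfl; simp at hw), mul_comm]

end WordSums

/-! ### The loops that do not hit `F` -/

namespace Energy

variable {X : Type*} [Fintype X] [DecidableEq X] (e : Energy X) (F : Finset X)

/-- The conductances of the chain killed on `F`. -/
def offC (x y : X) : ℝ := if x ∉ F ∧ y ∉ F then e.C x y else 0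

/-- The conductances of the chain killed on `F`, with values in `[0, ∞]`. -/
def offCw (x y : X) : ℝ≥0∞ := if x ∉ F ∧ y ∉ F then e.Cw x y else 0

theorem offCw_eq (x y : X) : e.offCw F x y = ENNReal.ofReal (e.offC F x y) := by
  unfold offCw offC Cw
  split_ifs <;> simp

theorem offC_nonneg (x y : X) : 0 ≤ e.offC F x y := by
  unfold offC
  split_ifs
  · exact e.C_nonneg x y
  · exact le_rfl

theorem offC_symm (x y : X) : e.offC F x y = e.offC F y x := by
  unfold offC
  simp only [and_comm, e.C_symm x y]

theorem isTransient_off : IsTransient Fᶜ (e.offCw F) e.lam where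
  mem x y h := by
    unfold offCw at h
    split_ifs at h with h1
    · simpa using h1.2
    · exact absurd rfl h
  diag x := by simp [offCw, Cw, e.C_diag]
  pos x _ := e.lam_pos' x
  path_ne_top x _ := by
    refine ne_top_of_le_ne_top (pathM_univ_ne_top e x x) ?_
    rw [pathM_univ, pathM_univ]
    have h : ∀ w z, pathW (e.offCw F) x z w ≤ pathW e.Cw x z w := by
      intro w
      induction w with
      | nil => exact fun z => le_rfl
      | cons a w ih =>
        intro z
        refine mul_le_mul' ?_ (ih a)
        unfold offCw
        split_ifs
        · exact le_rfl
        · exact zero_le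
    exact ENNReal.tsum_le_tsum fun w => mul_le_mul_left (h w x) _

/-- The symmetrized transition matrix of the chain killed on `F`. -/
def symOff : Matrix X X ℝ :=
  Matrix.of fun x y => e.offC F x y / (Real.sqrt (e.lam x) * Real.sqrt (e.lam y))

theorem symOff_isHermitian : (e.symOff F).IsHermitian := by
  ext x y
  simp only [symOff, Matrix.conjTranspose_apply, Matrix.of_apply, star_trivial]
  rw [offC_symm, mul_comm]

/-- For a unit eigenvector $v$ with eigenvalue $s$, let $z=|v|/\sqrt\lambda$ on $D$ and $0$ on $F$.
As $C\ge0$, $|s|\le\langle z,Cz\rangle\le(1-\varepsilon)\sum\lambda z^2$, while $\sum\lambda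
z^2\le1$. The absolute values exclude the eigenvalue $-1$ as well as $1$. -/
theorem abs_eigenvalues_symOff_lt_one (i : X) :
    |(e.symOff_isHermitian F).eigenvalues i| < 1 := by
  obtain ⟨ε, hε, hgap⟩ := e.exists_gap
  set s := (e.symOff_isHermitian F).eigenvalues i
  set v : X → ℝ := ((e.symOff_isHermitian F).eigenvectorBasis i).ofLp with hv
  have hS : (e.symOff F).mulVec v = s • v := (e.symOff_isHermitian F).mulVec_eigenvectorBasis i
  have hv1 : ∑ x, v x ^ 2 = 1 := by
    have h := (e.symOff_isHermitian F).eigenvectorBasis.orthonormal.1 i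
    rw [EuclideanSpace.norm_eq, Real.sqrt_eq_one] at h
    simpa [hv] using h
  have hsq : ∀ x, Real.sqrt (e.lam x) ^ 2 = e.lam x := fun x => Real.sq_sqrt (e.lam_pos' x).le
  have hsp : ∀ x, 0 < Real.sqrt (e.lam x) := fun x => Real.sqrt_pos.mpr (e.lam_pos' x)
  let z : X → ℝ := fun x => if x ∉ F then |v x| / Real.sqrt (e.lam x) else 0
  have h1 : s = ∑ x, ∑ y, v x * (e.symOff F x y * v y) := by
    have h2 : ∀ x, ∑ y, e.symOff F x y * v y = s * v x := fun x => congrFun hS x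
    simp_rw [← Finset.mul_sum, h2]
    have h3 : ∀ x, v x * (s * v x) = s * v x ^ 2 := fun x => by ring
    simp_rw [h3, ← Finset.mul_sum, hv1, mul_one]
  have h2 : |s| ≤ ∑ x, z x * ∑ y, e.C x y * z y := by
    rw [h1]
    refine (Finset.abs_sum_le_sum_abs _ _).trans (Finset.sum_le_sum fun x _ => ?_)
    refine (Finset.abs_sum_le_sum_abs _ _).trans ?_
    rw [Finset.mul_sum]
    refine Finset.sum_le_sum fun y _ => le_of_eq ?_
    simp only [symOff, Matrix.of_apply, offC, z]
    by_cases hx : x ∈ F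
    · simp [hx]
    by_cases hy : y ∈ F
    · simp [hy]
    simp only [hx, hy, not_false_eq_true, and_self, if_true, abs_mul, abs_div,
      abs_of_nonneg (e.C_nonneg x y), abs_of_pos (hsp x), abs_of_pos (hsp y)]
    field_simp
  have h3 := hgap z
  simp only [mul_sub, Finset.sum_sub_distrib] at h3
  have h4 : ∑ x, z x * (e.lam x * z x) = ∑ x, e.lam x * z x ^ 2 :=
    Finset.sum_congr rfl fun x _ => by ring
  have h5 : ∑ x, e.lam x * z x ^ 2 ≤ 1 := by
    rw [← hv1]
    refine Finset.sum_le_sum fun x _ => ?_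
    simp only [z]
    by_cases hx : x ∈ F
    · simpa [hx] using sq_nonneg (v x)
    · rw [if_pos hx, div_pow, hsq, sq_abs, mul_div_cancel₀ _ (e.lam_pos' x).ne']
  have h6 : 0 ≤ ∑ x, e.lam x * z x ^ 2 :=
    Finset.sum_nonneg fun x _ => mul_nonneg (e.lam_pos' x).le (sq_nonneg _)
  rw [h4] at h3
  rcases h6.eq_or_lt with h7 | h7
  · rw [← h7] at h3
    linarith
  · have := mul_pos hε h7
    linarith

/-- Multiplying by the diagonal matrix $\sqrt\lambda$ on both sides gives $M_\lambda$ minus the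
killed conductances. This matrix splits into the diagonal block $\lambda$ on $F$ and `genOff` on
$D$. -/
theorem det_one_sub_symOff :
    (1 - e.symOff F).det = (e.genOff F).det / ∏ x ∈ Fᶜ, e.lam x := by
  have hsp : ∀ x, Real.sqrt (e.lam x) ≠ 0 := fun x => (Real.sqrt_pos.mpr (e.lam_pos' x)).ne'
  have hsq : ∀ x, Real.sqrt (e.lam x) * Real.sqrt (e.lam x) = e.lam x :=
    fun x => Real.mul_self_sqrt (e.lam_pos' x).le
  set R : Matrix X X ℝ := Matrix.diagonal fun x => Real.sqrt (e.lam x) with hR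
  have h1 : R * (1 - e.symOff F) * R = Matrix.diagonal e.lam - Matrix.of (e.offC F) := by
    ext x y
    rw [hR, Matrix.mul_diagonal, Matrix.diagonal_mul, Matrix.sub_apply, Matrix.sub_apply,
      Matrix.of_apply, symOff, Matrix.of_apply, mul_sub, sub_mul]
    congr 1
    · by_cases h : x = y
      · subst h
        simp [hsq]
      · simp [h]
    · have := hsp x
      have := hsp y
      field_simp
  have h2 : (Matrix.diagonal e.lam - Matrix.of (e.offC F)).det =
      (∏ x ∈ F, e.lam x) * (e.genOff F).det := by
    rw [Matrix.twoBlockTriangular_det _ (fun x => x ∈ F)]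
    · congr 1
      · have h4 : ∀ (_ : Fintype {x // x ∈ F}) (_ : DecidableEq {x // x ∈ F})
            (A : Matrix {x // x ∈ F} {x // x ∈ F} ℝ)
            (_ : ∀ x y, A x y = if x = y then e.lam x else 0), A.det = ∏ x ∈ F, e.lam x := by
          intro _ _ A hA
          have : A = Matrix.diagonal fun x : {x // x ∈ F} => e.lam x := by
            ext x y
            rw [hA, Matrix.diagonal_apply]
          rw [this, Matrix.det_diagonal, Finset.prod_subtype F (fun x => Iff.rfl) e.lam]
        refine h4 _ _ _ ?_
        intro x y
        simp only [Matrix.toSquareBlockProp, Matrix.toBlock_apply, Matrix.sub_apply,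
          Matrix.of_apply, offC, x.2, not_true_eq_false, false_and, if_false, sub_zero,
          Matrix.diagonal_apply, Subtype.ext_iff]
      · congr 1
        ext x y
        simp only [Matrix.toSquareBlockProp, Matrix.toBlock_apply, genOff, Matrix.submatrix_apply,
          Matrix.sub_apply, Matrix.of_apply, offC, x.2, y.2, not_false_eq_true, and_self, if_true]
    · intro x hx y hy
      have hxy : x ≠ y := fun h => hx (h ▸ hy)
      simp [hxy, offC, hy]
  have h3 := congrArg Matrix.det h1
  rw [Matrix.det_mul, Matrix.det_mul, h2, hR, Matrix.det_diagonal] at h3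
  have h4 : (∏ x, Real.sqrt (e.lam x)) * ∏ x, Real.sqrt (e.lam x) =
      (∏ x ∈ F, e.lam x) * ∏ x ∈ Fᶜ, e.lam x := by
    rw [← Finset.prod_mul_distrib, Finset.prod_mul_prod_compl]
    exact Finset.prod_congr rfl fun x _ => hsq x
  have h5 : ∏ x ∈ F, e.lam x ≠ 0 := Finset.prod_ne_zero_iff.mpr fun x _ => (e.lam_pos' x).ne'
  have h6 : ∏ x ∈ Fᶜ, e.lam x ≠ 0 := Finset.prod_ne_zero_iff.mpr fun x _ => (e.lam_pos' x).ne'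
  rw [eq_div_iff h6]
  apply mul_left_cancel₀ h5
  rw [← h3, mul_right_comm, h4]
  ring

/-- The transition matrix of the chain killed on `F`. -/
def transOff : Matrix X X ℝ := Matrix.of fun x y => (e.lam x)⁻¹ * e.offC F x y

/-- The two matrices are conjugate by $\sqrt\lambda$. The transition matrix carries the weights of
the loops, while its symmetrized form is the one to which the spectral theorem applies. -/
theorem trace_transOff_pow (k : ℕ) :
    (e.transOff F ^ k).trace = (e.symOff F ^ k).trace := by
  have hsp : ∀ x, Real.sqrt (e.lam x) ≠ 0 := fun x => (Real.sqrt_pos.mpr (e.lam_pos' x)).ne'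
  let R : (Matrix X X ℝ)ˣ :=
    ⟨Matrix.diagonal fun x => Real.sqrt (e.lam x), Matrix.diagonal fun x => (Real.sqrt (e.lam x))⁻¹,
      by simp [Matrix.diagonal_mul_diagonal, hsp], by simp [Matrix.diagonal_mul_diagonal, hsp]⟩
  have h : e.symOff F = (R : Matrix X X ℝ) * e.transOff F * ((R⁻¹ : (Matrix X X ℝ)ˣ) : Matrix X X ℝ) := by
    ext x y
    change _ = (Matrix.diagonal (fun x => Real.sqrt (e.lam x)) * e.transOff F *
      Matrix.diagonal fun x => (Real.sqrt (e.lam x))⁻¹) x y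
    rw [Matrix.mul_diagonal, Matrix.diagonal_mul, symOff, transOff, Matrix.of_apply,
      Matrix.of_apply]
    have h1 := hsp x
    have h2 := hsp y
    have h3 : (e.lam x)⁻¹ = (Real.sqrt (e.lam x))⁻¹ * (Real.sqrt (e.lam x))⁻¹ := by
      rw [← mul_inv, Real.mul_self_sqrt (e.lam_pos' x).le]
    rw [h3]
    field_simp
  rw [h, Units.conj_pow, Matrix.trace_units_conj]

theorem map_ofReal_pow {n : Type*} [Fintype n] [DecidableEq n] {Q : Matrix n n ℝ}
    (hQ : ∀ x y, 0 ≤ Q x y) (k : ℕ) :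
    (∀ x y, 0 ≤ (Q ^ k) x y) ∧ Q.map ENNReal.ofReal ^ k = (Q ^ k).map ENNReal.ofReal := by
  induction k with
  | zero =>
    constructor
    · intro x y
      rw [pow_zero, Matrix.one_apply]
      split_ifs <;> simp
    · ext x y
      simp only [pow_zero, Matrix.map_apply, Matrix.one_apply]
      split_ifs <;> simp
  | succ k ih =>
    constructor
    · intro x y
      rw [pow_succ, Matrix.mul_apply]
      exact Finset.sum_nonneg fun z _ => mul_nonneg (ih.1 x z) (hQ z y)
    · ext x y
      rw [pow_succ, pow_succ, ih.2, Matrix.mul_apply, Matrix.map_apply, Matrix.mul_apply,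
        ENNReal.ofReal_sum_of_nonneg fun z _ => mul_nonneg (ih.1 x z) (hQ z y)]
      exact Finset.sum_congr rfl fun z _ => (ENNReal.ofReal_mul (ih.1 x z)).symm

theorem Zoff_eq : e.Zoff F = ((e.genOff F).det)⁻¹ := by
  change ((e.genOff F)⁻¹).det = _
  rw [Matrix.det_nonsing_inv, Ring.inverse_eq_inv']

/-- The mass of the non trivial loops that do not hit `F`. -/
theorem ep_wordLoops_off :
    ep (wordLoops ∅ (e.offCw F) e.lam Set.univ) =
      ENNReal.ofReal ((∏ x ∈ Fᶜ, e.lam x) * e.Zoff F) := by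
  have hQ : ∀ x y, 0 ≤ e.transOff F x y := fun x y =>
    mul_nonneg (inv_nonneg.mpr (e.lam_pos' x).le) (e.offC_nonneg F x y)
  have h1 : (fun x y => ENNReal.ofReal (e.lam x)⁻¹ * e.offCw F x y) =
      (e.transOff F).map ENNReal.ofReal := by
    ext x y
    rw [Matrix.map_apply, transOff, Matrix.of_apply,
      ENNReal.ofReal_mul (inv_nonneg.mpr (e.lam_pos' x).le), offCw_eq]
  have h0 : (e.symOff F).trace = 0 :=
    Finset.sum_eq_zero fun x _ => by simp [symOff, offC, e.C_diag]
  -- The logarithmic series for the symmetrized matrix, whose trace vanishes since $C_{x,x}=0$; the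
  -- traces are then transferred to the transition matrix.
  have hs := hasSum_trace_pow (e.symOff_isHermitian F) h0 (e.abs_eigenvalues_symOff_lt_one F)
  simp_rw [← trace_transOff_pow] at hs
  have hn : ∀ k : ℕ, 0 ≤ (e.transOff F ^ (k + 2)).trace / (k + 2) := fun k =>
    div_nonneg (Finset.sum_nonneg fun x _ => (map_ofReal_pow hQ (k + 2)).1 x x) (by positivity)
  rw [(e.isTransient_off F).measure_univ, h1, tsum_loopW]
  have h2 : ∀ k : ℕ, ((e.transOff F).map ENNReal.ofReal ^ (k + 2)).trace / ((k + 2 : ℕ) : ℝ≥0∞) =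
      ENNReal.ofReal ((e.transOff F ^ (k + 2)).trace / (k + 2)) := by
    intro k
    rw [(map_ofReal_pow hQ (k + 2)).2, ENNReal.ofReal_div_of_pos (by positivity), Matrix.trace,
      Matrix.trace, ENNReal.ofReal_sum_of_nonneg]
    swap
    · exact fun x _ => (map_ofReal_pow hQ (k + 2)).1 x x
    congr 1
    rw [← ENNReal.ofReal_natCast]
    push_cast
    rfl
  simp_rw [h2]
  rw [← ENNReal.ofReal_tsum_of_nonneg hn hs.summable, hs.tsum_eq, ep_ofReal, det_one_sub_symOff,
    Zoff_eq, Real.exp_neg, Real.exp_log, inv_div, div_eq_mul_inv]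
  · have := Matrix.PosDef.det_pos (e.genOff_posDef F)
    exact div_pos this (Finset.prod_pos fun x _ => e.lam_pos' x)
  · rw [← hs.tsum_eq]
    exact tsum_nonneg hn

end Energy

/-! ### Two energies -/

namespace Energy

variable {X : Type*} [Fintype X] [DecidableEq X] (e e' : Energy X) (F : Finset X)

/-- The mass of the paths in the complement of `F` from `a` to the neighbours of `y`. -/
def exitMass (y : X) (a : {x // x ∉ F}) : ℝ :=
  ∑ b : {x // x ∉ F}, e.greenOff F a b * e.C b y

theorem exitMass_nonneg (y : X) (a : {x // x ∉ F}) : 0 ≤ e.exitMass F y a :=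
  Finset.sum_nonneg fun b _ => mul_nonneg (e.greenOff_nonneg F a b) (e.C_nonneg _ _)

theorem excursionMass_eq (x y : X) :
    e.excursionMass F x y = ∑ a : {x // x ∉ F}, e.C x a * e.exitMass F y a := by
  unfold excursionMass exitMass
  refine Finset.sum_congr rfl fun a _ => ?_
  rw [Finset.mul_sum]
  exact Finset.sum_congr rfl fun b _ => by ring

theorem lam_mul_exitMass (y : X) (a : {x // x ∉ F}) :
    e.lam a * e.exitMass F y a = e.C a y + ∑ b : {x // x ∉ F}, e.C a b * e.exitMass F y b := by
  have h1 := e.genOff_mulVec F (e.exitMass F y) a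
  have h2 : e.exitMass F y = (e.greenOff F).mulVec fun b => e.C b y := rfl
  rw [h2, Matrix.mulVec_mulVec, genOff_mul_greenOff, Matrix.one_mulVec, ← h2] at h1
  linarith

variable {e e'}

/-- The zero set of `e.exitMass F y` is closed under the links of `e` inside $D$ and has no link to
`y`, and the links of `e'` are among those of `e`. The maximum principle for `e'` then forces
`e'.exitMass F y` to vanish on that set. -/
theorem exitMass_eq_zero (hlink : ∀ x y, e.C x y = 0 → e'.C x y = 0) (y : X)
    {a : {x // x ∉ F}} (ha : e.exitMass F y a = 0) : e'.exitMass F y a = 0 := by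
  have hz : ∀ a : {x // x ∉ F}, e.exitMass F y a = 0 →
      e.C a y = 0 ∧ ∀ b : {x // x ∉ F}, e.C a b * e.exitMass F y b = 0 := by
    intro a ha
    have h := e.lam_mul_exitMass F y a
    have hn : ∀ b ∈ Finset.univ, 0 ≤ e.C a (b : {x // x ∉ F}) * e.exitMass F y b := fun b _ =>
      mul_nonneg (e.C_nonneg _ _) (e.exitMass_nonneg F y b)
    rw [ha, mul_zero] at h
    have h1 := Finset.sum_nonneg hn
    have h2 := e.C_nonneg a y
    exact ⟨by linarith, fun b =>
      (Finset.sum_eq_zero_iff_of_nonneg hn).mp (by linarith) b (Finset.mem_univ b)⟩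
  -- The candidate supersolution is minus the exit mass of `e'`, cut off to the zero set of the exit
  -- mass of `e`.
  set v : {x // x ∉ F} → ℝ := fun b => if e.exitMass F y b = 0 then -e'.exitMass F y b else 0 with hv
  have h := e'.nonneg_of_supersolution (extendOff F v) (fun x hx => ?_) a
  · rw [extendOff_coe] at h
    simp only [hv, ha, if_true] at h
    linarith [e'.exitMass_nonneg F y a]
  · by_cases hxF : x ∈ F
    · simp [extendOff, hxF] at hx
    rw [sum_extendOff F v (fun y r => e'.C x y * r) (by simp)]
    have h3 := extendOff_coe F v ⟨x, hxF⟩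
    simp only at h3
    rw [h3] at hx ⊢
    by_cases hx0 : e.exitMass F y ⟨x, hxF⟩ = 0
    · have h4 := e'.lam_mul_exitMass F y ⟨x, hxF⟩
      have h5 : ∀ b : {x // x ∉ F}, e'.C x b * v b = -(e'.C x b * e'.exitMass F y b) := by
        intro b
        simp only [hv]
        split_ifs with hb
        · ring
        · have := (mul_eq_zero.mp ((hz _ hx0).2 b)).resolve_right hb
          simp only at this
          rw [hlink _ _ this]
          ring
      simp only [hlink _ _ (hz _ hx0).1, zero_add] at h4
      simp_rw [h5]
      simp only [hv, hx0, if_true, Finset.sum_neg_distrib]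
      linarith
    · simp [hv, hx0] at hx

/-- Each term of the nonnegative sum defining the traced conductance vanishes, and each of these
zeros passes to `e'`. So the quotient of traced conductances is a genuine density even with $0/0=0$.
-/
theorem traceC_eq_zero (hlink : ∀ x y, e.C x y = 0 → e'.C x y = 0) {x y : X}
    (h : e.traceC F x y = 0) : e'.traceC F x y = 0 := by
  unfold traceC at h ⊢
  split_ifs at h ⊢ with hxy
  · rfl
  have h1 := e.C_nonneg x y
  have h2 := e.excursionMass_nonneg F x y
  rw [hlink x y (by linarith), zero_add, excursionMass_eq]
  have h3 : e.excursionMass F x y = 0 := by linarith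
  rw [excursionMass_eq] at h3
  have hn : ∀ a ∈ Finset.univ, 0 ≤ e.C x (a : {x // x ∉ F}) * e.exitMass F y a := fun b _ =>
    mul_nonneg (e.C_nonneg _ _) (e.exitMass_nonneg F y b)
  refine Finset.sum_eq_zero fun a ha => ?_
  rcases mul_eq_zero.mp ((Finset.sum_eq_zero_iff_of_nonneg hn).mp h3 a ha) with h4 | h4
  · rw [hlink _ _ h4, zero_mul]
  · rw [exitMass_eq_zero F hlink y h4, mul_zero]

variable (e e')

/-- The ratio of the conductances outside `F × F`. -/
def ratio (x y : X) : ℝ≥0∞ := if x ∈ F ∧ y ∈ F then 1 else ENNReal.ofReal (e'.C x y / e.C x y)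

/-- The difference of the masses. -/
def delta (x : X) : ℝ := e'.lam x - e.lam x

/-- The ratio of the conductances of the traces on `F`. -/
def traceRatio (x y : X) : ℝ≥0∞ :=
  if x ∈ F ∧ y ∈ F then ENNReal.ofReal (e'.traceC F x y / e.traceC F x y) else 1

/-- The difference of the masses of the traces on `F`. -/
def traceDelta (x : X) : ℝ := if x ∈ F then e'.traceLam F x - e.traceLam F x else 0

variable {e e' F}

theorem ratio_mul_Cw (hC : ∀ x ∈ F, ∀ y ∈ F, e'.C x y = e.C x y)
    (hlink : ∀ x y, e.C x y = 0 → e'.C x y = 0) (x y : X) :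
    e'.Cw x y = ratio e e' F x y * e.Cw x y := by
  unfold ratio Cw
  split_ifs with h
  · rw [one_mul, hC x h.1 y h.2]
  · rw [← ENNReal.ofReal_mul (div_nonneg (e'.C_nonneg _ _) (e.C_nonneg _ _)),
      div_mul_cancel_of_imp (hlink x y)]

theorem ratio_mul_offCw (hC : ∀ x ∈ F, ∀ y ∈ F, e'.C x y = e.C x y)
    (hlink : ∀ x y, e.C x y = 0 → e'.C x y = 0) (x y : X) :
    e'.offCw F x y = ratio e e' F x y * e.offCw F x y := by
  unfold offCw
  split_ifs
  · exact ratio_mul_Cw hC hlink x y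
  · rw [mul_zero]

theorem traceRatio_mul_traceCw (hlink : ∀ x y, e.C x y = 0 → e'.C x y = 0) (x y : X) :
    e'.traceCw F x y = traceRatio e e' F x y * e.traceCw F x y := by
  unfold traceRatio traceCw
  split_ifs with h
  · rw [← ENNReal.ofReal_mul (div_nonneg (e'.traceC_nonneg F _ _) (e.traceC_nonneg F _ _)),
      div_mul_cancel_of_imp (traceC_eq_zero F hlink)]
  · rw [one_mul]

theorem linkW_offCw (e : Energy X) {x y : X} {w : List X} (hx : x ∉ F) (hy : y ∉ F)
    (hw : ∀ z ∈ w, z ∉ F) : linkW (e.offCw F) x w y = linkW e.Cw x w y := by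
  induction w generalizing x with
  | nil => simp [linkW, offCw, hx, hy]
  | cons a w ih =>
    rw [List.forall_mem_cons] at hw
    rw [linkW, linkW, ih hw.1 hw.2, offCw, if_pos ⟨hx, hw.1⟩]

theorem loopW_offCw (e : Energy X) {w : List X} (hw : ∀ z ∈ w, z ∉ F) :
    loopW (e.offCw F) w = loopW e.Cw w := by
  unfold loopW
  rcases w with _ | ⟨x, w⟩
  · rfl
  · rw [List.forall_mem_cons] at hw
    rw [cycW, cycW, linkW_offCw e hw.1 hw.1 hw.2]

end Energy

/-! ### Loops that avoid `F` and loops that hit `F` -/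

section

variable {X : Type*} [Fintype X] [DecidableEq X]

theorem restrict_not_hits (e : Energy X) (F : Finset X) :
    (loopMeasure e).restrict {l | ∃ p ∈ l, p.1 ∈ F}ᶜ = wordLoops Fᶜ (e.offCw F) e.lam := by
  refine Measure.ext_of_lintegral _ fun f hf => ?_
  have hH := (measurableSet_hits (X := X) F).compl
  rw [← lintegral_indicator hH, loopMeasure_eq_wordLoops, lintegral_wordLoops _ _ _ (hf.indicator hH),
    lintegral_wordLoops _ _ _ hf]
  congr 1
  · rw [← Finset.sum_add_sum_compl F, Finset.sum_eq_zero, zero_add]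
    · refine Finset.sum_congr rfl fun x hx => lintegral_congr fun t => ?_
      exact Set.indicator_of_mem (s := {l : Loop X | ∃ p ∈ l, p.1 ∈ F}ᶜ) (by simpa using hx) _
    · intro x hx
      rw [lintegral_eq_zero_of_ae_eq_zero]
      refine Filter.Eventually.of_forall fun t => ?_
      exact Set.indicator_of_notMem (s := {l : Loop X | ∃ p ∈ l, p.1 ∈ F}ᶜ) (by simpa using hx) _
  · refine tsum_congr fun w => ?_
    by_cases hw : ∀ z ∈ w, z ∉ F
    · rw [Energy.loopW_offCw e hw]
      congr 1
      refine lintegral_congr_ae ?_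
      filter_upwards [ae_wordM_map_fst e.lam w] with l hl
      refine Set.indicator_of_mem (s := {l : Loop X | ∃ p ∈ l, p.1 ∈ F}ᶜ) ?_ _
      rintro ⟨p, hp, hpF⟩
      exact hw p.1 (hl ▸ List.mem_map_of_mem (Cycle.mem_coe_iff.mp hp)) hpF
    · have h1 : loopW (e.offCw F) w = 0 := by
        by_contra h0
        exact hw fun z hz => Finset.mem_compl.mp ((loopW_support (e.isTransient_off F).mem h0).2 z hz)
      rw [h1, zero_mul]
      refine mul_eq_zero_of_right _ (lintegral_eq_zero_of_ae_eq_zero ?_)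
      filter_upwards [ae_wordM_map_fst e.lam w] with l hl
      refine Set.indicator_of_notMem (s := {l : Loop X | ∃ p ∈ l, p.1 ∈ F}ᶜ) ?_ _
      push Not at hw
      obtain ⟨z, hz, hzF⟩ := hw
      rw [← hl] at hz
      obtain ⟨p, hp, rfl⟩ := List.mem_map.mp hz
      exact fun h => h ⟨p, Cycle.mem_coe_iff.mpr hp, hzF⟩

theorem map_trace (e : Energy X) (F : Finset X) :
    ((loopMeasure e).restrict {l | ∃ p ∈ l, p.1 ∈ F}).map (Loop.trace F) = traceLoops e F := by
  refine Measure.ext_of_lintegral _ fun f hf => ?_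
  rw [lintegral_map hf (measurable_trace F), lintegral_trace e F hf]

end

/-! ### The change of the energy and the trace -/

section TraceFunctional

variable {X : Type*} [Fintype X] [DecidableEq X] {e e' : Energy X} {F : Finset X}

/-- The multiplicative functional of a loop given by a functional of its trace. -/
def ofTrace (F : Finset X) (T : Loop X → ℝ≥0∞) (l : Loop X) : ℝ≥0∞ :=
  open scoped Classical in if ∃ p ∈ l, p.1 ∈ F then T (l.trace F) else 1

/-- A level function of loops, with level sets of finite measure. -/
def timeLevel (F : Finset X) (l : Loop X) : ℕ := ⌈((Loop.timeIn F l)⁻¹).toReal⌉₊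

theorem measurable_timeLevel (F : Finset X) : Measurable (timeLevel F : Loop X → ℕ) :=
  Nat.measurable_ceil.comp (measurable_timeIn F).inv.ennreal_toReal

theorem ae_traceLoops_timeIn (e : Energy X) (F : Finset X) :
    ∀ᵐ l ∂traceLoops e F, Loop.timeIn F l ≠ 0 ∧ Loop.timeIn F l ≠ ∞ := by
  have hm := measurable_timeIn (X := X) F
  refine ae_wordLoops ?_ (fun x hx t ht => ⟨?_, timeIn_ne_top F _⟩) fun l hl hw =>
    ⟨?_, timeIn_ne_top F _⟩
  · exact (hm (measurableSet_singleton 0).compl).inter (hm (measurableSet_singleton ∞).compl)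
  · exact (timeIn_ne_zero_iff F (by simpa using ht)).mpr (by simpa using hx)
  · have h := loopW_support (e.isTransient_trace F).mem hw
    rcases l with _ | ⟨p, l⟩
    · simp at h
    · exact (timeIn_ne_zero_iff F hl).mpr ⟨p, by simp, h.2 p.1 (by simp)⟩

/-- Markov's inequality: on level $j$ the time in $F$ satisfies $1\le j\cdot\mathrm{time}$, and this
time is integrable. -/
theorem traceLoops_timeLevel_ne_top (e : Energy X) (F : Finset X) (j : ℕ) :
    traceLoops e F {l | timeLevel F l = j} ≠ ∞ := by
  have hA : MeasurableSet {l : Loop X | timeLevel F l = j} :=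
    measurable_timeLevel F (measurableSet_singleton j)
  have hm := measurable_timeIn (X := X) F
  refine ne_top_of_le_ne_top (b := j * ∫⁻ l, Loop.timeIn F l ∂traceLoops e F)
    (ENNReal.mul_ne_top (ENNReal.natCast_ne_top j)
      ((e.isTransient_trace F).lintegral_timeIn_ne_top F subset_rfl)) ?_
  rw [← lintegral_indicator_one hA, ← lintegral_const_mul _ hm]
  refine lintegral_mono_ae ?_
  filter_upwards [ae_traceLoops_timeIn e F] with l hl
  refine Set.indicator_apply_le' (fun h => ?_) fun _ => zero_le
  have h1 : ((Loop.timeIn F l)⁻¹).toReal ≤ j := by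
    rw [← (show timeLevel F l = j from h)]
    exact Nat.le_ceil _
  have h2 : (Loop.timeIn F l)⁻¹ ≤ j := by
    rw [← ENNReal.ofReal_toReal (ENNReal.inv_ne_top.mpr hl.1), ← ENNReal.ofReal_natCast]
    exact ENNReal.ofReal_le_ofReal h1
  calc (1 : ℝ≥0∞) = (Loop.timeIn F l)⁻¹ * Loop.timeIn F l := (ENNReal.inv_mul_cancel hl.1 hl.2).symm
    _ ≤ _ := mul_le_mul_left h2 _

theorem lintegral_traceTilt_mul (hlink : ∀ x y, e.C x y = 0 → e'.C x y = 0)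
    {φ : Loop X → ℝ≥0∞} (hφ : Measurable φ) :
    ∫⁻ l, Loop.tilt (Energy.traceRatio e e' F) (Energy.traceDelta e e' F) l * φ l ∂traceLoops e F =
      ∫⁻ l, φ l ∂traceLoops e' F :=
  lintegral_tilt_mul subset_rfl (e.isTransient_trace F).mem
    (Energy.traceRatio_mul_traceCw hlink) (fun x hx => by simp [Energy.traceDelta, hx]) hφ

/-- Tilting first turns `e` into `e'`, and the trace of the loop measure of `e'` is then taken.
Together with `lintegral_traceTilt_mul`, where tracing precedes tilting, this gives the conditional
density given the trace. -/
theorem lintegral_tilt_hits_mul (hC : ∀ x ∈ F, ∀ y ∈ F, e'.C x y = e.C x y)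
    (hlink : ∀ x y, e.C x y = 0 → e'.C x y = 0) {φ : Loop X → ℝ≥0∞} (hφ : Measurable φ) :
    ∫⁻ l in {l | ∃ p ∈ l, p.1 ∈ F}, Loop.tilt (Energy.ratio e e' F) (Energy.delta e e') l *
      φ (l.trace F) ∂loopMeasure e = ∫⁻ l, φ l ∂traceLoops e' F := by
  have hH := measurableSet_hits (X := X) F
  have hφt := hφ.fun_comp (measurable_trace F)
  have h1 : ∀ e : Energy X, loopMeasure e = wordLoops Finset.univ e.Cw e.lam :=
    loopMeasure_eq_wordLoops
  rw [← lintegral_trace e' F hφ, ← lintegral_indicator hH, ← lintegral_indicator hH, h1, h1,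
    ← lintegral_tilt_mul subset_rfl e.isTransient.mem (Energy.ratio_mul_Cw hC hlink)
      (lam := e.lam) (δ := Energy.delta e e') (fun x _ => by simp [Energy.delta])
      (hφt.indicator hH)]
  exact lintegral_congr fun l => Set.indicator_mul_right _ _ _

/-- Trivial loops contribute $\prod_D\lambda/\lambda'$, and the exponentials of the masses of non
trivial loops have ratio $\prod_D(\lambda'/\lambda)\cdot\mathcal Z'/\mathcal Z$. The products of
masses cancel. -/
theorem expDiff_not_hits (hC : ∀ x ∈ F, ∀ y ∈ F, e'.C x y = e.C x y)
    (hlink : ∀ x y, e.C x y = 0 → e'.C x y = 0) :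
    expDiff ((loopMeasure e).restrict {l | ∃ p ∈ l, p.1 ∈ F}ᶜ)
      (Loop.tilt (Energy.ratio e e' F) (Energy.delta e e')) =
      ENNReal.ofReal (e'.Zoff F / e.Zoff F) := by
  have hp : ∀ e : Energy X, 0 < ∏ x ∈ Fᶜ, e.lam x := fun e =>
    Finset.prod_pos fun x _ => e.lam_pos' x
  have hz := e.Zoff_pos F
  have hz' := e'.Zoff_pos F
  rw [restrict_not_hits, (e.isTransient_off F).expDiff_wordLoops (e'.isTransient_off F)
    (Energy.ratio_mul_offCw hC hlink) (fun x _ => by simp [Energy.delta]),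
    e.ep_wordLoops_off, e'.ep_wordLoops_off,
    ← ENNReal.ofReal_prod_of_nonneg fun x _ => div_nonneg (e.lam_pos' x).le (e'.lam_pos' x).le,
    ← ENNReal.ofReal_inv_of_pos (mul_pos (hp e) hz),
    ← ENNReal.ofReal_mul (mul_pos (hp e') hz').le,
    ← ENNReal.ofReal_mul (Finset.prod_nonneg fun x _ =>
      div_nonneg (e.lam_pos' x).le (e'.lam_pos' x).le), Finset.prod_div_distrib]
  congr 1
  have h1 := (hp e).ne'
  have h2 := (hp e').ne'
  field_simp

/-- The change of the energy is transferred to the trace. -/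
theorem expDiff_ofTrace (hC : ∀ x ∈ F, ∀ y ∈ F, e'.C x y = e.C x y)
    (hlink : ∀ x y, e.C x y = 0 → e'.C x y = 0) {T : Loop X → ℝ≥0∞} (hT : Measurable T)
    (hT1 : ∀ l, T l ≤ 1) :
    expDiff (loopMeasure e)
        (fun l => Loop.tilt (Energy.ratio e e' F) (Energy.delta e e') l * ofTrace F T l) =
      ENNReal.ofReal (e'.Zoff F / e.Zoff F) * expDiff (traceLoops e F) (fun l =>
        Loop.tilt (Energy.traceRatio e e' F) (Energy.traceDelta e e' F) l * T l) := by
  have hH := measurableSet_hits (X := X) F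
  have hh := measurable_tilt (Energy.ratio e e' F) (Energy.delta e e')
  have hr := measurable_tilt (Energy.traceRatio e e' F) (Energy.traceDelta e e' F)
  have htr := measurable_trace (X := X) F
  have hA : ∀ j, MeasurableSet {l : Loop X | timeLevel F l = j} := fun j =>
    measurable_timeLevel F (measurableSet_singleton j)
  rw [expDiff_restrict _ hH, mul_comm]
  congr 1
  · rw [← expDiff_not_hits hC hlink]
    refine expDiff_congr_ae ?_
    filter_upwards [ae_restrict_mem hH.compl] with l hl
    rw [ofTrace, if_neg (show ¬ ∃ p ∈ l, p.1 ∈ F from hl), mul_one]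
  · rw [← map_trace, expDiff_map _ htr (hr.fun_mul hT)]
    rw [expDiff_congr_ae (G := fun l =>
      Loop.tilt (Energy.ratio e e' F) (Energy.delta e e') l * T (l.trace F))]
    swap
    · filter_upwards [ae_restrict_mem hH] with l hl
      rw [ofTrace, if_pos (show ∃ p ∈ l, p.1 ∈ F from hl)]
    -- Both densities, integrated against a function of the trace, give the traced loop measure of
    -- `e'`.
    have hfin : ∀ φ : Loop X → ℝ≥0∞, Measurable φ →
        ∫⁻ l in {l | ∃ p ∈ l, p.1 ∈ F}, Loop.tilt (Energy.ratio e e' F) (Energy.delta e e') l *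
          φ (l.trace F) ∂loopMeasure e = ∫⁻ l in {l | ∃ p ∈ l, p.1 ∈ F},
            Loop.tilt (Energy.traceRatio e e' F) (Energy.traceDelta e e' F) (l.trace F) *
            φ (l.trace F) ∂loopMeasure e := by
      intro φ hφ
      rw [lintegral_tilt_hits_mul hC hlink hφ, lintegral_trace e F (hr.fun_mul hφ),
        ← lintegral_traceTilt_mul hlink hφ]
    -- The measure of the loops that hit $F$ may be infinite because of short trivial loops; the
    -- level sets of the time spent in $F$ by the trace provide the finite pieces.
    refine expDiff_eq_of_lintegral_eq htr hh (hr.comp htr) hfin (measurable_timeLevel F)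
      (fun j => ?_) (fun j => ?_) hT hT1 ?_ ?_
    · have h1 := traceLoops_timeLevel_ne_top e F j
      rwa [← map_trace, Measure.map_apply htr (hA j)] at h1
    · rw [← lintegral_indicator (show MeasurableSet {l : Loop X | timeLevel F (l.trace F) = j} from
        htr (hA j))]
      have h1 := lintegral_tilt_hits_mul hC hlink (measurable_one.indicator (hA j))
      rw [lintegral_indicator_one (hA j)] at h1
      refine ne_of_eq_of_ne (Eq.trans (lintegral_congr fun l => ?_) h1)
        (traceLoops_timeLevel_ne_top e' F j)
      by_cases hl : timeLevel F (l.trace F) = j <;> simp [Set.indicator, hl]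
    · refine ne_top_of_le_ne_top (e.isTransient.lintegral_tilt_sub_one_ne_top e'.isTransient
        (Energy.ratio_mul_Cw hC hlink) (δ := Energy.delta e e')
        fun x _ => by simp [Energy.delta]) ?_
      exact lintegral_mono' ((Measure.restrict_le_self).trans (loopMeasure_eq_wordLoops e).le) le_rfl
    · have h1 := lintegral_trace e F (hr.sub_const 1)
      refine ne_of_eq_of_ne h1 ?_
      exact (e.isTransient_trace F).lintegral_tilt_sub_one_ne_top (e'.isTransient_trace F)
        (Energy.traceRatio_mul_traceCw hlink) fun x hx => by simp [Energy.traceDelta, hx]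

/-- The ratio of the conductances of the traces on `F`, for loops without holding times. -/
def Energy.discreteRatio (e e' : Energy X) (F : Finset X) (x y : X) : ℝ≥0∞ :=
  Energy.traceRatio e e' F x y * ENNReal.ofReal (e.traceLam F x / e'.traceLam F x)

/-- A functional of the non trivial loops without their holding times. -/
def ofDiscrete (T : Cycle X → ℝ≥0∞) (l : Loop X) : ℝ≥0∞ :=
  if 2 ≤ Cycle.length l then T l.discrete else 1

theorem measurable_discrete {β : Type*} [MeasurableSpace β] (T : Cycle X → β) :
    Measurable fun l : Loop X => T l.discrete := by
  rw [measurable_loop_iff]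
  exact measurable_of_map_fst (fun w : List X => T w)

theorem measurable_ofDiscrete (T : Cycle X → ℝ≥0∞) : Measurable (ofDiscrete T) :=
  Measurable.ite (measurable_length (measurableSet_Ici (a := 2))) (measurable_discrete T)
    measurable_const

/-- The trivial part of the measure being absent, `φ` may be replaced by $0$ on cycles of length at
most one, as `lintegral_tilt_discrete` requires. -/
theorem lintegral_discreteTilt_mul (e e' : Energy X) (F : Finset X) (φ : Cycle X → ℝ≥0∞) :
    ∫⁻ l, Loop.tilt (Energy.traceRatio e e' F) (Energy.traceDelta e e' F) l * φ l.discrete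
        ∂wordLoops ∅ (e.traceCw F) (e.traceLam F) =
      ∫⁻ l, Loop.tilt (Energy.discreteRatio e e' F) 0 l * φ l.discrete
        ∂wordLoops ∅ (e.traceCw F) (e.traceLam F) := by
  have ht := e.isTransient_trace F
  have ht' := e'.isTransient_trace F
  have hd : ∀ x ∈ F, e'.traceLam F x = e.traceLam F x + Energy.traceDelta e e' F x :=
    fun x hx => by simp [Energy.traceDelta, hx]
  set m := wordLoops ∅ (e.traceCw F) (e.traceLam F) with hm
  have hlen : ∀ᵐ l ∂m, 2 ≤ Cycle.length l := ae_wordLoops_empty _ _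
  have h1 : ∀ G : Loop X → ℝ≥0∞, ∫⁻ l, G l * φ l.discrete ∂m =
      ∫⁻ l, G l * (fun c : Cycle X => if c.length ≤ 1 then 0 else φ c) l.discrete ∂m := by
    intro G
    refine lintegral_congr_ae ?_
    filter_upwards [hlen] with l hl
    have h2 : ¬ l.discrete.length ≤ 1 := by
      induction l using Quotient.inductionOn with
      | _ l =>
        change 2 ≤ l.length at hl
        change ¬ (l.map Prod.fst).length ≤ 1
        rw [List.length_map]
        omega
    simp only [h2, if_false]
  rw [h1, h1]
  exact lintegral_tilt_discrete (Finset.empty_subset F) ht.mem ht.pos ht'.pos _ hd _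
    fun c hc => if_pos hc

/-- Trivial loops are invisible to `T` and to the discrete ratio, and contribute the product of mass
ratios. The non trivial ones have finite measure, so two densities with the same conditional density
given the discrete loop may be exchanged using a single level set. -/
theorem expDiff_discrete (hlink : ∀ x y, e.C x y = 0 → e'.C x y = 0) {T : Cycle X → ℝ≥0∞}
    (hT1 : ∀ l, T l ≤ 1) :
    expDiff (traceLoops e F) (fun l =>
        Loop.tilt (Energy.traceRatio e e' F) (Energy.traceDelta e e' F) l * ofDiscrete T l) =
      (∏ x ∈ F, ENNReal.ofReal (e.traceLam F x / e'.traceLam F x)) * expDiff (traceLoops e F)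
        (fun l => Loop.tilt (Energy.discreteRatio e e' F) 0 l * ofDiscrete T l) := by
  have ht := e.isTransient_trace F
  have ht' := e'.isTransient_trace F
  have hd : ∀ x ∈ F, e'.traceLam F x = e.traceLam F x + Energy.traceDelta e e' F x :=
    fun x hx => by simp [Energy.traceDelta, hx]
  have hh := measurable_tilt (Energy.traceRatio e e' F) (Energy.traceDelta e e' F)
  have hk := measurable_tilt (Energy.discreteRatio e e' F) 0
  have hD := measurable_ofDiscrete T
  have htriv : ∀ G G' : Loop X → ℝ≥0∞, Measurable G → Measurable G' →
      (∀ x t, G (([(x, t)] : List (X × ℝ)) : Loop X) = G' (([(x, t)] : List (X × ℝ)) : Loop X)) →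
      expDiff (∑ x ∈ F, (trivM (e.traceLam F x)).map
        fun t => ((([(x, t)] : List (X × ℝ))) : Loop X)) G =
      expDiff (∑ x ∈ F, (trivM (e.traceLam F x)).map
        fun t => ((([(x, t)] : List (X × ℝ))) : Loop X)) G' := by
    intro G G' hG hG' h
    rw [expDiff_finsetSum, expDiff_finsetSum]
    refine Finset.prod_congr rfl fun x _ => ?_
    rw [expDiff_map _ (measurable_coe_singleton x) hG, expDiff_map _ (measurable_coe_singleton x) hG']
    simp_rw [h]
  rw [traceLoops, wordLoops_eq_add, expDiff_add, expDiff_add,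
    htriv _ (Loop.tilt (Energy.traceRatio e e' F) (Energy.traceDelta e e' F)) (hh.fun_mul hD) hh
      (fun x t => by simp [ofDiscrete]),
    ht.expDiff_trivial ht' hd, htriv _ (fun _ => 1) (hk.fun_mul hD) measurable_const
      (fun x t => by rw [IsTransient.tilt_singleton]; simp [ofDiscrete]), expDiff_one, one_mul]
  congr 1
  set m := wordLoops ∅ (e.traceCw F) (e.traceLam F) with hm
  have hlen : ∀ᵐ l ∂m, 2 ≤ Cycle.length l := ae_wordLoops_empty _ _
  have hae : ∀ G : Loop X → ℝ≥0∞, expDiff m (fun l => G l * ofDiscrete T l) =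
      expDiff m (fun l => G l * T l.discrete) := fun G => expDiff_congr_ae <| by
    filter_upwards [hlen] with l hl
    rw [ofDiscrete, if_pos hl]
  rw [hae, hae]
  have key := lintegral_discreteTilt_mul e e' F
  have hmfin : m Set.univ ≠ ∞ := ht.measure_univ_ne_top
  have hhfin : ∫⁻ l, Loop.tilt (Energy.traceRatio e e' F) (Energy.traceDelta e e' F) l ∂m ≠ ∞ := by
    rw [ht.lintegral_tilt_empty (Energy.traceRatio_mul_traceCw hlink) hd]
    exact ht'.measure_univ_ne_top
  have hkfin : ∫⁻ l, Loop.tilt (Energy.discreteRatio e e' F) 0 l ∂m ≠ ∞ := by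
    have h1 := key fun _ => 1
    simp only [mul_one] at h1
    rwa [← h1]
  -- Discrete loops carry the discrete σ-algebra, so every functional of them is allowed.
  let _ : MeasurableSpace (Cycle X) := ⊤
  refine expDiff_eq_of_lintegral_eq (τ := Loop.discrete) (n := fun _ => 0)
    (measurable_discrete (fun c => c)) hh hk (fun φ _ => key φ) measurable_const (fun j => ?_)
    (fun j => ?_) (T := T) (fun _ _ => trivial) hT1 ?_ ?_
  · exact ne_top_of_le_ne_top hmfin (measure_mono (Set.subset_univ _))
  · exact ne_top_of_le_ne_top hhfin (setLIntegral_le_lintegral _ _)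
  · exact ne_top_of_le_ne_top hhfin (lintegral_mono fun l => tsub_le_self)
  · exact ne_top_of_le_ne_top hkfin (lintegral_mono fun l => tsub_le_self)

end TraceFunctional

/-! ### Densities of a set of loops -/

theorem inv_ep_sum {ι : Type*} (s : Finset ι) (f : ι → ℝ≥0∞) :
    (ep (∑ i ∈ s, f i))⁻¹ = ∏ i ∈ s, (ep (f i))⁻¹ := by
  classical
  induction s using Finset.induction_on with
  | empty => simp
  | insert i s hi ih => rw [Finset.sum_insert hi, Finset.prod_insert hi, inv_ep_add, ih]

theorem lp_ne_top {a : ℝ≥0∞} (ha : a ≠ ∞) : lp a ≠ ∞ := by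
  intro h
  have h1 := ep_lp a
  rw [h, ep_top] at h1
  exact (max_lt ENNReal.one_lt_top ha.lt_top).ne h1.symm

section TiltSums

variable {X : Type*} [Fintype X]

/-- The density `∏ ρ_p ^ n_p exp (- ∑ δ_x o_x)`. -/
def tiltVal (ρ : X → X → ℝ≥0∞) (δ : X → ℝ) (n : X × X → ℕ) (o : X → ℝ) : ℝ≥0∞ :=
  (∏ p : X × X, ρ p.1 p.2 ^ n p) * ENNReal.ofReal (Real.exp (-∑ x, δ x * o x))

/-- The sum of the positive terms of the logarithm of `tiltVal`. -/
def tiltPos (ρ : X → X → ℝ≥0∞) (δ : X → ℝ) (n : X × X → ℝ≥0∞) (o : X → ℝ≥0∞) : ℝ≥0∞ :=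
  ∑ p : X × X, lp (ρ p.1 p.2) * n p + ∑ x, ENNReal.ofReal (-δ x) * o x

/-- The sum of the negative terms of the logarithm of `tiltVal`. -/
def tiltNeg (ρ : X → X → ℝ≥0∞) (δ : X → ℝ) (n : X × X → ℝ≥0∞) (o : X → ℝ≥0∞) : ℝ≥0∞ :=
  ∑ p : X × X, lp (ρ p.1 p.2)⁻¹ * n p + ∑ x, ENNReal.ofReal (δ x) * o x

/-- The logarithm of each factor is split into positive and negative parts. For $\rho=0$ the
negative part is infinite, and $\infty\cdot0=0$ yields the convention $0^0=1$. -/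
theorem tiltVal_eq (ρ : X → X → ℝ≥0∞) (δ : X → ℝ) (n : X × X → ℕ) {o : X → ℝ} (ho : ∀ x, 0 ≤ o x) :
    ep (tiltPos ρ δ (fun p => n p) fun x => ENNReal.ofReal (o x)) *
      (ep (tiltNeg ρ δ (fun p => n p) fun x => ENNReal.ofReal (o x)))⁻¹ = tiltVal ρ δ n o := by
  rw [tiltPos, tiltNeg, tiltVal, ep_add, inv_ep_add, mul_mul_mul_comm, inv_ep_sum, inv_ep_sum,
    ep_sum, ep_sum, ← Finset.prod_mul_distrib, ← Finset.prod_mul_distrib]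
  congr 1
  · refine Finset.prod_congr rfl fun p _ => ?_
    rw [ep_mul_natCast, ep_mul_natCast, ENNReal.inv_pow, inv_ep_lp_inv, ep_lp, ← mul_pow,
      max_mul_min, one_mul]
  · rw [← Finset.sum_neg_distrib, Real.exp_sum, ENNReal.ofReal_prod_of_nonneg fun x _ =>
      (Real.exp_pos _).le]
    refine Finset.prod_congr rfl fun x _ => ?_
    rcases le_total 0 (δ x) with h | h
    · rw [ENNReal.ofReal_of_nonpos (p := -δ x) (by linarith), zero_mul, ep_zero, one_mul,
        ← ENNReal.ofReal_mul h, ep_ofReal (mul_nonneg h (ho x)),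
        ← ENNReal.ofReal_inv_of_pos (Real.exp_pos _), Real.exp_neg]
    · rw [ENNReal.ofReal_of_nonpos (p := δ x) h, zero_mul, ep_zero, inv_one, mul_one,
        ← ENNReal.ofReal_mul (by linarith),
        ep_ofReal (mul_nonneg (by linarith) (ho x)), neg_mul]

/-- A sum of integers over an infinite support has default value $0$ as a `finsum`; finiteness of `A
∩ B`, outside which the terms vanish, rules this out. -/
theorem tsum_finsum_natCast {S : Type*} (A : Set S) (n : S → ℕ) (B : Set S)
    (hfin : (A ∩ B).Finite) (hn : ∀ l ∉ B, n l = 0) :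
    ∑' l : A, (n l : ℝ≥0∞) = ((∑ᶠ l ∈ A, n l : ℕ) : ℝ≥0∞) := by
  rw [tsum_subtype A fun l => (n l : ℝ≥0∞),
    tsum_eq_sum (s := hfin.toFinset), finsum_mem_eq_sum_of_inter_support_eq (t := hfin.toFinset)]
  · rw [Nat.cast_sum]
    refine Finset.sum_congr rfl fun l hl => ?_
    exact Set.indicator_of_mem ((Set.Finite.mem_toFinset hfin).mp hl).1 _
  · ext l
    simp only [Set.mem_inter_iff, Function.mem_support, Set.Finite.coe_toFinset]
    constructor
    · exact fun h => ⟨⟨h.1, by_contra fun hB => h.2 (hn l hB)⟩, h.2⟩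
    · exact fun h => ⟨h.1.1, h.2⟩
  · intro l hl
    by_cases hA : l ∈ A
    · rw [Set.indicator_of_mem hA, hn l fun hB => hl ((Set.Finite.mem_toFinset hfin).mpr ⟨hA, hB⟩),
        Nat.cast_zero]
    · exact Set.indicator_of_notMem hA _

end TiltSums

/-! ### Densities of a loop and of a process of loops -/

section LoopSums

variable {X : Type*} [Fintype X] [DecidableEq X]

/-- The positive terms of the logarithm of `Loop.tilt`. -/
def Loop.tiltPos (ρ : X → X → ℝ≥0∞) (δ : X → ℝ) (l : Loop X) : ℝ≥0∞ :=
  MarkovLoops.tiltPos ρ δ (fun p => l.N p.1 p.2) fun x => ENNReal.ofReal (l.occ x)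

/-- The negative terms of the logarithm of `Loop.tilt`. -/
def Loop.tiltNeg (ρ : X → X → ℝ≥0∞) (δ : X → ℝ) (l : Loop X) : ℝ≥0∞ :=
  MarkovLoops.tiltNeg ρ δ (fun p => l.N p.1 p.2) fun x => ENNReal.ofReal (l.occ x)

theorem measurable_N_coe (x y : X) : Measurable fun l : Loop X => (Loop.N x y l : ℝ≥0∞) :=
  (measurable_of_countable fun n : ℕ => (n : ℝ≥0∞)).comp (measurable_N x y)

theorem measurable_ofReal_occ (x : X) : Measurable fun l : Loop X => ENNReal.ofReal (Loop.occ x l) :=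
  ENNReal.measurable_ofReal.comp (measurable_occ x)

theorem measurable_linear (c : X × X → ℝ≥0∞) (d : X → ℝ≥0∞) :
    Measurable fun l : Loop X =>
      ∑ p : X × X, c p * (Loop.N p.1 p.2 l : ℝ≥0∞) + ∑ x, d x * ENNReal.ofReal (Loop.occ x l) :=
  (Finset.measurable_sum _ fun p _ => (measurable_N_coe p.1 p.2).const_mul _).add
    (Finset.measurable_sum _ fun x _ => (measurable_ofReal_occ x).const_mul _)

theorem measurable_tiltPos (ρ : X → X → ℝ≥0∞) (δ : X → ℝ) : Measurable (Loop.tiltPos ρ δ) :=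
  measurable_linear _ _

theorem measurable_tiltNeg (ρ : X → X → ℝ≥0∞) (δ : X → ℝ) : Measurable (Loop.tiltNeg ρ δ) :=
  measurable_linear _ _

theorem occ_nonneg_of_pos (x : X) {l : Loop X} (hl : ∀ p ∈ l, 0 < p.2) : 0 ≤ l.occ x := by
  induction l using Quotient.inductionOn with
  | _ l => exact occ_nonneg x fun p hp => (hl p hp).le

theorem tilt_eq (ρ : X → X → ℝ≥0∞) (δ : X → ℝ) {l : Loop X} (hl : ∀ p ∈ l, 0 < p.2) :
    ep (Loop.tiltPos ρ δ l) * (ep (Loop.tiltNeg ρ δ l))⁻¹ = Loop.tilt ρ δ l :=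
  tiltVal_eq ρ δ _ fun x => occ_nonneg_of_pos x hl

theorem N_eq_zero_of_length_le {l : Loop X} (hl : Cycle.length l ≤ 1) (x y : X) : l.N x y = 0 :=
  if_pos hl

/-- A map of loops, such as the trace, with the moments that are finite for the loop measure. -/
structure IsLoopMap (ν : Measure (Loop X)) (θ : Loop X → Loop X) : Prop where
  measurable : Measurable θ
  length_le : ∀ l, Cycle.length l ≤ 1 → Cycle.length (θ l) ≤ 1
  pos : ∀ᵐ l ∂ν, ∀ p ∈ θ l, 0 < p.2
  N_ne_top : ∀ x y, ∫⁻ l, ((θ l).N x y : ℝ≥0∞) ∂ν ≠ ∞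
  occ_ne_top : ∀ x, ∫⁻ l, ENNReal.ofReal ((θ l).occ x) ∂ν ≠ ∞

variable {ν : Measure (Loop X)} {θ : Loop X → Loop X}

theorem lintegral_linear (m : Measure (Loop X)) (hθ : Measurable θ) (c : X × X → ℝ≥0∞)
    (d : X → ℝ≥0∞) :
    ∫⁻ l, (∑ p : X × X, c p * ((θ l).N p.1 p.2 : ℝ≥0∞) +
        ∑ x, d x * ENNReal.ofReal ((θ l).occ x)) ∂m =
      ∑ p : X × X, c p * ∫⁻ l, ((θ l).N p.1 p.2 : ℝ≥0∞) ∂m +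
        ∑ x, d x * ∫⁻ l, ENNReal.ofReal ((θ l).occ x) ∂m := by
  have hN : ∀ p : X × X, Measurable fun l => ((θ l).N p.1 p.2 : ℝ≥0∞) := fun p =>
    (measurable_N_coe p.1 p.2).comp hθ
  have hO : ∀ x, Measurable fun l => ENNReal.ofReal ((θ l).occ x) := fun x =>
    (measurable_ofReal_occ x).comp hθ
  rw [lintegral_add_left (Finset.measurable_sum _ fun p _ => (hN p).const_mul _),
    lintegral_finsetSum _ fun p _ => (hN p).const_mul _,
    lintegral_finsetSum _ fun x _ => (hO x).const_mul _]
  congr 1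
  · exact Finset.sum_congr rfl fun p _ => lintegral_const_mul _ (hN p)
  · exact Finset.sum_congr rfl fun x _ => lintegral_const_mul _ (hO x)

theorem IsLoopMap.lintegral_tiltPos_ne_top (h : IsLoopMap ν θ) {ρ : X → X → ℝ≥0∞}
    (hρ : ∀ x y, ρ x y ≠ ∞) (δ : X → ℝ) : ∫⁻ l, Loop.tiltPos ρ δ (θ l) ∂ν ≠ ∞ := by
  have h1 := lintegral_linear ν h.measurable (fun p => lp (ρ p.1 p.2))
    fun x => ENNReal.ofReal (-δ x)
  refine ne_of_eq_of_ne h1 (ENNReal.add_ne_top.mpr ⟨ENNReal.sum_ne_top.mpr fun p _ => ?_,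
    ENNReal.sum_ne_top.mpr fun x _ => ?_⟩)
  · exact ENNReal.mul_ne_top (lp_ne_top (hρ _ _)) (h.N_ne_top _ _)
  · exact ENNReal.mul_ne_top ENNReal.ofReal_ne_top (h.occ_ne_top x)

theorem tiltPos_ne_top {ρ : X → X → ℝ≥0∞} (hρ : ∀ x y, ρ x y ≠ ∞) (δ : X → ℝ) (l : Loop X) :
    Loop.tiltPos ρ δ l ≠ ∞ :=
  ENNReal.add_ne_top.mpr ⟨ENNReal.sum_ne_top.mpr fun _ _ =>
    ENNReal.mul_ne_top (lp_ne_top (hρ _ _)) (ENNReal.natCast_ne_top _),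
    ENNReal.sum_ne_top.mpr fun _ _ => ENNReal.mul_ne_top ENNReal.ofReal_ne_top ENNReal.ofReal_ne_top⟩

/-- The random density of a process of loops. -/
def processTilt (ρ : X → X → ℝ≥0∞) (δ : X → ℝ) (θ : Loop X → Loop X) (A : Set (Loop X)) : ℝ≥0∞ :=
  ep (∫⁻ l, Loop.tiltPos ρ δ (θ l) ∂pointMeasure A id) *
    (ep (∫⁻ l, Loop.tiltNeg ρ δ (θ l) ∂pointMeasure A id))⁻¹

/-- The left side is defined by sums in $[0,\infty]$, which always make sense and are measurable;
the right side uses real and integer sums with default values. They agree when non trivial loops are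
finite in number and occupation times are summable, which holds almost surely. -/
theorem processTilt_eq (hθ : Measurable θ) (ρ : X → X → ℝ≥0∞) (δ : X → ℝ) {A : Set (Loop X)}
    (hfin : {l | l ∈ A ∧ 2 ≤ Cycle.length l}.Finite)
    (hlen : ∀ l, Cycle.length l ≤ 1 → Cycle.length (θ l) ≤ 1)
    (hocc : ∀ x, ∀ l ∈ A, 0 ≤ (θ l).occ x) (hsum : ∀ x, Summable fun l : A => (θ l).occ x) :
    processTilt ρ δ θ A =
      tiltVal ρ δ (fun p => ∑ᶠ l ∈ A, (θ l).N p.1 p.2) fun x => ∑' l : A, (θ l).occ x := by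
  have hN : ∀ p : X × X, ∫⁻ l, ((θ l).N p.1 p.2 : ℝ≥0∞) ∂pointMeasure A id =
      ((∑ᶠ l ∈ A, (θ l).N p.1 p.2 : ℕ) : ℝ≥0∞) := by
    intro p
    rw [lintegral_pointMeasure _ _ ((measurable_N_coe p.1 p.2).fun_comp hθ)]
    refine tsum_finsum_natCast A (fun l => (θ l).N p.1 p.2) {l | 2 ≤ Cycle.length l} hfin
      fun l hl => N_eq_zero_of_length_le (hlen l ?_) _ _
    simpa using Nat.lt_of_not_le hl
  have hO : ∀ x : X, ∫⁻ l, ENNReal.ofReal ((θ l).occ x) ∂pointMeasure A id =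
      ENNReal.ofReal (∑' l : A, (θ l).occ x) := by
    intro x
    rw [lintegral_pointMeasure _ _ ((measurable_ofReal_occ x).fun_comp hθ)]
    exact (ENNReal.ofReal_tsum_of_nonneg (fun l : A => hocc x l.1 l.2) (hsum x)).symm
  rw [← tiltVal_eq ρ δ _ fun x => tsum_nonneg fun l : A => hocc x l.1 l.2, processTilt]
  have h1 := lintegral_linear (pointMeasure A id) hθ (fun p => lp (ρ p.1 p.2))
    fun x => ENNReal.ofReal (-δ x)
  have h2 := lintegral_linear (pointMeasure A id) hθ (fun p => lp (ρ p.1 p.2)⁻¹)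
    fun x => ENNReal.ofReal (δ x)
  simp_rw [hN, hO] at h1 h2
  exact congrArg₂ (fun a b => ep a * (ep b)⁻¹) h1 h2

variable {Ω : Type*} [MeasurableSpace Ω] {P : Measure Ω} {L : Ω → Set (Loop X)}

theorem measurableSet_pos : MeasurableSet {l : Loop X | ∀ p ∈ l, 0 < p.2} := by
  rw [measurableSet_loop_iff]
  exact measurableSet_forall_pos

/-- The process of loops has almost surely the properties under which its density is the product of
the densities of the loops. -/
theorem IsPoissonProcess.ae_loops [IsProbabilityMeasure P] (hL : IsPoissonProcess P ν L)
    (h : IsLoopMap ν θ) :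
    ∀ᵐ ω ∂P, (∀ x, ∀ l ∈ L ω, 0 ≤ (θ l).occ x) ∧ ∀ x, Summable fun l : L ω => (θ l).occ x := by
  have h1 : ∀ᵐ ω ∂P, L ω ∩ {l | ∀ p ∈ θ l, 0 < p.2}ᶜ = ∅ :=
    hL.ae_count_eq_zero (h.measurable measurableSet_pos).compl h.pos
  have h2 : ∀ᵐ ω ∂P, ∀ x, ∫⁻ l, ENNReal.ofReal ((θ l).occ x) ∂pointMeasure (L ω) id ≠ ∞ :=
    ae_all_iff.mpr fun x => hL.ae_lintegral_ne_top ((measurable_ofReal_occ x).comp h.measurable)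
      (h.occ_ne_top x)
  filter_upwards [h1, h2] with ω hω hω'
  have h3 : ∀ x, ∀ l ∈ L ω, 0 ≤ (θ l).occ x := fun x l hl => occ_nonneg_of_pos x <|
    not_not.mp fun hn => (Set.eq_empty_iff_forall_notMem.mp hω) l ⟨hl, hn⟩
  refine ⟨h3, fun x => ?_⟩
  have h4 := hω' x
  rw [lintegral_pointMeasure _ _ ((measurable_ofReal_occ x).fun_comp h.measurable)] at h4
  have h5 := ENNReal.summable_toReal h4
  refine h5.congr fun l => ?_
  exact ENNReal.toReal_ofReal (h3 x l l.2)

/-- The expectation of the density of a process of loops, with a further factor. -/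
theorem IsPoissonProcess.lintegral_processTilt [IsProbabilityMeasure P]
    (hL : IsPoissonProcess P ν L) (h : IsLoopMap ν θ) {ρ : X → X → ℝ≥0∞} (hρ : ∀ x y, ρ x y ≠ ∞)
    (δ : X → ℝ) (hfin : ∫⁻ l, (Loop.tilt ρ δ (θ l) - 1) ∂ν ≠ ∞) {W : Loop X → ℝ≥0∞}
    (hW : Measurable W) :
    ∫⁻ ω, processTilt ρ δ θ (L ω) * (ep (∫⁻ l, W l ∂pointMeasure (L ω) id))⁻¹ ∂P =
      expDiff ν fun l => Loop.tilt ρ δ (θ l) * (ep (W l))⁻¹ := by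
  have hp := (measurable_tiltPos ρ δ).fun_comp h.measurable
  have hn := (measurable_tiltNeg ρ δ).fun_comp h.measurable
  -- The additional factor is absorbed into the negative exponent.
  have hae : (fun l => ep (Loop.tiltPos ρ δ (θ l)) * (ep (Loop.tiltNeg ρ δ (θ l) + W l))⁻¹) =ᵐ[ν]
      fun l => Loop.tilt ρ δ (θ l) * (ep (W l))⁻¹ := by
    filter_upwards [h.pos] with l hl
    rw [inv_ep_add, ← mul_assoc, tilt_eq ρ δ hl]
  rw [← expDiff_congr_ae hae, ← hL.lintegral_prod hp (hn.fun_add hW) (fun l => tiltPos_ne_top hρ δ _)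
    (h.lintegral_tiltPos_ne_top hρ δ)]
  · refine lintegral_congr fun ω => ?_
    have h1 := lintegral_add_left (μ := pointMeasure (L ω) id) hn W
    rw [processTilt, mul_assoc, ← inv_ep_add]
    exact congrArg (fun a => _ * (ep a)⁻¹) h1.symm
  · refine ne_top_of_le_ne_top hfin (lintegral_mono_ae ?_)
    filter_upwards [hae] with l hl
    refine tsub_le_tsub_right (hl.le.trans ?_) 1
    exact mul_le_of_le_one_right' (ENNReal.inv_le_one.mpr (one_le_ep _))

end LoopSums

/-! ### The process of loops and the process of its traces -/

section TracePoints

variable {X : Type*} [DecidableEq X]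

theorem mem_mergeCons_fst {p q : X × ℝ} {l : List (X × ℝ)} (h : q ∈ mergeCons p l) :
    q.1 ∈ (p :: l).map Prod.fst := by
  rcases l with _ | ⟨r, l⟩
  · simp only [mergeCons, List.mem_singleton] at h
    simp [h]
  · rw [mergeCons] at h
    split_ifs at h with hpr
    · rcases List.mem_cons.mp h with rfl | h
      · simp
      · exact List.mem_map_of_mem (List.mem_cons_of_mem _ (List.mem_cons_of_mem _ h))
    · exact List.mem_map_of_mem h

theorem mem_mergeRuns_fst {q : X × ℝ} {l : List (X × ℝ)} (h : q ∈ mergeRuns l) :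
    q.1 ∈ l.map Prod.fst := by
  induction l generalizing q with
  | nil => simp [mergeRuns] at h
  | cons p l ih =>
    have h1 := mem_mergeCons_fst (l := mergeRuns l) h
    rw [List.map_cons, List.mem_cons] at h1 ⊢
    refine h1.imp_right fun h2 => ?_
    obtain ⟨r, hr, hrq⟩ := List.mem_map.mp h2
    exact hrq ▸ ih hr

theorem mem_mergeEnds_fst {q : X × ℝ} {l : List (X × ℝ)} (h : q ∈ mergeEnds l) :
    q.1 ∈ l.map Prod.fst := by
  rcases l with _ | ⟨p, l⟩
  · simp [mergeEnds] at h
  rcases List.eq_nil_or_concat l with rfl | ⟨m, c, rfl⟩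
  · simp only [mergeEnds, List.mem_singleton] at h
    simp [h]
  · rw [List.concat_eq_append, mergeEnds_cons_concat] at h
    rw [List.concat_eq_append]
    split_ifs at h with hpc
    · rcases List.mem_cons.mp h with rfl | h
      · simp
      · exact List.mem_map_of_mem (by simp [h])
    · exact List.mem_map_of_mem h

theorem mem_trace_fst {F : Finset X} {l : Loop X} {q : X × ℝ} (h : q ∈ l.trace F) :
    q.1 ∈ F ∧ ∃ p ∈ l, p.1 ∈ F := by
  induction l using Quotient.inductionOn with
  | _ l =>
    have h1 := mem_mergeEnds_fst (show q ∈ mergeEnds _ from h)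
    obtain ⟨r, hr, hrq⟩ := List.mem_map.mp h1
    have h2 := mem_mergeRuns_fst hr
    obtain ⟨s, hs, hsr⟩ := List.mem_map.mp h2
    rw [List.mem_filter] at hs
    have h3 : s.1 ∈ F := by simpa using hs.2
    exact ⟨by rwa [← hrq, ← hsr], s, hs.1, h3⟩

theorem trace_eq_nil {F : Finset X} {l : Loop X} (h : ¬ ∃ p ∈ l, p.1 ∈ F) :
    l.trace F = Cycle.nil := by
  generalize hl : l.trace F = l'
  induction l' using Quotient.inductionOn with
  | _ l' =>
    rcases l' with _ | ⟨p, l'⟩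
    · rfl
    · exact absurd (mem_trace_fst (F := F) (l := l) (q := p) (hl ▸ by
        change p ∈ ((p :: l' : List (X × ℝ)) : Cycle (X × ℝ))
        simp)).2 h

theorem N_eq_zero_of_notMem {l : Loop X} {x : X} (h : ∀ p ∈ l, p.1 ≠ x) (y : X) : l.N x y = 0 := by
  induction l using Quotient.inductionOn with
  | _ l =>
    change Loop.N x y (l : Loop X) = 0
    rw [N_coe]
    split_ifs
    · rfl
    · rw [List.count_eq_zero]
      intro h1
      have h2 := (List.of_mem_zip (by simpa [wordSteps, List.zip] using h1)).1
      obtain ⟨p, hp, hpx⟩ := List.mem_map.mp h2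
      exact h p hp hpx

theorem length_trace_le (F : Finset X) (l : Loop X) (hl : Cycle.length l ≤ 1) :
    Cycle.length (l.trace F) ≤ 1 := by
  induction l using Quotient.inductionOn with
  | _ l =>
    change l.length ≤ 1 at hl
    change (traceList F l).length ≤ 1
    rcases l with _ | ⟨p, _ | ⟨q, l⟩⟩
    · simp [traceList, mergeRuns, mergeEnds]
    · by_cases hp : p.1 ∈ F <;> simp [traceList, mergeRuns, mergeEnds, mergeCons, hp]
    · simp at hl

end TracePoints

/-! ### The identity and the trace as loop maps, and conditioning on counts -/

section LoopProcess

variable {X : Type*} [Fintype X] [DecidableEq X] {e e' : Energy X} {F : Finset X}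

theorem tilt_nil (ρ : X → X → ℝ≥0∞) (δ : X → ℝ) : Loop.tilt ρ δ Cycle.nil = 1 := by
  change Loop.tilt ρ δ (([] : List (X × ℝ)) : Loop X) = 1
  rw [tilt_coe]
  simp [weightedTime]

theorem occ_nil (x : X) : Loop.occ x (Cycle.nil : Loop X) = 0 := by
  change Loop.occ x (([] : List (X × ℝ)) : Loop X) = 0
  rw [occ_coe]
  simp

theorem N_nil (x y : X) : Loop.N x y (Cycle.nil : Loop X) = 0 := N_eq_zero_of_length_le (by simp) x y

/-- The integral of a functional of the trace that vanishes for the loops that do not hit `F`. -/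
theorem lintegral_comp_trace (e : Energy X) (F : Finset X) {f : Loop X → ℝ≥0∞} (hf : Measurable f)
    (h0 : f Cycle.nil = 0) : ∫⁻ l, f (l.trace F) ∂loopMeasure e = ∫⁻ l, f l ∂traceLoops e F := by
  rw [← lintegral_trace e F hf, ← lintegral_indicator (measurableSet_hits F)]
  refine lintegral_congr fun l => ?_
  by_cases hl : l ∈ {l : Loop X | ∃ p ∈ l, p.1 ∈ F}
  · rw [Set.indicator_of_mem hl]
  · rw [Set.indicator_of_notMem hl, trace_eq_nil hl, h0]

theorem ae_pos_wordLoops (S : Finset X) (C : X → X → ℝ≥0∞) (lam : X → ℝ) :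
    ∀ᵐ l ∂wordLoops S C lam, ∀ p ∈ l, 0 < p.2 :=
  ae_wordLoops measurableSet_pos (fun x _ t ht => by simpa using ht) fun l hl _ => hl

theorem isLoopMap_id (e : Energy X) (α : ℝ) : IsLoopMap (ENNReal.ofReal α • loopMeasure e) id where
  measurable := measurable_id
  length_le _ h := h
  pos := by
    refine Measure.ae_smul_measure ?_ _
    rw [loopMeasure_eq_wordLoops]
    exact ae_pos_wordLoops _ _ _
  N_ne_top x y := by
    rw [lintegral_smul_measure, loopMeasure_eq_wordLoops]
    exact ENNReal.mul_ne_top ENNReal.ofReal_ne_top (e.isTransient.lintegral_N_ne_top x y)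
  occ_ne_top x := by
    rw [lintegral_smul_measure, loopMeasure_eq_wordLoops]
    exact ENNReal.mul_ne_top ENNReal.ofReal_ne_top (e.isTransient.lintegral_occ_ne_top x)

theorem isLoopMap_trace (e : Energy X) (F : Finset X) (α : ℝ) :
    IsLoopMap (ENNReal.ofReal α • loopMeasure e) (Loop.trace F) where
  measurable := measurable_trace F
  length_le := length_trace_le F
  pos := by
    refine Measure.ae_smul_measure ?_ _
    have h := lintegral_comp_trace e F (f := {l : Loop X | ∀ p ∈ l, 0 < p.2}ᶜ.indicator 1)
      (measurable_one.indicator measurableSet_pos.compl)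
      (Set.indicator_of_notMem (not_not.mpr fun p hp => absurd hp (Cycle.notMem_nil p)) _)
    have h0 : traceLoops e F {l : Loop X | ∀ p ∈ l, 0 < p.2}ᶜ = 0 := ae_pos_wordLoops _ _ _
    rw [lintegral_indicator_one measurableSet_pos.compl, h0] at h
    rw [ae_iff, ← h]
    exact (lintegral_indicator_one (measurable_trace F measurableSet_pos.compl)).symm
  N_ne_top x y := by
    rw [lintegral_smul_measure, lintegral_comp_trace e F (measurable_N_coe x y) (by simp [N_nil])]
    exact ENNReal.mul_ne_top ENNReal.ofReal_ne_top ((e.isTransient_trace F).lintegral_N_ne_top x y)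
  occ_ne_top x := by
    rw [lintegral_smul_measure, lintegral_comp_trace e F (measurable_ofReal_occ x)
      (by simp [occ_nil])]
    exact ENNReal.mul_ne_top ENNReal.ofReal_ne_top ((e.isTransient_trace F).lintegral_occ_ne_top x)

/-- A loop that avoids $F$ has an empty trace, of density $1$, and so contributes nothing. -/
theorem expDiff_comp_trace (e : Energy X) (F : Finset X) {ρ : X → X → ℝ≥0∞} {δ : X → ℝ}
    {T : Loop X → ℝ≥0∞} (hT : Measurable T) :
    expDiff (loopMeasure e) (fun l => Loop.tilt ρ δ (l.trace F) * ofTrace F T l) =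
      expDiff (traceLoops e F) fun l => Loop.tilt ρ δ l * T l := by
  have hH := measurableSet_hits (X := X) F
  rw [expDiff_restrict _ hH, ← map_trace,
    expDiff_map _ (measurable_trace F) ((measurable_tilt ρ δ).fun_mul hT)]
  have h1 : expDiff ((loopMeasure e).restrict {l | ∃ p ∈ l, p.1 ∈ F}ᶜ)
      (fun l => Loop.tilt ρ δ (l.trace F) * ofTrace F T l) = 1 := by
    rw [← expDiff_one ((loopMeasure e).restrict {l | ∃ p ∈ l, p.1 ∈ F}ᶜ)]
    refine expDiff_congr_ae ?_
    filter_upwards [ae_restrict_mem hH.compl] with l hl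
    rw [ofTrace, if_neg (show ¬ ∃ p ∈ l, p.1 ∈ F from hl), trace_eq_nil hl, tilt_nil, one_mul]
  rw [h1, mul_one]
  refine expDiff_congr_ae ?_
  filter_upwards [ae_restrict_mem hH] with l hl
  rw [ofTrace, if_pos (show ∃ p ∈ l, p.1 ∈ F from hl)]

variable {Ω : Type*} [mΩ : MeasurableSpace Ω] {P : Measure Ω} {L : Ω → Set (Loop X)}
  {ν : Measure (Loop X)}

/-- A sum over the points of a process that satisfy a condition, and of a function of an image of
these points, is measurable for the σ-algebra of the images. -/
theorem measurable_lintegral_image {S S' : Type*} [MeasurableSpace S] [MeasurableSpace S']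
    {m : MeasurableSpace Ω} {A : Ω → Set S} {p : S → Prop} {f : S → S'}
    (h : ∀ B : Set S', MeasurableSet B →
      Measurable fun ω => {l | l ∈ A ω ∧ p l ∧ f l ∈ B}.encard)
    {u : S' → ℝ≥0∞} (hu : Measurable u) {v : S → ℝ≥0∞} (hv : Measurable v)
    (hp : ∀ l, p l → v l = u (f l)) (hn : ∀ l, ¬ p l → v l = 0) :
    Measurable fun ω => ∫⁻ l, v l ∂pointMeasure (A ω) id := by
  have h1 : ∀ ω, ∫⁻ l, v l ∂pointMeasure (A ω) id =
      ∫⁻ s, u s ∂pointMeasure {l | l ∈ A ω ∧ p l} f := by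
    intro ω
    rw [lintegral_pointMeasure _ _ hv, lintegral_pointMeasure _ _ hu]
    simp only [id]
    rw [tsum_subtype (A ω) v, tsum_subtype {l | l ∈ A ω ∧ p l} fun l => u (f l)]
    refine tsum_congr fun l => ?_
    by_cases hl : p l <;> by_cases hA : l ∈ A ω <;> simp [Set.indicator, hl, hA, hp, hn]
  simp_rw [h1]
  refine measurable_lintegral_pointMeasure (fun B hB => ?_) hu
  have h2 := h B hB
  simpa only [Set.mem_ofPred_eq, and_assoc] using h2

theorem measurable_processTilt_trace {m : MeasurableSpace Ω}
    (h : ∀ B : Set (Loop X), MeasurableSet B →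
      Measurable fun ω => {l | l ∈ L ω ∧ (∃ p ∈ l, p.1 ∈ F) ∧ l.trace F ∈ B}.encard)
    (ρ : X → X → ℝ≥0∞) (δ : X → ℝ) :
    Measurable fun ω => processTilt ρ δ (Loop.trace F) (L ω) := by
  have h0 : Loop.tiltPos ρ δ Cycle.nil = 0 ∧ Loop.tiltNeg ρ δ Cycle.nil = 0 := by
    simp [Loop.tiltPos, Loop.tiltNeg, tiltPos, tiltNeg, N_nil, occ_nil]
  refine Measurable.mul (measurable_ep.comp ?_) (measurable_ep.comp ?_).inv
  · exact measurable_lintegral_image h (measurable_tiltPos ρ δ)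
      ((measurable_tiltPos ρ δ).fun_comp (measurable_trace F)) (fun l _ => rfl)
      fun l hl => by rw [trace_eq_nil hl, h0.1]
  · exact measurable_lintegral_image h (measurable_tiltNeg ρ δ)
      ((measurable_tiltNeg ρ δ).fun_comp (measurable_trace F)) (fun l _ => rfl)
      fun l hl => by rw [trace_eq_nil hl, h0.2]

/-- Zero holding times are put back on the discrete loop as dummies, so that `Loop.N` can be read as
a function of the discrete loop. -/
theorem N_discrete (x y : X) (l : Loop X) :
    Loop.N x y (l.discrete.map fun z => (z, (0 : ℝ))) = l.N x y := by
  induction l using Quotient.inductionOn with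
  | _ l =>
    change Loop.N x y (((l.map Prod.fst).map fun z => (z, (0 : ℝ)) : List (X × ℝ)) : Loop X) =
      Loop.N x y (l : Loop X)
    rw [N_coe, N_coe]
    simp [Function.comp_def]

theorem measurable_processTilt_discrete {m : MeasurableSpace Ω}
    (h : ∀ B : Set (Cycle X), Measurable fun ω =>
      {l | l ∈ L ω ∧ 2 ≤ (l.trace F).length ∧ (l.trace F).discrete ∈ B}.encard)
    (ρ : X → X → ℝ≥0∞) :
    Measurable fun ω => processTilt ρ 0 (Loop.trace F) (L ω) := by
  let _ : MeasurableSpace (Cycle X) := ⊤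
  have hl : ∀ l : Loop X, ¬ 2 ≤ l.length → Loop.tiltPos ρ 0 l = 0 ∧ Loop.tiltNeg ρ 0 l = 0 := by
    intro l hl
    have hN := N_eq_zero_of_length_le (show l.length ≤ 1 by omega)
    simp [Loop.tiltPos, Loop.tiltNeg, tiltPos, tiltNeg, hN]
  have hd : ∀ l : Loop X,
      Loop.tiltPos ρ 0 l = Loop.tiltPos ρ 0 (l.discrete.map fun z => (z, (0 : ℝ))) ∧
      Loop.tiltNeg ρ 0 l = Loop.tiltNeg ρ 0 (l.discrete.map fun z => (z, (0 : ℝ))) := by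
    intro l
    simp [Loop.tiltPos, Loop.tiltNeg, tiltPos, tiltNeg, N_discrete]
  refine Measurable.mul (measurable_ep.comp ?_) (measurable_ep.comp ?_).inv
  · exact measurable_lintegral_image (fun B _ => h B)
      (u := fun c => Loop.tiltPos ρ 0 (c.map fun z => (z, (0 : ℝ)))) (fun _ _ => trivial)
      ((measurable_tiltPos ρ 0).fun_comp (measurable_trace F)) (fun l _ => (hd _).1)
      fun l h => (hl _ h).1
  · exact measurable_lintegral_image (fun B _ => h B)
      (u := fun c => Loop.tiltNeg ρ 0 (c.map fun z => (z, (0 : ℝ)))) (fun _ _ => trivial)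
      ((measurable_tiltNeg ρ 0).fun_comp (measurable_trace F)) (fun l _ => (hd _).2)
      fun l h => (hl _ h).2

theorem expDiff_ne_top {S : Type*} [MeasurableSpace S] {m : Measure S} {G : S → ℝ≥0∞}
    (h : ∫⁻ s, (G s - 1) ∂m ≠ ∞) : expDiff m G ≠ ∞ :=
  ENNReal.mul_ne_top (ep_ne_top h) (ENNReal.inv_ne_top.mpr (ep_ne_zero _))

theorem lintegral_processTilt_ne_top [IsProbabilityMeasure P] (hL : IsPoissonProcess P ν L)
    {θ : Loop X → Loop X} (h : IsLoopMap ν θ) {ρ : X → X → ℝ≥0∞} (hρ : ∀ x y, ρ x y ≠ ∞)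
    {δ : X → ℝ} (hfin : ∫⁻ l, (Loop.tilt ρ δ (θ l) - 1) ∂ν ≠ ∞) :
    ∫⁻ ω, processTilt ρ δ θ (L ω) ∂P ≠ ∞ := by
  have h1 := hL.lintegral_processTilt h hρ δ hfin (W := fun _ => 0) measurable_const
  simp only [lintegral_zero, ep_zero, inv_one, mul_one] at h1
  rw [h1]
  exact expDiff_ne_top hfin

theorem measurable_processTilt (hL : IsPoissonProcess P ν L) {θ : Loop X → Loop X}
    (hθ : Measurable θ) (ρ : X → X → ℝ≥0∞) (δ : X → ℝ) :
    Measurable fun ω => processTilt ρ δ θ (L ω) :=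
  (measurable_ep.comp (hL.measurable_lintegral ((measurable_tiltPos ρ δ).fun_comp hθ))).mul
    (measurable_ep.comp (hL.measurable_lintegral ((measurable_tiltNeg ρ δ).fun_comp hθ))).inv

/-- The conditional expectation of the density of a process of loops, given the numbers of loops in
some sets. -/
theorem condExp_processTilt [IsProbabilityMeasure P] (hL : IsPoissonProcess P ν L)
    {θ θ' : Loop X → Loop X} (h : IsLoopMap ν θ) (h' : IsLoopMap ν θ') {ρ ρ' : X → X → ℝ≥0∞}
    (hρ : ∀ x y, ρ x y ≠ ∞) (hρ' : ∀ x y, ρ' x y ≠ ∞) {δ δ' : X → ℝ} {c : ℝ≥0∞}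
    (hfin : ∫⁻ l, (Loop.tilt ρ δ (θ l) - 1) ∂ν ≠ ∞)
    (hfin' : ∫⁻ l, (Loop.tilt ρ' δ' (θ' l) - 1) ∂ν ≠ ∞)
    {ι : Type*} {S : ι → Set (Loop X)} (hS : ∀ i, MeasurableSet (S i))
    (hkey : ∀ (t : Finset ι) (k : ι → ℕ),
      expDiff ν (fun l => Loop.tilt ρ δ (θ l) * (ep (∑ i ∈ t, k i * (S i).indicator 1 l))⁻¹) =
        c * expDiff ν (fun l => Loop.tilt ρ' δ' (θ' l) *
          (ep (∑ i ∈ t, k i * (S i).indicator 1 l))⁻¹))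
    (hg : Measurable[⨆ i, MeasurableSpace.comap (fun ω => {l | l ∈ L ω ∧ l ∈ S i}.encard) ⊤]
      fun ω => processTilt ρ' δ' θ' (L ω)) :
    P[fun ω => (processTilt ρ δ θ (L ω)).toReal |
        ⨆ i, MeasurableSpace.comap (fun ω => {l | l ∈ L ω ∧ l ∈ S i}.encard) ⊤] =ᵐ[P]
      fun ω => (c * processTilt ρ' δ' θ' (L ω)).toReal := by
  refine condExp_ae_eq_of_exp_moments (fun i => hL.measurable_count (S i) (hS i))
    (measurable_processTilt hL h.measurable ρ δ) (hg.const_mul c)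
    (lintegral_processTilt_ne_top hL h hρ hfin) fun t k => ?_
  have hW : Measurable fun l : Loop X => ∑ i ∈ t, (k i : ℝ≥0∞) * (S i).indicator 1 l :=
    Finset.measurable_sum _ fun i _ => (measurable_one.indicator (hS i)).const_mul _
  -- The linear combination of counts is itself a sum over the loops, so its exponential is a
  -- multiplicative functional.
  have hsum : ∀ ω, ∑ i ∈ t, (k i : ℝ≥0∞) * ((L ω ∩ S i).encard : ℝ≥0∞) =
      ∫⁻ l, ∑ i ∈ t, (k i : ℝ≥0∞) * (S i).indicator 1 l ∂pointMeasure (L ω) id := by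
    intro ω
    rw [lintegral_finsetSum _ fun i _ => (measurable_one.indicator (hS i)).const_mul _]
    refine Finset.sum_congr rfl fun i _ => ?_
    rw [lintegral_const_mul _ (measurable_one.indicator (hS i)), lintegral_indicator_one (hS i),
      pointMeasure_apply _ _ (hS i)]
    rfl
  have hm : Measurable fun ω => processTilt ρ' δ' θ' (L ω) *
      (ep (∫⁻ l, ∑ i ∈ t, (k i : ℝ≥0∞) * (S i).indicator 1 l ∂pointMeasure (L ω) id))⁻¹ :=
    (measurable_processTilt hL h'.measurable ρ' δ').mul
      (measurable_ep.comp (hL.measurable_lintegral hW)).inv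
  simp only [hsum, mul_assoc]
  rw [lintegral_const_mul _ hm, hL.lintegral_processTilt h hρ δ hfin hW,
    hL.lintegral_processTilt h' hρ' δ' hfin' hW]
  exact hkey t k

end LoopProcess

/-! ### The conditional expectations -/

section Conditional

variable {X : Type*} [Fintype X] [DecidableEq X] {e e' : Energy X} {F : Finset X}
  {Ω : Type*} [mΩ : MeasurableSpace Ω] {P : Measure Ω} {L : Ω → Set (Loop X)} {α : ℝ}

theorem ratio_ne_top (x y : X) : Energy.ratio e e' F x y ≠ ∞ := by
  unfold Energy.ratio
  split_ifs <;> simp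

theorem traceRatio_ne_top (x y : X) : Energy.traceRatio e e' F x y ≠ ∞ := by
  unfold Energy.traceRatio
  split_ifs <;> simp

theorem discreteRatio_ne_top (x y : X) : Energy.discreteRatio e e' F x y ≠ ∞ :=
  ENNReal.mul_ne_top (traceRatio_ne_top x y) ENNReal.ofReal_ne_top

theorem lintegral_tilt_loop_ne_top (hC : ∀ x ∈ F, ∀ y ∈ F, e'.C x y = e.C x y)
    (hlink : ∀ x y, e.C x y = 0 → e'.C x y = 0) :
    ∫⁻ l, (Loop.tilt (Energy.ratio e e' F) (Energy.delta e e') l - 1)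
      ∂(ENNReal.ofReal α • loopMeasure e) ≠ ∞ := by
  rw [lintegral_smul_measure, loopMeasure_eq_wordLoops]
  exact ENNReal.mul_ne_top ENNReal.ofReal_ne_top
    (e.isTransient.lintegral_tilt_sub_one_ne_top e'.isTransient
      (Energy.ratio_mul_Cw hC hlink) (δ := Energy.delta e e') fun x _ => by simp [Energy.delta])

theorem lintegral_tilt_trace_ne_top {ρ : X → X → ℝ≥0∞} {δ : X → ℝ}
    (h : ∫⁻ l, (Loop.tilt ρ δ l - 1) ∂traceLoops e F ≠ ∞) :
    ∫⁻ l, (Loop.tilt ρ δ (l.trace F) - 1) ∂(ENNReal.ofReal α • loopMeasure e) ≠ ∞ := by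
  rw [lintegral_smul_measure, lintegral_comp_trace e F ((measurable_tilt ρ δ).sub_const 1)
    (by simp [tilt_nil])]
  exact ENNReal.mul_ne_top ENNReal.ofReal_ne_top h

theorem lintegral_discreteTilt_ne_top (hlink : ∀ x y, e.C x y = 0 → e'.C x y = 0) :
    ∫⁻ l, (Loop.tilt (Energy.discreteRatio e e' F) 0 l - 1) ∂traceLoops e F ≠ ∞ := by
  have ht := e.isTransient_trace F
  have ht' := e'.isTransient_trace F
  have hm := (measurable_tilt (Energy.discreteRatio e e' F) 0).sub_const 1
  rw [traceLoops, wordLoops_eq_add, lintegral_add_measure, lintegral_finsetSum_measure]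
  refine ENNReal.add_ne_top.mpr ⟨ENNReal.sum_ne_top.mpr fun x _ => ?_, ?_⟩
  · rw [lintegral_map hm (measurable_coe_singleton x)]
    simp [IsTransient.tilt_singleton]
  · refine ne_top_of_le_ne_top ?_ (lintegral_mono fun l => tsub_le_self)
    have h1 := lintegral_discreteTilt_mul e e' F fun _ => 1
    simp only [mul_one] at h1
    rw [← h1, ht.lintegral_tilt_empty (δ := Energy.traceDelta e e' F)
      (Energy.traceRatio_mul_traceCw hlink) (lam' := e'.traceLam F)
      fun x hx => by simp [Energy.traceDelta, hx]]
    exact ht'.measure_univ_ne_top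

theorem indicator_one_congr {ι S S' : Type*} {A : ι → Set S} {B : ι → Set S'} {s : S} {s' : S'}
    (h : ∀ i, s ∈ A i ↔ s' ∈ B i) (i : ι) :
    (A i).indicator (1 : S → ℝ≥0∞) s = (B i).indicator 1 s' := by
  by_cases hs : s ∈ A i
  · rw [Set.indicator_of_mem hs, Set.indicator_of_mem ((h i).mp hs), Pi.one_apply, Pi.one_apply]
  · rw [Set.indicator_of_notMem hs, Set.indicator_of_notMem fun h' => hs ((h i).mpr h')]

/-- The conditional expectation of the density given the traced loops. -/
theorem condExp_traced [IsProbabilityMeasure P] (hC : ∀ x ∈ F, ∀ y ∈ F, e'.C x y = e.C x y)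
    (hlink : ∀ x y, e.C x y = 0 → e'.C x y = 0) (hα : 0 < α)
    (hL : IsPoissonProcess P (ENNReal.ofReal α • loopMeasure e) L) :
    P[fun ω => (processTilt (Energy.ratio e e' F) (Energy.delta e e') id (L ω)).toReal |
        tracedSigma F L] =ᵐ[P]
      fun ω => (ENNReal.ofReal (e'.Zoff F / e.Zoff F) ^ α *
        processTilt (Energy.traceRatio e e' F) (Energy.traceDelta e e' F) (Loop.trace F)
          (L ω)).toReal := by
  let S : {B : Set (Loop X) // MeasurableSet B} → Set (Loop X) := fun B =>
    {l | (∃ p ∈ l, p.1 ∈ F) ∧ l.trace F ∈ B.1}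
  have hS : ∀ B, MeasurableSet (S B) := fun B =>
    (measurableSet_hits F).inter (measurable_trace F B.2)
  have hσ : tracedSigma F L =
      ⨆ B, MeasurableSpace.comap (fun ω => {l | l ∈ L ω ∧ l ∈ S B}.encard) ⊤ := iSup_subtype'
  rw [hσ]
  refine condExp_processTilt hL (isLoopMap_id e α) (isLoopMap_trace e F α) ratio_ne_top
    traceRatio_ne_top (lintegral_tilt_loop_ne_top hC hlink) (lintegral_tilt_trace_ne_top
      ((e.isTransient_trace F).lintegral_tilt_sub_one_ne_top (e'.isTransient_trace F)
        (Energy.traceRatio_mul_traceCw hlink) fun x hx => by simp [Energy.traceDelta, hx]))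
    hS (fun t k => ?_) ?_
  -- The exponential of the counts becomes a product over the loops of a functional of their traces,
  -- equal to $1$ for a loop that avoids $F$.
  · set T : Loop X → ℝ≥0∞ := fun l => (ep (∑ i ∈ t, k i * i.1.indicator 1 l))⁻¹ with hT
    have hTm : Measurable T := (measurable_ep.comp (Finset.measurable_sum _ fun i _ =>
      (measurable_one.indicator i.2).const_mul _)).inv
    have hW : ∀ l, (ep (∑ i ∈ t, (k i : ℝ≥0∞) * (S i).indicator 1 l))⁻¹ = ofTrace F T l := by
      intro l
      by_cases hl : ∃ p ∈ l, p.1 ∈ F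
      · rw [ofTrace, if_pos hl]
        simp_rw [indicator_one_congr fun i => show l ∈ S i ↔ l.trace F ∈ i.1 from and_iff_right hl]
        rfl
      · rw [ofTrace, if_neg hl, Finset.sum_eq_zero fun i _ => ?_, ep_zero, inv_one]
        rw [Set.indicator_of_notMem fun h => hl h.1, mul_zero]
    simp_rw [hW]
    rw [expDiff_smul _ hα, expDiff_smul _ hα, expDiff_comp_trace e F hTm,
      ← ENNReal.mul_rpow_of_nonneg _ _ hα.le, ← expDiff_ofTrace hC hlink hTm
        fun l => ENNReal.inv_le_one.mpr (one_le_ep _)]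
    rfl
  · refine measurable_processTilt_trace (fun B hB => ?_) _ _
    exact measurable_iff_comap_le.mpr (le_iSup (fun B =>
      MeasurableSpace.comap (fun ω => {l | l ∈ L ω ∧ l ∈ S B}.encard) ⊤) ⟨B, hB⟩)

/-- The conditional expectation of the density given the discrete traced loops. -/
theorem condExp_discreteTraced [IsProbabilityMeasure P]
    (hC : ∀ x ∈ F, ∀ y ∈ F, e'.C x y = e.C x y)
    (hlink : ∀ x y, e.C x y = 0 → e'.C x y = 0) (hα : 0 < α)
    (hL : IsPoissonProcess P (ENNReal.ofReal α • loopMeasure e) L) :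
    P[fun ω => (processTilt (Energy.ratio e e' F) (Energy.delta e e') id (L ω)).toReal |
        discreteTracedSigma F L] =ᵐ[P]
      fun ω => ((ENNReal.ofReal (e'.Zoff F / e.Zoff F) *
          ∏ x ∈ F, ENNReal.ofReal (e.traceLam F x / e'.traceLam F x)) ^ α *
        processTilt (Energy.discreteRatio e e' F) 0 (Loop.trace F) (L ω)).toReal := by
  let S : Set (Cycle X) → Set (Loop X) := fun B =>
    {l | 2 ≤ (l.trace F).length ∧ (l.trace F).discrete ∈ B}
  have hS : ∀ B, MeasurableSet (S B) := by
    intro B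
    have h1 : MeasurableSet {l : Loop X | l.discrete ∈ B} :=
      measurableSet_setOfPred.mpr (measurable_discrete fun c => c ∈ B)
    exact measurable_trace F ((measurable_length (measurableSet_Ici (a := 2))).inter h1)
  refine condExp_processTilt (S := S) hL (isLoopMap_id e α) (isLoopMap_trace e F α) ratio_ne_top
    discreteRatio_ne_top (lintegral_tilt_loop_ne_top hC hlink)
    (lintegral_tilt_trace_ne_top (lintegral_discreteTilt_ne_top hlink)) hS (fun t k => ?_) ?_
  · set T : Cycle X → ℝ≥0∞ := fun c => (ep (∑ i ∈ t, k i * i.indicator 1 c))⁻¹ with hT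
    have hT1 : ∀ c, T c ≤ 1 := fun c => ENNReal.inv_le_one.mpr (one_le_ep _)
    have hTm := measurable_ofDiscrete T
    have hW : ∀ l, (ep (∑ i ∈ t, (k i : ℝ≥0∞) * (S i).indicator 1 l))⁻¹ =
        ofTrace F (ofDiscrete T) l := by
      intro l
      by_cases hl : ∃ p ∈ l, p.1 ∈ F
      · rw [ofTrace, if_pos hl, ofDiscrete]
        split_ifs with h2
        · simp_rw [indicator_one_congr fun i =>
            show l ∈ S i ↔ (l.trace F).discrete ∈ i from and_iff_right h2]
          rfl
        · rw [Finset.sum_eq_zero fun i _ => ?_, ep_zero, inv_one]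
          rw [Set.indicator_of_notMem fun h => h2 h.1, mul_zero]
      -- The trace is then `Cycle.nil`, of length $0$, so no count sees this loop.
      · rw [ofTrace, if_neg hl]
        simp [S, Set.indicator, trace_eq_nil hl]
    simp_rw [hW]
    rw [expDiff_smul _ hα, expDiff_smul _ hα, expDiff_comp_trace e F hTm,
      ← ENNReal.mul_rpow_of_nonneg _ _ hα.le, mul_assoc, ← expDiff_discrete hlink hT1,
      ← expDiff_ofTrace hC hlink hTm]
    · rfl
    · intro l
      unfold ofDiscrete
      split_ifs
      · exact hT1 _
      · exact le_rfl
  · refine measurable_processTilt_discrete (fun B => ?_) _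
    exact measurable_iff_comap_le.mpr (le_iSup (fun B =>
      MeasurableSpace.comap (fun ω => {l | l ∈ L ω ∧ l ∈ S B}.encard) ⊤) B)

/-! ### The values of the densities -/

theorem toReal_tiltVal (ρ : X → X → ℝ≥0∞) (δ : X → ℝ) (n : X × X → ℕ) (o : X → ℝ) :
    (tiltVal ρ δ n o).toReal =
      (∏ p : X × X, (ρ p.1 p.2).toReal ^ n p) * Real.exp (-∑ x, δ x * o x) := by
  rw [tiltVal, ENNReal.toReal_mul, ENNReal.toReal_prod, ENNReal.toReal_ofReal (Real.exp_pos _).le]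
  simp_rw [ENNReal.toReal_pow]

theorem toReal_processTilt_loops (hlam : ∀ x ∈ F, e'.lam x = e.lam x) (n : X × X → ℕ) (o : X → ℝ) :
    (tiltVal (Energy.ratio e e' F) (Energy.delta e e') n o).toReal =
      (∏ p : X × X with ¬ (p.1 ∈ F ∧ p.2 ∈ F), (e'.C p.1 p.2 / e.C p.1 p.2) ^ n p) *
        Real.exp (-∑ x ∈ Fᶜ, o x * (e'.lam x - e.lam x)) := by
  rw [toReal_tiltVal, Finset.prod_filter]
  congr 1
  · refine Finset.prod_congr rfl fun p _ => ?_
    unfold Energy.ratio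
    by_cases h : p.1 ∈ F ∧ p.2 ∈ F
    · rw [if_pos h, if_neg (not_not.mpr h), ENNReal.toReal_one, one_pow]
    · rw [if_neg h, if_pos h,
        ENNReal.toReal_ofReal (div_nonneg (e'.C_nonneg _ _) (e.C_nonneg _ _))]
  · rw [← Finset.sum_subset (Finset.subset_univ Fᶜ)]
    · simp_rw [Energy.delta, mul_comm]
    · intro x _ hx
      rw [Energy.delta, hlam x (by simpa using hx), sub_self, zero_mul]

theorem prod_traceRatio (n : X × X → ℕ) :
    ∏ p : X × X, (Energy.traceRatio e e' F p.1 p.2).toReal ^ n p =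
      ∏ x ∈ F, ∏ y ∈ F, (e'.traceC F x y / e.traceC F x y) ^ n (x, y) := by
  rw [← Finset.prod_product' F F fun x y => (e'.traceC F x y / e.traceC F x y) ^ n (x, y),
    ← Finset.prod_subset (Finset.subset_univ (F ×ˢ F))]
  · refine Finset.prod_congr rfl fun p hp => ?_
    rw [Energy.traceRatio, if_pos (Finset.mem_product.mp hp),
      ENNReal.toReal_ofReal (div_nonneg (e'.traceC_nonneg F _ _) (e.traceC_nonneg F _ _))]
  · intro p _ hp
    rw [Energy.traceRatio, if_neg fun h => hp (Finset.mem_product.mpr h), ENNReal.toReal_one,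
      one_pow]

theorem toReal_processTilt_trace (n : X × X → ℕ) (o : X → ℝ) :
    (tiltVal (Energy.traceRatio e e' F) (Energy.traceDelta e e' F) n o).toReal =
      (∏ x ∈ F, ∏ y ∈ F, (e'.traceC F x y / e.traceC F x y) ^ n (x, y)) *
        ∏ x ∈ F, Real.exp (-(o x * (e'.traceLam F x - e.traceLam F x))) := by
  rw [toReal_tiltVal, prod_traceRatio, ← Real.exp_sum, Finset.sum_neg_distrib,
    ← Finset.sum_subset (Finset.subset_univ F)]
  · congr 3
    refine Finset.sum_congr rfl fun x hx => ?_
    rw [Energy.traceDelta, if_pos hx, mul_comm]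
  · intro x _ hx
    rw [Energy.traceDelta, if_neg hx, zero_mul]

/-- The ratio $\lambda_x/\lambda'_x$ attached to every jump out of $x$ occurs $N_x$ times; the
trivial loops add the exponent $\alpha$. Outside $F$ the counts vanish, so the default values of the
traced masses there play no role. -/
theorem toReal_processTilt_discrete (α : ℝ) (n : X × X → ℕ) (o : X → ℝ)
    (hn : ∀ x ∉ F, ∀ y, n (x, y) = 0) :
    (∏ x ∈ F, (e.traceLam F x / e'.traceLam F x)) ^ α *
        (tiltVal (Energy.discreteRatio e e' F) 0 n o).toReal =
      (∏ x ∈ F, ∏ y ∈ F, (e'.traceC F x y / e.traceC F x y) ^ n (x, y)) *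
        ∏ x ∈ F, (e.traceLam F x / e'.traceLam F x) ^ (((∑ y, n (x, y) : ℕ) : ℝ) + α) := by
  have hpos : ∀ x ∈ F, 0 < e.traceLam F x / e'.traceLam F x := fun x hx =>
    div_pos (traceLam_pos e hx) (traceLam_pos e' hx)
  have h1 : ∏ p : X × X, (ENNReal.ofReal (e.traceLam F p.1 / e'.traceLam F p.1)).toReal ^ n p =
      ∏ x ∈ F, (e.traceLam F x / e'.traceLam F x) ^ (∑ y, n (x, y)) := by
    rw [Fintype.prod_prod_type, ← Finset.prod_subset (Finset.subset_univ F)]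
    · refine Finset.prod_congr rfl fun x hx => ?_
      simp only [ENNReal.toReal_ofReal (hpos x hx).le, Finset.prod_pow_eq_pow_sum]
    · exact fun x _ hx => Finset.prod_eq_one fun y _ => by rw [hn x hx, pow_zero]
  rw [toReal_tiltVal]
  simp only [Energy.discreteRatio, ENNReal.toReal_mul, mul_pow, Finset.prod_mul_distrib, h1,
    prod_traceRatio, Pi.zero_apply, zero_mul, Finset.sum_const_zero, neg_zero, Real.exp_zero, mul_one]
  rw [← Real.finsetProd_rpow _ _ fun x hx => (hpos x hx).le, mul_left_comm,
    ← Finset.prod_mul_distrib]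
  congr 1
  refine Finset.prod_congr rfl fun x hx => ?_
  rw [Real.rpow_add (hpos x hx), Real.rpow_natCast, mul_comm]

end Conditional

end
end MarkovLoops

theorem mainTheorem10 {X : Type*} [Fintype X] [DecidableEq X]
    (e e' : Energy X) (F : Finset X)
    (hC : ∀ x ∈ F, ∀ y ∈ F, e'.C x y = e.C x y)
    (hlam : ∀ x ∈ F, e'.lam x = e.lam x)
    (hlink : ∀ x y, e.C x y = 0 → e'.C x y = 0)
    (α : ℝ) (hα : 0 < α)
    {Ω : Type*} [mΩ : MeasurableSpace Ω] (P : Measure Ω) [IsProbabilityMeasure P]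
    (L : Ω → Set (Loop X))
    (hL : IsPoissonProcess P (ENNReal.ofReal α • loopMeasure e) L)
    (Y : Ω → ℝ)
    (hY : ∀ ω, Y ω =
      (∏ p : X × X with ¬ (p.1 ∈ F ∧ p.2 ∈ F),
        (e'.C p.1 p.2 / e.C p.1 p.2) ^ totalN p.1 p.2 (L ω)) *
      Real.exp (-∑ x ∈ Fᶜ, totalOcc x (L ω) * (e'.lam x - e.lam x))) :
    (∀ᵐ ω ∂P, {l | l ∈ L ω ∧ 2 ≤ l.length}.Finite ∧
      ∀ x, Summable fun l : L ω => (l : Loop X).occ x) ∧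
    Integrable Y P ∧
    tracedSigma F L ≤ mΩ ∧ discreteTracedSigma F L ≤ mΩ ∧
    P[Y | tracedSigma F L] =ᵐ[P] (fun ω =>
      (e'.Zoff F / e.Zoff F) ^ α *
        ((∏ x ∈ F, ∏ y ∈ F,
            (e'.traceC F x y / e.traceC F x y) ^ traceN F x y (L ω)) *
          ∏ x ∈ F, Real.exp (-(traceOcc F x (L ω) * (e'.traceLam F x - e.traceLam F x))))) ∧
    P[Y | discreteTracedSigma F L] =ᵐ[P] (fun ω =>
      (e'.Zoff F / e.Zoff F) ^ α *
        ((∏ x ∈ F, ∏ y ∈ F,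
            (e'.traceC F x y / e.traceC F x y) ^ traceN F x y (L ω)) *
          ∏ x ∈ F,
            (e.traceLam F x / e'.traceLam F x) ^ ((traceVisits F x (L ω) : ℝ) + α))) := by
  have hbig : MeasurableSet {l : Loop X | 2 ≤ l.length} :=
    measurable_length (measurableSet_Ici (a := 2))
  have hfin : ∀ᵐ ω ∂P, {l | l ∈ L ω ∧ 2 ≤ l.length}.Finite := by
    have h1 : (ENNReal.ofReal α • loopMeasure e) {l : Loop X | 2 ≤ l.length} ≠ ⊤ := by
      rw [Measure.smul_apply, loopMeasure_eq_wordLoops]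
      exact ENNReal.mul_ne_top ENNReal.ofReal_ne_top e.isTransient.measure_nontrivial_ne_top
    filter_upwards [hL.ae_count_ne_top hbig h1] with ω hω
    exact Set.encard_ne_top_iff.mp hω
  have hid := isLoopMap_id e α
  have htr := isLoopMap_trace e F α
  -- The formula for `Y` uses default values of divergent sums, while the density of the process
  -- does not; they coincide almost surely.
  have hYae : (fun ω => (processTilt (Energy.ratio e e' F) (Energy.delta e e') id (L ω)).toReal)
      =ᵐ[P] Y := by
    filter_upwards [hfin, hL.ae_loops hid] with ω h1 h2
    rw [processTilt_eq hid.measurable _ _ h1 hid.length_le h2.1 h2.2,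
      toReal_processTilt_loops hlam, hY]
    rfl
  have hfinY := lintegral_processTilt_ne_top hL hid ratio_ne_top
    (lintegral_tilt_loop_ne_top (α := α) hC hlink)
  have hmY := measurable_processTilt hL hid.measurable (Energy.ratio e e' F) (Energy.delta e e')
  have hz : 0 < e'.Zoff F / e.Zoff F := div_pos (e'.Zoff_pos F) (e.Zoff_pos F)
  refine ⟨?_, ?_, ?_, ?_, ?_, ?_⟩
  · filter_upwards [hfin, hL.ae_loops hid] with ω h1 h2
    exact ⟨h1, h2.2⟩
  · exact (integrable_toReal_of_lintegral_ne_top hmY.aemeasurable hfinY).congr hYae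
  · exact iSup₂_le fun B hB => (hL.measurable_count _
      ((measurableSet_hits F).inter (measurable_trace F hB))).comap_le
  · refine iSup_le fun B => Measurable.comap_le ?_
    have h1 : MeasurableSet {l : Loop X | l.discrete ∈ B} :=
      measurableSet_setOfPred.mpr (measurable_discrete fun c => c ∈ B)
    exact hL.measurable_count _ (measurable_trace F (hbig.inter h1))
  · refine (condExp_congr_ae hYae.symm).trans ((condExp_traced hC hlink hα hL).trans ?_)
    filter_upwards [hfin, hL.ae_loops htr] with ω h1 h2
    rw [processTilt_eq htr.measurable _ _ h1 htr.length_le h2.1 h2.2, ENNReal.toReal_mul,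
      ENNReal.ofReal_rpow_of_pos hz, ENNReal.toReal_ofReal (Real.rpow_nonneg hz.le _),
      toReal_processTilt_trace]
    rfl
  · refine (condExp_congr_ae hYae.symm).trans ((condExp_discreteTraced hC hlink hα hL).trans ?_)
    filter_upwards [hfin, hL.ae_loops htr] with ω h1 h2
    have hpos : ∀ x ∈ F, 0 < e.traceLam F x / e'.traceLam F x := fun x hx =>
      div_pos (traceLam_pos e hx) (traceLam_pos e' hx)
    -- A traced loop has no points outside $F$, so such jumps are never counted.
    have hn : ∀ x ∉ F, ∀ y, traceN F x y (L ω) = 0 := fun x hx y =>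
      finsum_mem_eq_zero_of_forall_eq_zero fun l _ =>
        N_eq_zero_of_notMem (fun p hp (hpx : p.1 = x) => hx (hpx ▸ (mem_trace_fst hp).1)) y
    rw [processTilt_eq htr.measurable _ _ h1 htr.length_le h2.1 h2.2, ENNReal.toReal_mul,
      ← ENNReal.toReal_rpow, ENNReal.toReal_mul, ENNReal.toReal_ofReal hz.le, ENNReal.toReal_prod,
      Finset.prod_congr rfl fun x hx => ENNReal.toReal_ofReal (hpos x hx).le,
      Real.mul_rpow hz.le (Finset.prod_nonneg fun x hx => (hpos x hx).le), mul_assoc,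
      toReal_processTilt_discrete α _ _ hn]
    rfl
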